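/- Let $P_5=\mathbb F_2[x_1,\dots,x_5]$, graded with every $x_i$ in degree $1$ and regarded as a module over the mod-$2$ Steenrod algebra $\mathcal A$ (so $Sq^0=\mathrm{id}$, $Sq^1x_i=x_i^2$, $Sq^nx_i=0$ for $n>1$, and the Cartan formula holds). Let $\mathcal A^+P_5=\sum_{n\ge 1}Sq^n(P_5)$ be the subspace of hit polynomials, and let $GL_5=GL_5(\mathbb F_2)$ act on $P_5$ by linear substitutions of the variables. For a monomial $x=x_1^{\nu_1}\cdots x_5^{\nu_5}$ let $\omega_i(x)$, $i\ge1$, be the number of $j$ such that the coefficient of $2^{i-1}$ in the binary expansion of $\nu_j$ is $1$, and let $\omega(x)=(\omega_1(x),\omega_2(x),\dots)$ be its weight vector. Weight vectors and exponent vectors are ordered left-lexicographically. For monomials $x,y$ of the same degree, $x<y$ means that $\omega(x)<\omega(y)$, or $\omega(x)=\omega(y)$ and $(\nu_1(x),\dots,\nu_5(x))<(\nu_1(y),\dots,\nu_5(y))$. A monomial $x$ is inadmissible if $x+y_1+\cdots+y_t\in\mathcal A^+P_5$ for some monomials $y_1,\dots,y_t<x$ ($t\ge 0$), and admissible otherwise.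 For a sequence $\omega=(\omega_1,\omega_2,\dots)$ of non-negative integers, almost all zero, put $\deg\omega=\sum_i2^{i-1}\omega_i$. Let $P_5(\omega)$ (respectively $P_5^-(\omega)$) be the span of the monomials $y$ with $\deg y=\deg\omega$ and $\omega(y)\le\omega$ (respectively $\omega(y)<\omega$). Put $$QP_5(\omega)=P_5(\omega)/\big((\mathcal A^+P_5\cap P_5(\omega))+P_5^-(\omega)\big),$$ with the induced action of $GL_5$, and write $[f]_\omega$ for the class of $f\in P_5(\omega)$. Let $B_5(\omega)$ be the set of admissible monomials $x$ with $\omega(x)=\omega$. Let $\omega_{(4)}=(3,4,2,2)$ and $\omega_{(5)}=(3,4,4,1)$ (both of degree $35$), and let $a_t$, $161\le t\le 225$, be the monomials with the following exponent vectors $(\nu_1,\dots,\nu_5)$: $$\begin{aligned} a_{161}&:(1,2,7,11,14), & a_{162}&:(1,7,2,11,14), & a_{163}&:(1,7,11,2,14), & a_{164}&:(1,7,11,14,2), & a_{165}&:(7,1,2,11,14) \\ a_{166}&:(7,1,11,2,14), & a_{167}&:(7,1,11,14,2), & a_{168}&:(7,11,1,2,14), & a_{169}&:(7,11,1,14,2),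 & a_{170}&:(7,11,13,2,2) \\ a_{171}&:(1,3,6,11,14), & a_{172}&:(3,1,6,11,14), & a_{173}&:(1,3,7,10,14), & a_{174}&:(1,3,7,14,10), & a_{175}&:(1,7,3,10,14) \\ a_{176}&:(1,7,3,14,10), & a_{177}&:(3,1,7,10,14), & a_{178}&:(3,1,7,14,10), & a_{179}&:(3,7,1,10,14), & a_{180}&:(3,7,1,14,10) \\ a_{181}&:(7,1,3,10,14), & a_{182}&:(7,1,3,14,10), & a_{183}&:(7,3,1,10,14), & a_{184}&:(7,3,1,14,10), & a_{185}&:(1,7,11,6,10) \\ a_{186}&:(7,1,11,6,10), & a_{187}&:(7,11,1,6,10), & a_{188}&:(3,5,2,11,14), & a_{189}&:(3,5,11,2,14), & a_{190}&:(3,5,11,14,2) \\ a_{191}&:(3,7,9,2,14), & a_{192}&:(3,7,9,14,2), & a_{193}&:(7,3,9,2,14), & a_{194}&:(7,3,9,14,2), & a_{195}&:(3,7,13,2,10) \\ a_{196}&:(3,7,13,10,2), & a_{197}&:(7,3,13,2,10), & a_{198}&:(7,3,13,10,2), & a_{199}&:(7,11,5,2,10), & a_{200}&:(7,11,5,10,2)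 \\ a_{201}&:(3,3,5,10,14), & a_{202}&:(3,3,5,14,10), & a_{203}&:(3,5,3,10,14), & a_{204}&:(3,5,3,14,10), & a_{205}&:(3,3,13,6,10) \\ a_{206}&:(3,5,11,6,10), & a_{207}&:(3,7,5,10,10), & a_{208}&:(7,3,5,10,10), & a_{209}&:(3,7,9,6,10), & a_{210}&:(7,3,9,6,10) \end{aligned}$$ $$\begin{aligned} a_{211}&:(3,5,6,6,15), & a_{212}&:(3,5,6,15,6), & a_{213}&:(3,5,15,6,6), & a_{214}&:(3,15,5,6,6), & a_{215}&:(15,3,5,6,6) \\ a_{216}&:(3,5,6,7,14), & a_{217}&:(3,5,7,6,14), & a_{218}&:(3,5,7,14,6), & a_{219}&:(3,7,5,6,14), & a_{220}&:(3,7,5,14,6) \\ a_{221}&:(3,7,13,6,6), & a_{222}&:(7,3,5,6,14), & a_{223}&:(7,3,5,14,6), & a_{224}&:(7,3,13,6,6), & a_{225}&:(7,11,5,6,6) \end{aligned}$$ Then: (1) $B_5(\omega_{(4)})=\{a_t: 161\le t\le 210\}$; the classes $[a_t]_{\omega_{(4)}}$, $161\le t\le 210$, form a basis of the $\mathbb F_2$-vector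 space $QP_5(\omega_{(4)})$, so that $\dim QP_5(\omega_{(4)})=50$; and $QP_5(\omega_{(4)})$ is generated as a $GL_5$-module by $[a_{203}]_{\omega_{(4)}}$. (2) $B_5(\omega_{(5)})=\{a_t: 211\le t\le 225\}$; the classes $[a_t]_{\omega_{(5)}}$, $211\le t\le 225$, form a basis of the $\mathbb F_2$-vector space $QP_5(\omega_{(5)})$, so that $\dim QP_5(\omega_{(5)})=15$; and $QP_5(\omega_{(5)})$ is generated as a $GL_5$-module by $[a_{225}]_{\omega_{(5)}}$. -/

import Mathlib

open MvPolynomial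

namespace HitProblem

/-- The polynomial algebra `P_k = 𝔽₂[x_1, …, x_k]`. The variable `x_{i+1}` is `X i`, `i : Fin k`. -/
abbrev P (k : ℕ) : Type := MvPolynomial (Fin k) (ZMod 2)

/-- The monomial `x_1^{a_1} ⋯ x_k^{a_k}` with exponent vector `a`. Monomials are identified with
their exponent vectors. -/
noncomputable abbrev mono {k : ℕ} (a : Fin k →₀ ℕ) : P k := monomial a 1

section Steenrod

/-- The total Steenrod square `Sq = ∑ₙ Sqⁿ Tⁿ : P_k → P_k[T]`. By the Cartan formula it is the ring
homomorphism determined by `Sq(x_i) = x_i + x_i² T`, as every `x_i` has degree one. -/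
noncomputable def totalSq (k : ℕ) : P k →ₐ[ZMod 2] Polynomial (P k) :=
  aeval fun i => Polynomial.C (X i) + Polynomial.C (X i ^ 2) * Polynomial.X

/-- The Steenrod square `Sqⁿ : P_k → P_k`, the coefficient of `Tⁿ` in the total square. -/
noncomputable def sq (k n : ℕ) : P k →ₗ[ZMod 2] P k :=
  ((Polynomial.lcoeff (P k) n).restrictScalars (ZMod 2)) ∘ₗ (totalSq k).toLinearMap

/-- The space `𝒜⁺P_k` of hit polynomials. The augmentation ideal `𝒜⁺` of the Steenrod algebra is
spanned by the nonempty composites of the `Sqⁿ`, `n ≥ 1`, so that `𝒜⁺P_k` is the sum of the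
images of the `Sqⁿ` with `n ≥ 1`. -/
noncomputable def hit (k : ℕ) : Submodule (ZMod 2) (P k) :=
  ⨆ n ≥ 1, LinearMap.range (sq k n)

end Steenrod

section Weight

/-- The weight vector `ω(x)` of a monomial: `weight x i = ω_{i+1}(x)` is the number of exponents of
`x` whose `i`-th binary digit is one. Sequences `(ω_1, ω_2, …)` are indexed from `0` here. -/
noncomputable def weight {k : ℕ} (x : Fin k →₀ ℕ) : ℕ →₀ ℕ :=
  Finsupp.onFinset (Finset.range x.degree) (fun i => ∑ j, x j / 2 ^ i % 2) (by
    intro i hi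
    rw [Finset.mem_range]
    obtain ⟨j, -, hj⟩ := Finset.exists_ne_zero_of_sum_ne_zero hi
    have h1 : i < x j := by
      by_contra h
      rw [Nat.div_eq_of_lt (lt_of_le_of_lt (not_lt.mp h) Nat.lt_two_pow_self)] at hj
      exact hj rfl
    exact h1.trans_le (Finsupp.le_degree j x))

/-- `deg ω = ∑ 2^{i-1} ω_i`. -/
def wdeg (ω : ℕ →₀ ℕ) : ℕ := ω.sum fun i a => 2 ^ i * a

/-- `P_k(ω)`: the span of the monomials `y` with `deg y = deg ω` and `ω(y) ≤ ω` in the left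
lexicographical order. -/
noncomputable def PLe (k : ℕ) (ω : ℕ →₀ ℕ) : Submodule (ZMod 2) (P k) :=
  Submodule.span (ZMod 2) {f | ∃ y : Fin k →₀ ℕ, y.degree = wdeg ω ∧
    toLex (weight y) ≤ toLex ω ∧ f = mono y}

/-- `P_k⁻(ω)`: the span of the monomials `y` with `deg y = deg ω` and `ω(y) < ω`. -/
noncomputable def PLt (k : ℕ) (ω : ℕ →₀ ℕ) : Submodule (ZMod 2) (P k) :=
  Submodule.span (ZMod 2) {f | ∃ y : Fin k →₀ ℕ, y.degree = wdeg ω ∧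
    toLex (weight y) < toLex ω ∧ f = mono y}

/-- The order on monomials of the same degree: first by weight vector, then by exponent vector, both
in the left lexicographical order. -/
def MonoLT {k : ℕ} (x y : Fin k →₀ ℕ) : Prop :=
  x.degree = y.degree ∧ (toLex (weight x) < toLex (weight y) ∨
    (weight x = weight y ∧ toLex x < toLex y))

/-- `x` is inadmissible if `x + y_1 + ⋯ + y_t` is hit for some monomials `y_1, …, y_t < x`
(repeated `y_j` cancel in pairs, so they may be taken distinct). -/
def Inadmissible {k : ℕ} (x : Fin k →₀ ℕ) : Prop :=
  ∃ S : Finset (Fin k →₀ ℕ), (∀ y ∈ S, MonoLT y x) ∧ mono x + ∑ y ∈ S, mono y ∈ hit k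

/-- `B_k(ω)`: the admissible monomials with weight vector `ω`. -/
def admissibleMonomials (k : ℕ) (ω : ℕ →₀ ℕ) : Set (Fin k →₀ ℕ) :=
  {x | ¬ Inadmissible x ∧ weight x = ω}

end Weight

section Quotient

/-- The denominator `(𝒜⁺P_k ∩ P_k(ω)) + P_k⁻(ω)`, as a subspace of `P_k(ω)`. -/
noncomputable def relations (k : ℕ) (ω : ℕ →₀ ℕ) : Submodule (ZMod 2) (PLe k ω) :=
  ((hit k ⊓ PLe k ω) ⊔ PLt k ω).submoduleOf (PLe k ω)

/-- `QP_k(ω) = P_k(ω) / ((𝒜⁺P_k ∩ P_k(ω)) + P_k⁻(ω))`. -/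
abbrev QP (k : ℕ) (ω : ℕ →₀ ℕ) : Type := PLe k ω ⧸ relations k ω

/-- The class `[f]_ω` of `f ∈ P_k(ω)`. -/
noncomputable def cls {k : ℕ} {ω : ℕ →₀ ℕ} (f : P k) (hf : f ∈ PLe k ω) : QP k ω :=
  (relations k ω).mkQ ⟨f, hf⟩

end Quotient

section Action

/-- The algebra endomorphism of `P_k` extending the linear map of `⟨x_1, …, x_k⟩` with matrix `A` in
the basis `x_1, …, x_k`, i.e. `x_i ↦ ∑_j A_{ji} x_j`. -/
noncomputable def subst {k : ℕ} (A : Matrix (Fin k) (Fin k) (ZMod 2)) : P k →ₐ[ZMod 2] P k :=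
  aeval fun i => ∑ j, C (A j i) * X j

theorem subst_one (k : ℕ) : subst (1 : Matrix (Fin k) (Fin k) (ZMod 2)) = AlgHom.id _ _ := by
  apply MvPolynomial.algHom_ext
  intro i
  simp [subst, Matrix.one_apply]

theorem subst_mul {k : ℕ} (A B : Matrix (Fin k) (Fin k) (ZMod 2)) :
    subst (A * B) = (subst A).comp (subst B) := by
  apply MvPolynomial.algHom_ext
  intro i
  simp only [subst, Matrix.mul_apply, aeval_X, AlgHom.comp_apply, map_sum, map_mul,
    Finset.sum_mul, Finset.mul_sum]
  rw [Finset.sum_comm]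
  refine Finset.sum_congr rfl fun l _ => Finset.sum_congr rfl fun j _ => ?_
  rw [← algebraMap_eq, AlgHom.commutes]
  ring

/-- The action of `GL_k = GL_k(𝔽₂)` on `P_k` by linear substitution of the variables. -/
noncomputable def polyRep (k : ℕ) : Representation (ZMod 2) (GL (Fin k) (ZMod 2)) (P k) where
  toFun g := (subst (g : Matrix (Fin k) (Fin k) (ZMod 2))).toLinearMap
  map_one' := by
    rw [Units.val_one, subst_one]
    rfl
  map_mul' g h := by
    rw [Units.val_mul, subst_mul]
    rfl

theorem subst_sq {k : ℕ} (A : Matrix (Fin k) (Fin k) (ZMod 2)) (n : ℕ) (f : P k) :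
    subst A (sq k n f) = sq k n (subst A f) := by
  have key : (Polynomial.mapAlgHom (subst A)).comp (totalSq k) = (totalSq k).comp (subst A) := by
    apply MvPolynomial.algHom_ext
    intro i
    have hs : (∑ j, C (A j i) * X j : P k) ^ 2 = ∑ j, C (A j i) * X j ^ 2 := by
      rw [sum_pow_char 2]
      refine Finset.sum_congr rfl fun j _ => ?_
      rw [mul_pow, ← C_pow, ZMod.pow_card]
    have hc : ∀ a : ZMod 2, totalSq k (C a) = Polynomial.C (C a) := fun a => by
      rw [← algebraMap_eq, AlgHom.commutes]; rfl
    have hx : ∀ j, totalSq k (X j) = Polynomial.C (X j) + Polynomial.C (X j ^ 2) * Polynomial.X :=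
      fun j => by rw [totalSq, aeval_X]
    have hA : subst A (X i) = ∑ j, C (A j i) * X j := by rw [subst, aeval_X]
    rw [AlgHom.comp_apply, AlgHom.comp_apply, hA, hx]
    simp only [map_sum, map_mul, hc, hx, Polynomial.coe_mapAlgHom, Polynomial.map_add,
      Polynomial.map_mul, Polynomial.map_C, Polynomial.map_X, RingHom.coe_coe, hA, map_pow,
      mul_add, Finset.sum_add_distrib]
    have h2 : Polynomial.map (subst A : P k →+* P k) (Polynomial.C (X i) ^ 2)
        = ∑ j, Polynomial.C (C (A j i)) * Polynomial.C (X j) ^ 2 := by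
      rw [← Polynomial.C_pow, Polynomial.map_C, RingHom.coe_coe, map_pow, hA, hs]
      simp only [map_sum, map_mul, map_pow]
    refine congrArg₂ (· + ·) rfl ((congrArg (· * Polynomial.X) h2).trans ?_)
    simp only [Finset.sum_mul, mul_assoc]
  have h := congrArg (fun p => Polynomial.coeff p n) (DFunLike.congr_fun key f)
  simpa [sq] using h

theorem subst_mem_hit {k : ℕ} (A : Matrix (Fin k) (Fin k) (ZMod 2)) {f : P k} (hf : f ∈ hit k) :
    subst A f ∈ hit k := by
  have : hit k ≤ (hit k).comap (subst A).toLinearMap := by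
    refine iSup₂_le fun n hn => ?_
    rintro _ ⟨g, rfl⟩
    change subst A (sq k n g) ∈ hit k
    rw [subst_sq]
    exact (le_iSup₂ (f := fun n (_ : n ≥ 1) => LinearMap.range (sq k n)) n hn) ⟨_, rfl⟩
  exact this hf

theorem weight_apply {k : ℕ} (x : Fin k →₀ ℕ) (i : ℕ) : weight x i = ∑ j, x j / 2 ^ i % 2 := rfl

theorem lex_le_of_head {a b : ℕ →₀ ℕ} (h0 : a 0 ≤ b 0)
    (h : a 0 = b 0 → ∃ a' b' : ℕ →₀ ℕ, (∀ i, a (i + 1) = a' i) ∧ (∀ i, b (i + 1) = b' i) ∧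
      toLex a' ≤ toLex b') : toLex a ≤ toLex b := by
  rcases h0.lt_or_eq with h0 | h0
  · exact le_of_lt (Finsupp.Lex.lt_iff.2 ⟨0, fun j hj => absurd hj (Nat.not_lt_zero j), h0⟩)
  · obtain ⟨a', b', ha, hb, hab⟩ := h h0
    rcases hab.lt_or_eq with hlt | heq
    · obtain ⟨i, hi, hi'⟩ := Finsupp.Lex.lt_iff.1 hlt
      refine le_of_lt (Finsupp.Lex.lt_iff.2 ⟨i + 1, fun j hj => ?_, ?_⟩)
      · cases j with
        | zero => exact h0
        | succ j => simpa [ha, hb] using hi j (by omega)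
      · simpa [ha, hb] using hi'
    · have hab' : a' = b' := toLex.injective heq
      subst hab'
      refine le_of_eq (congrArg toLex (Finsupp.ext fun j => ?_))
      cases j with
      | zero => exact h0
      | succ j => rw [ha, hb]

/-- Every monomial of the image of a monomial under a linear substitution has the same degree and a
smaller or equal weight vector. -/
theorem subst_mono_support {k : ℕ} (A : Matrix (Fin k) (Fin k) (ZMod 2)) (n : ℕ) :
    ∀ x : Fin k →₀ ℕ, (∀ j, x j < 2 ^ n) → ∀ y ∈ (subst A (mono x)).support,
      y.degree = x.degree ∧ toLex (weight y) ≤ toLex (weight x) := by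
  classical
  have hom : ∀ u : Fin k →₀ ℕ, (subst A (mono u)).IsHomogeneous u.degree := by
    intro u
    have h1 : ∀ i, (∑ j, C (A j i) * X j : P k).IsHomogeneous 1 := fun i =>
      IsHomogeneous.sum _ _ _ fun j _ => by
        simpa using (isHomogeneous_C (Fin k) (A j i)).mul (isHomogeneous_X (ZMod 2) j)
    simpa [subst] using (isHomogeneous_monomial (σ := Fin k) (1 : ZMod 2) rfl).aeval _ h1
  have hdeg : ∀ (u y : Fin k →₀ ℕ), y ∈ (subst A (mono u)).support → y.degree = u.degree := by
    intro u y hy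
    have h := hom u (mem_support_iff.1 hy)
    rw [← h, Finsupp.degree_eq_weight_one]
    rfl
  induction n with
  | zero =>
    intro x hx y hy
    have hx0 : x = 0 := Finsupp.ext fun j => by simpa using hx j
    subst hx0
    have : subst A (mono (0 : Fin k →₀ ℕ)) = mono 0 := by
      change subst A 1 = 1
      exact map_one _
    rw [this] at hy
    have hy0 : y = 0 := by simpa using support_monomial_subset hy
    subst hy0
    exact ⟨rfl, le_rfl⟩
  | succ n ih =>
    intro x hx y hy
    refine ⟨hdeg x y hy, ?_⟩
    let u : Fin k →₀ ℕ := x.mapRange (fun a => a % 2) rfl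
    let z : Fin k →₀ ℕ := x.mapRange (fun a => a / 2) rfl
    have hxuz : x = u + 2 • z := Finsupp.ext fun j => by
      simp [u, z, Nat.mod_add_div]
    have hprod : subst A (mono x) = subst A (mono u) * expand 2 (subst A (mono z)) := by
      rw [expand_zmod, ← map_pow, ← map_mul]
      congr 1
      rw [hxuz]
      simp [mono, monomial_pow, monomial_mul]
    rw [hprod] at hy
    obtain ⟨m, hm, q, hq, rfl⟩ := Finset.mem_add.1 (support_mul _ _ hy)
    rw [support_expand _ (by norm_num)] at hq
    obtain ⟨w, hw, rfl⟩ := Finset.mem_image.1 hq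
    have hw' := (ih z (fun j => by
      have := hx j
      simp only [z, Finsupp.mapRange_apply]
      omega) w hw).2
    have hmu := hdeg u m hm
    have hw0 : weight x 0 = u.degree := by
      simp [weight_apply, Finsupp.degree_eq_sum, u]
    have hm0 : weight (m + 2 • w) 0 = ∑ j, m j % 2 := by
      simp [weight_apply]
    have hle : ∀ j ∈ Finset.univ, m j % 2 ≤ m j := fun j _ => Nat.mod_le _ _
    refine lex_le_of_head ?_ fun heq => ⟨weight w, weight z, fun i => ?_, fun i => ?_, hw'⟩
    · rw [hw0, ← hmu, hm0, Finsupp.degree_eq_sum]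
      exact Finset.sum_le_sum hle
    · rw [hw0, ← hmu, hm0, Finsupp.degree_eq_sum, Finset.sum_eq_sum_iff_of_le hle] at heq
      simp only [weight_apply]
      refine Finset.sum_congr rfl fun j _ => ?_
      have := heq j (Finset.mem_univ j)
      simp only [Finsupp.add_apply, Finsupp.smul_apply, smul_eq_mul, pow_succ']
      rw [← Nat.div_div_eq_div_mul]
      congr 2
      omega
    · simp only [weight_apply, z, Finsupp.mapRange_apply, pow_succ', Nat.div_div_eq_div_mul]

theorem subst_mono_support' {k : ℕ} (A : Matrix (Fin k) (Fin k) (ZMod 2)) (x : Fin k →₀ ℕ) :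
    ∀ y ∈ (subst A (mono x)).support,
      y.degree = x.degree ∧ toLex (weight y) ≤ toLex (weight x) :=
  subst_mono_support A x.degree x fun j =>
    (Finsupp.le_degree j x).trans_lt Nat.lt_two_pow_self

theorem mem_span_of_support {k : ℕ} (Q : (Fin k →₀ ℕ) → Prop) (f : P k)
    (h : ∀ y ∈ f.support, Q y) : f ∈ Submodule.span (ZMod 2) {f | ∃ y, Q y ∧ f = mono y} := by
  rw [f.as_sum]
  refine Submodule.sum_mem _ fun y hy => ?_
  have : monomial y (coeff y f) = coeff y f • mono y := by
    rw [smul_monomial, smul_eq_mul, mul_one]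
  rw [this]
  exact Submodule.smul_mem _ _ (Submodule.subset_span ⟨y, h y hy, rfl⟩)

theorem subst_mem_PLe {k : ℕ} (A : Matrix (Fin k) (Fin k) (ZMod 2)) (ω : ℕ →₀ ℕ) {f : P k}
    (hf : f ∈ PLe k ω) : subst A f ∈ PLe k ω := by
  have : PLe k ω ≤ (PLe k ω).comap (subst A).toLinearMap := by
    refine Submodule.span_le.2 ?_
    rintro _ ⟨x, hx, hx', rfl⟩
    have := mem_span_of_support (fun y => y.degree = wdeg ω ∧ toLex (weight y) ≤ toLex ω)
      (subst A (mono x)) fun y hy =>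
        ⟨(subst_mono_support' A x y hy).1.trans hx, (subst_mono_support' A x y hy).2.trans hx'⟩
    simp only [and_assoc] at this
    exact this
  exact this hf

theorem subst_mem_PLt {k : ℕ} (A : Matrix (Fin k) (Fin k) (ZMod 2)) (ω : ℕ →₀ ℕ) {f : P k}
    (hf : f ∈ PLt k ω) : subst A f ∈ PLt k ω := by
  have : PLt k ω ≤ (PLt k ω).comap (subst A).toLinearMap := by
    refine Submodule.span_le.2 ?_
    rintro _ ⟨x, hx, hx', rfl⟩
    have := mem_span_of_support (fun y => y.degree = wdeg ω ∧ toLex (weight y) < toLex ω)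
      (subst A (mono x)) fun y hy =>
        ⟨(subst_mono_support' A x y hy).1.trans hx,
          (subst_mono_support' A x y hy).2.trans_lt hx'⟩
    simp only [and_assoc] at this
    exact this
  exact this hf

/-- The action of `GL_k` on `P_k(ω)`. -/
noncomputable def PLeRep (k : ℕ) (ω : ℕ →₀ ℕ) :
    Representation (ZMod 2) (GL (Fin k) (ZMod 2)) (PLe k ω) :=
  (polyRep k).subrepresentation (PLe k ω) fun _ _ hf => subst_mem_PLe _ ω hf

/-- The action of `GL_k` on `QP_k(ω)`, given by `g [f]_ω = [g f]_ω`. -/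
noncomputable def QPRep (k : ℕ) (ω : ℕ →₀ ℕ) :
    Representation (ZMod 2) (GL (Fin k) (ZMod 2)) (QP k ω) :=
  (PLeRep k ω).quotient (relations k ω) fun g f hf => by
    obtain ⟨a, ha, b, hb, hab⟩ := Submodule.mem_sup.1 (Submodule.mem_comap.1 hf)
    refine Submodule.mem_comap.2 (Submodule.mem_sup.2
      ⟨_, ⟨subst_mem_hit g.1 ha.1, subst_mem_PLe g.1 ω ha.2⟩, _, subst_mem_PLt g.1 ω hb, ?_⟩)
    rw [← map_add, hab]
    rfl

/-- `v` generates the `GL_k`-module `QP_k(ω)`: the only subrepresentation containing `v` is the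
whole space. -/
def Generates {k : ℕ} {ω : ℕ →₀ ℕ} (v : QP k ω) : Prop :=
  ∀ W : Subrepresentation (QPRep k ω), v ∈ W → W.toSubmodule = ⊤

end Action

section Data

/-- The weight vector `ω_(4) = (3,4,2,2)`. -/
def omega4 : ℕ →₀ ℕ := [3, 4, 2, 2].toFinsupp

/-- The weight vector `ω_(5) = (3,4,4,1)`. -/
def omega5 : ℕ →₀ ℕ := [3, 4, 4, 1].toFinsupp

/-- The pairs of an index `t` and the exponent vector `(ν_1, …, ν_5)` of the monomial
`a_t = a_{35,t}`, for `161 ≤ t ≤ 225`. -/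
def aTable : List (ℕ × (Fin 5 → ℕ)) :=
  [(161, ![1, 2, 7, 11, 14]), (162, ![1, 7, 2, 11, 14]), (163, ![1, 7, 11, 2, 14]),
   (164, ![1, 7, 11, 14, 2]), (165, ![7, 1, 2, 11, 14]), (166, ![7, 1, 11, 2, 14]),
   (167, ![7, 1, 11, 14, 2]), (168, ![7, 11, 1, 2, 14]), (169, ![7, 11, 1, 14, 2]),
   (170, ![7, 11, 13, 2, 2]), (171, ![1, 3, 6, 11, 14]), (172, ![3, 1, 6, 11, 14]),
   (173, ![1, 3, 7, 10, 14]), (174, ![1, 3, 7, 14, 10]), (175, ![1, 7, 3, 10, 14]),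
   (176, ![1, 7, 3, 14, 10]), (177, ![3, 1, 7, 10, 14]), (178, ![3, 1, 7, 14, 10]),
   (179, ![3, 7, 1, 10, 14]), (180, ![3, 7, 1, 14, 10]), (181, ![7, 1, 3, 10, 14]),
   (182, ![7, 1, 3, 14, 10]), (183, ![7, 3, 1, 10, 14]), (184, ![7, 3, 1, 14, 10]),
   (185, ![1, 7, 11, 6, 10]), (186, ![7, 1, 11, 6, 10]), (187, ![7, 11, 1, 6, 10]),
   (188, ![3, 5, 2, 11, 14]), (189, ![3, 5, 11, 2, 14]), (190, ![3, 5, 11, 14, 2]),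
   (191, ![3, 7, 9, 2, 14]), (192, ![3, 7, 9, 14, 2]), (193, ![7, 3, 9, 2, 14]),
   (194, ![7, 3, 9, 14, 2]), (195, ![3, 7, 13, 2, 10]), (196, ![3, 7, 13, 10, 2]),
   (197, ![7, 3, 13, 2, 10]), (198, ![7, 3, 13, 10, 2]), (199, ![7, 11, 5, 2, 10]),
   (200, ![7, 11, 5, 10, 2]), (201, ![3, 3, 5, 10, 14]), (202, ![3, 3, 5, 14, 10]),
   (203, ![3, 5, 3, 10, 14]), (204, ![3, 5, 3, 14, 10]), (205, ![3, 3, 13, 6, 10]),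
   (206, ![3, 5, 11, 6, 10]), (207, ![3, 7, 5, 10, 10]), (208, ![7, 3, 5, 10, 10]),
   (209, ![3, 7, 9, 6, 10]), (210, ![7, 3, 9, 6, 10]), (211, ![3, 5, 6, 6, 15]),
   (212, ![3, 5, 6, 15, 6]), (213, ![3, 5, 15, 6, 6]), (214, ![3, 15, 5, 6, 6]),
   (215, ![15, 3, 5, 6, 6]), (216, ![3, 5, 6, 7, 14]), (217, ![3, 5, 7, 6, 14]),
   (218, ![3, 5, 7, 14, 6]), (219, ![3, 7, 5, 6, 14]), (220, ![3, 7, 5, 14, 6]),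
   (221, ![3, 7, 13, 6, 6]), (222, ![7, 3, 5, 6, 14]), (223, ![7, 3, 5, 14, 6]),
   (224, ![7, 3, 13, 6, 6]), (225, ![7, 11, 5, 6, 6])]

/-- The monomial `a_t = a_{35,t}`, `161 ≤ t ≤ 225` (the value at other `t` is irrelevant). -/
noncomputable def a (t : ℕ) : Fin 5 →₀ ℕ :=
  Finsupp.equivFunOnFinite.symm ((aTable.lookup t).getD 0)

end Data

end HitProblem

/-! Fix ω and work modulo `trivials`, the sum of the hit polynomials and the span of all monomials,
in any degree, of weight below ω. Both summands are graded and stable under linear substitutions, so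
QP₅(ω) embeds in the quotient of P₅ by `trivials` (`mem_relations_iff`) and GL₅ may be used freely.

Spanning. For n < 2^s, Sqⁿ commutes with multiplication by a 2^s-th power (`sq_mul_pow`), and such a
factor v^(2^s) leaves the low s binary digits of the exponents unchanged. Hence a congruence between
monomials, obtained from squares Sqⁿ with n < 2^s by dropping terms whose first s weights are too
small, persists when arbitrary higher digits are attached; it also persists under permutations of
the variables. A few congruences in weights (3,4), (3,4,2), (3,4,2,2) and in (3,4), (3,4,4),
(3,4,4,1) show that every monomial of weight ω outside the list is congruent to a sum of
lexicographically smaller monomials of weight ω (`exists_of_classifies`). Such a monomial is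
inadmissible, and by induction the listed monomials span.

Independence. A sum F of coefficient functionals in degree 35 is given that kills the image of every
Sqⁿ with n ≥ 1 and every monomial of lower weight (`functional_trivials`). Since `trivials` is
GL₅-stable, f ↦ F(g f) kills it too. For a suitable order of the a_t and suitable g_t, the matrix
F(g_t a_u) is triangular with ones on the diagonal (`eq_zero_of_separates`). Independence, with
spanning by monomials that are not larger, makes every a_t admissible (`not_inadmissible`).

Generation. Starting from a single a_t, the others are obtained one by one from images of known
monomials under words in permutations and the transvection x₁ ↦ x₁ + x₂, modulo the same congruences
(`mem_of_generates`).

All of this is finite. Exponent vectors are coded by base-100 numbers, and permutations by their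
five decimal digits, so that `1234` is the identity. -/

namespace HitProblem

/-! ### Steenrod squares of monomials -/

section SquareFormulas

variable {k : ℕ}

theorem totalSq_X (i : Fin k) :
    totalSq k (X i) = Polynomial.C (X i) + Polynomial.C (X i ^ 2) * Polynomial.X := by
  rw [totalSq, aeval_X]

theorem totalSq_X_pow (i : Fin k) (e : ℕ) :
    totalSq k (X i ^ e) = ∑ a ∈ Finset.range (e + 1),
      Polynomial.X ^ a * Polynomial.C ((e.choose a : P k) * X i ^ (e + a)) := by
  rw [map_pow, totalSq_X, add_comm, add_pow]
  refine Finset.sum_congr rfl fun a ha => ?_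
  have ha : a ≤ e := Nat.lt_succ_iff.1 (Finset.mem_range.1 ha)
  have h : (X i : P k) ^ (e + a) = (X i ^ 2) ^ a * X i ^ (e - a) := by
    rw [← pow_mul, ← pow_add]
    congr 1
    omega
  rw [mul_pow, h]
  simp only [map_mul, map_pow, map_natCast]
  ring

theorem sq_apply (n : ℕ) (f : P k) : sq k n f = (totalSq k f).coeff n := rfl

/-- The Cartan formula for the product with a power of a variable. -/
theorem sq_X_pow_mul (n : ℕ) (i : Fin k) (e : ℕ) (f : P k) :
    sq k n (X i ^ e * f) = ∑ a ∈ Finset.range (e + 1),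
      if a ≤ n then (e.choose a : P k) * X i ^ (e + a) * sq k (n - a) f else 0 := by
  rw [sq_apply, map_mul, totalSq_X_pow, Finset.sum_mul, Polynomial.finsetSum_coeff]
  refine Finset.sum_congr rfl fun a _ => ?_
  rw [mul_assoc, Polynomial.coeff_X_pow_mul']
  split_ifs
  · rw [Polynomial.coeff_C_mul, sq_apply]
  · rfl

theorem sq_one (n : ℕ) : sq k n 1 = if n = 0 then 1 else 0 := by
  rw [sq_apply, map_one, Polynomial.coeff_one]

/-- Setting T = 0 in the total square is an algebra map that fixes every variable; thus Sq⁰ = id. -/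
theorem totalSq_coeff_zero (f : P k) : (totalSq k f).coeff 0 = f := by
  have h : ((Polynomial.aeval (0 : P k)).restrictScalars (ZMod 2)).comp (totalSq k)
      = AlgHom.id (ZMod 2) (P k) := by
    apply MvPolynomial.algHom_ext
    intro i
    simp [totalSq_X]
  have := DFunLike.congr_fun h f
  simpa [Polynomial.coeff_zero_eq_aeval_zero] using this

/-- Multiplication by a `2 ^ s`-th power commutes with `Sqⁿ` for `n < 2 ^ s`. -/
theorem sq_mul_pow (s n : ℕ) (hn : n < 2 ^ s) (f v : P k) :
    sq k n (f * v ^ 2 ^ s) = sq k n f * v ^ 2 ^ s := by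
  -- By Frobenius, Sq(v^(2^s)) = Sq(v)^(2^s) is a polynomial in T^(2^s), so below degree 2^s only
  -- its constant term survives.
  have hv : ∀ m, m ≤ n → (totalSq k (v ^ 2 ^ s)).coeff m = if m = 0 then v ^ 2 ^ s else 0 := by
    intro m hm
    rw [map_pow, ← Polynomial.map_iterateFrobenius_expand, Polynomial.coeff_map,
      Polynomial.coeff_expand (by positivity)]
    split_ifs with h1 h2 h2
    · subst h2
      simp [iterateFrobenius_def, totalSq_coeff_zero]
    · exact absurd (Nat.le_of_dvd (Nat.pos_of_ne_zero h2) h1) (by omega)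
    · subst h2
      simp at h1
    · simp
  rw [sq_apply, map_mul, Polynomial.coeff_mul, Finset.sum_eq_single (n, 0)]
  · rw [hv 0 (Nat.zero_le _), if_pos rfl, sq_apply]
  · rintro ⟨a, b⟩ hab hne
    rw [Finset.HasAntidiagonal.mem_antidiagonal] at hab
    rw [hv b (by simp at hab; omega), if_neg, mul_zero]
    rintro rfl
    exact hne (by simp at hab; simp [hab])
  · intro h
    simp at h

theorem sq_mem_hit {n : ℕ} (hn : 1 ≤ n) (f : P k) : sq k n f ∈ hit k :=
  (le_iSup₂ (f := fun n (_ : n ≥ 1) => LinearMap.range (sq k n)) n hn) ⟨_, rfl⟩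

theorem mono_eq_prod (e : Fin k →₀ ℕ) : mono e = ∏ j, (X j : P k) ^ e j := by
  rw [mono, monomial_eq, C_1, one_mul, Finsupp.prod_fintype]
  simp

theorem sq_mono (n : ℕ) (e : Fin k →₀ ℕ) :
    sq k n (mono e) = ∑ a ∈ Fintype.piFinset fun j => Finset.range (e j + 1),
      if ∑ j, a j = n then
        ((∏ j, (e j).choose (a j) : ℕ) : P k) * mono (e + Finsupp.equivFunOnFinite.symm a)
      else 0 := by
  rw [sq_apply, mono_eq_prod, map_prod]
  simp_rw [totalSq_X_pow]
  rw [Finset.prod_univ_sum, Polynomial.finsetSum_coeff]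
  refine Finset.sum_congr rfl fun a _ => ?_
  rw [Finset.prod_mul_distrib, Finset.prod_pow_eq_pow_sum, ← map_prod, Polynomial.coeff_mul_C,
    Polynomial.coeff_X_pow, Finset.prod_mul_distrib, mono_eq_prod]
  simp [eq_comm]

theorem coeff_sq_mono (n : ℕ) (e c : Fin k →₀ ℕ) :
    coeff c (sq k n (mono e)) =
      if e ≤ c ∧ ∑ j, (c j - e j) = n then ((∏ j, (e j).choose (c j - e j) : ℕ) : ZMod 2)
      else 0 := by
  rw [sq_mono, coeff_sum]
  have hc : ∀ a : Fin k → ℕ, coeff c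
      (if ∑ j, a j = n then
        ((∏ j, (e j).choose (a j) : ℕ) : P k) * mono (e + Finsupp.equivFunOnFinite.symm a)
      else 0) = if (e + Finsupp.equivFunOnFinite.symm a = c ∧ ∑ j, a j = n) then
        ((∏ j, (e j).choose (a j) : ℕ) : ZMod 2) else 0 := by
    intro a
    by_cases h1 : ∑ j, a j = n
    · rw [if_pos h1, ← map_natCast (C : ZMod 2 →+* P k), coeff_C_mul, coeff_monomial]
      by_cases h2 : e + Finsupp.equivFunOnFinite.symm a = c <;> simp [h1, h2]
    · simp [h1]
  simp_rw [hc]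
  by_cases h : e ≤ c ∧ ∑ j, (c j - e j) = n
  · rw [if_pos h]
    have hs : ∀ a : Fin k → ℕ, (e + Finsupp.equivFunOnFinite.symm a = c ∧ ∑ j, a j = n) ↔
        a = fun j => c j - e j := by
      intro a
      constructor
      · rintro ⟨h1, -⟩
        funext j
        have := DFunLike.congr_fun h1 j
        simp at this
        omega
      · rintro rfl
        refine ⟨Finsupp.ext fun j => ?_, h.2⟩
        have := h.1 j
        simp
        omega
    simp_rw [hs]
    rw [Finset.sum_ite_eq']
    split_ifs with hm
    · rfl
    -- If c - e leaves the range of summation, one of its entries exceeds that of e and the binomial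
    -- coefficient there vanishes.
    · rw [Fintype.mem_piFinset] at hm
      push Not at hm
      obtain ⟨j, hj⟩ := hm
      rw [Finset.mem_range] at hj
      rw [Finset.prod_eq_zero (Finset.mem_univ j), Nat.cast_zero]
      exact Nat.choose_eq_zero_of_lt (by omega)
  · rw [if_neg h]
    refine Finset.sum_eq_zero fun a _ => if_neg ?_
    rintro ⟨rfl, h2⟩
    exact h ⟨by intro j; simp, by simpa using h2⟩

theorem sq_mono_isHomogeneous (n : ℕ) (e : Fin k →₀ ℕ) :
    (sq k n (mono e)).IsHomogeneous (e.degree + n) := by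
  intro c hc
  rw [coeff_sq_mono] at hc
  have h : e ≤ c ∧ ∑ j, (c j - e j) = n := by
    by_contra h
    exact hc (if_neg h)
  rw [show Finsupp.weight 1 c = c.degree from (DFunLike.congr_fun Finsupp.degree_eq_weight_one c).symm,
    Finsupp.degree_eq_sum, Finsupp.degree_eq_sum, ← h.2, ← Finset.sum_add_distrib]
  refine Finset.sum_congr rfl fun j _ => ?_
  have := h.1 j
  omega

/-- The space of hit polynomials is graded. -/
theorem homogeneousComponent_mem_hit (m : ℕ) {f : P k} (hf : f ∈ hit k) :
    homogeneousComponent m f ∈ hit k := by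
  suffices h : hit k ≤ (hit k).comap (homogeneousComponent m) from h hf
  refine iSup₂_le fun n hn => ?_
  rintro _ ⟨g, rfl⟩
  change homogeneousComponent m (sq k n g) ∈ hit k
  induction g using MvPolynomial.induction_on' with
  | monomial e a =>
    have : (monomial e a : P k) = a • mono e := by
      rw [smul_monomial, smul_eq_mul, mul_one]
    rw [this, map_smul, map_smul]
    refine Submodule.smul_mem _ _ ?_
    rw [homogeneousComponent_of_mem (sq_mono_isHomogeneous n e)]
    split_ifs
    · exact sq_mem_hit hn _
    · exact Submodule.zero_mem _
  | add p q hp hq =>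
    rw [map_add, map_add]
    exact Submodule.add_mem _ hp hq

end SquareFormulas

/-! ### Polynomials that are trivial modulo hits and lower weight -/

section Trivial

variable {k : ℕ}

/-- The span of the monomials, of any degree, with weight vector smaller than `ω`. -/
noncomputable def lowWeight (k : ℕ) (ω : ℕ →₀ ℕ) : Submodule (ZMod 2) (P k) :=
  Submodule.span (ZMod 2) {f | ∃ y : Fin k →₀ ℕ, toLex (weight y) < toLex ω ∧ f = mono y}

/-- The sum of the hit polynomials and the polynomials of weight smaller than `ω`. -/
noncomputable def trivials (k : ℕ) (ω : ℕ →₀ ℕ) : Submodule (ZMod 2) (P k) :=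
  hit k ⊔ lowWeight k ω

theorem sq_mem_trivials {n : ℕ} (hn : 1 ≤ n) (f : P k) (ω : ℕ →₀ ℕ) :
    sq k n f ∈ trivials k ω :=
  Submodule.mem_sup_left (sq_mem_hit hn f)

theorem mono_mem_trivials {ω : ℕ →₀ ℕ} {y : Fin k →₀ ℕ} (h : toLex (weight y) < toLex ω) :
    mono y ∈ trivials k ω :=
  Submodule.mem_sup_right (Submodule.subset_span ⟨y, h, rfl⟩)

/-- Substitutions commute with the squares and never raise a weight vector, so each summand is
stable. This is what allows both permuted relations and translated functionals. -/
theorem subst_mem_trivials (A : Matrix (Fin k) (Fin k) (ZMod 2)) (ω : ℕ →₀ ℕ) {f : P k}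
    (hf : f ∈ trivials k ω) : subst A f ∈ trivials k ω := by
  suffices h : trivials k ω ≤ (trivials k ω).comap (subst A).toLinearMap from h hf
  refine sup_le (fun f hf => Submodule.mem_sup_left (subst_mem_hit A hf)) (Submodule.span_le.2 ?_)
  rintro _ ⟨x, hx, rfl⟩
  exact Submodule.mem_sup_right (mem_span_of_support (fun y => toLex (weight y) < toLex ω)
    (subst A (mono x)) fun y hy => (subst_mono_support' A x y hy).2.trans_lt hx)

theorem add_self_eq_zero (f : P k) : f + f = 0 := CharTwo.add_self_eq_zero f

end Trivial

/-! ### Parity of binomial coefficients -/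

section OddBinomials

/-- Whether the binomial coefficient `a.choose b` is odd. -/
def oddChoose (a b : ℕ) : Bool := Nat.beq (Nat.land a b) b

theorem oddChoose_iff (a b : ℕ) : oddChoose a b = true ↔ a &&& b = b := by
  rw [oddChoose, Nat.beq_eq]
  rfl

/-- Splits off the lowest binary digit, to match the recursion in Lucas' theorem. -/
theorem land_eq_iff (a b : ℕ) : a &&& b = b ↔ b % 2 ≤ a % 2 ∧ (a / 2) &&& (b / 2) = b / 2 := by
  have h1 : (a &&& b) / 2 = a / 2 &&& b / 2 := Nat.and_div_two
  have h3 : b % 2 < 2 := Nat.mod_lt _ (by norm_num)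
  have h4 : a % 2 < 2 := Nat.mod_lt _ (by norm_num)
  have h2 : (a &&& b) % 2 = a % 2 * (b % 2) := by
    have h := Nat.and_mod_two_eq_one (a := a) (b := b)
    rcases Nat.mod_two_eq_zero_or_one a with ha | ha <;>
      rcases Nat.mod_two_eq_zero_or_one b with hb | hb <;>
        rcases Nat.mod_two_eq_zero_or_one (a &&& b) with hc | hc <;>
          rw [ha, hb, hc] at h <;> rw [ha, hb, hc] <;> simp at h ⊢
  rw [← h1]
  constructor
  · intro h
    rw [h] at h2
    refine ⟨?_, by rw [h]⟩
    interval_cases b % 2 <;> interval_cases a % 2 <;> omega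
  · rintro ⟨h5, h6⟩
    have : (a &&& b) % 2 = b % 2 := by
      rw [h2]
      interval_cases b % 2 <;> interval_cases a % 2 <;> omega
    omega

/-- Lucas' theorem for p = 2: the coefficient is odd exactly when the binary digits of b are
contained in those of a. -/
theorem choose_cast (a b : ℕ) : (a.choose b : ZMod 2) = if oddChoose a b then 1 else 0 := by
  induction a using Nat.strong_induction_on generalizing b with
  | _ a ih =>
    rcases Nat.eq_zero_or_pos a with rfl | ha
    · rcases Nat.eq_zero_or_pos b with rfl | hb
      · simp [oddChoose]
      · rw [Nat.choose_eq_zero_of_lt hb, if_neg]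
        · rfl
        · rw [oddChoose_iff, Nat.zero_and]
          omega
    · have h := (ZMod.natCast_eq_natCast_iff _ _ _).2
        (Choose.choose_modEq_choose_mod_mul_choose_div_nat (n := a) (k := b) (p := 2))
      rw [h, Nat.cast_mul, ih (a / 2) (by omega)]
      simp only [oddChoose_iff, land_eq_iff a b]
      have h3 : b % 2 < 2 := Nat.mod_lt _ (by norm_num)
      have h4 : a % 2 < 2 := Nat.mod_lt _ (by norm_num)
      interval_cases b % 2 <;> interval_cases a % 2 <;> simp

end OddBinomials

/-! ### Squares computed on lists of exponents -/

section Lists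

variable {k : ℕ}

/-- The monomials of `Sqⁿ` of a monomial, given by the lists of their exponents. -/
def sqList : List ℕ → ℕ → List (List ℕ)
  | [], n => if n = 0 then [[]] else []
  | e :: es, n => (List.range (e + 1)).flatMap fun a =>
      if Nat.ble a n && oddChoose e a then (sqList es (n - a)).map ((e + a) :: ·) else []

/-- The product of powers of the given variables with the given exponents. -/
noncomputable def powProd (vars : List (Fin k)) (es : List ℕ) : P k :=
  (List.zipWith (fun i e => X i ^ e) vars es).prod

theorem sum_map_range_eq {M : Type*} [AddCommMonoid M] (f : ℕ → M) (n : ℕ) :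
    ((List.range n).map f).sum = ∑ a ∈ Finset.range n, f a := by
  rw [Finset.sum_range]
  simp [← List.sum_ofFn, List.ofFn_eq_map, ← List.map_coe_finRange_eq_range, Function.comp_def]

theorem sum_map_flatMap {α β M : Type*} [AddCommMonoid M] (l : List α) (g : α → List β)
    (f : β → M) : ((l.flatMap g).map f).sum = (l.map fun a => ((g a).map f).sum).sum := by
  induction l with
  | nil => rfl
  | cons a l ih => simp [ih]

theorem sq_powProd : ∀ (es : List ℕ) (vars : List (Fin k)) (n : ℕ), vars.length = es.length →
    sq k n (powProd vars es) = ((sqList es n).map (powProd vars)).sum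
  | [], [], n, _ => by
    simp only [powProd, sqList, List.zipWith_nil_left, List.prod_nil, sq_one]
    split_ifs <;> simp [powProd]
  | e :: es, i :: vars, n, h => by
    have ih := fun m => sq_powProd es vars m (by simpa using h)
    have hp : ∀ e es, powProd (i :: vars) (e :: es) = X i ^ e * powProd vars es := fun e es => by
      simp [powProd]
    rw [hp, sq_X_pow_mul, sqList, sum_map_flatMap, sum_map_range_eq]
    refine Finset.sum_congr rfl fun a _ => ?_
    have hc : (e.choose a : P k) = if oddChoose e a then 1 else 0 := by
      rw [← map_natCast (C : ZMod 2 →+* P k), choose_cast]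
      split_ifs <;> simp
    rw [hc]
    by_cases h1 : a ≤ n <;> by_cases h2 : oddChoose e a = true
    · have h3 : (Nat.ble a n && oddChoose e a) = true := by simp [h1, h2]
      rw [if_pos h1, if_pos h2, if_pos h3, List.map_map, one_mul, ih, ← List.sum_map_mul_left]
      simp [Function.comp_def, hp]
    · simp [h2]
    · simp [h1]
    · simp [h2]

theorem sqList_length : ∀ (es : List ℕ) (n : ℕ), ∀ l ∈ sqList es n, l.length = es.length
  | [], n, l, h => by
    unfold sqList at h
    split_ifs at h <;> simp_all
  | e :: es, n, l, h => by
    unfold sqList at h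
    obtain ⟨a, -, h⟩ := List.mem_flatMap.1 h
    split_ifs at h
    · obtain ⟨l', hl, rfl⟩ := List.mem_map.1 h
      simp [sqList_length es _ l' hl]
    · simp at h

/-- A square turns an exponent e into e + a with a ≤ e, hence at most doubles it. Arguments with
entries below 50 therefore give squares that fit into base-100 digits. -/
theorem sqList_lt (b : ℕ) : ∀ (es : List ℕ) (n : ℕ), (∀ e ∈ es, e < b) →
    ∀ l ∈ sqList es n, ∀ x ∈ l, x < 2 * b
  | [], n, _, l, h => by
    unfold sqList at h
    split_ifs at h <;> simp_all
  | e :: es, n, hb, l, h => by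
    unfold sqList at h
    obtain ⟨a, ha, h⟩ := List.mem_flatMap.1 h
    split_ifs at h
    · obtain ⟨l', hl, rfl⟩ := List.mem_map.1 h
      intro x hx
      rcases List.mem_cons.1 hx with rfl | hx
      · have := hb e (by simp)
        have := List.mem_range.1 ha
        omega
      · exact sqList_lt b es _ (fun e he => hb e (by simp [he])) l' hl x hx
    · simp at h

end Lists

/-! ### Exponent vectors as base-100 numbers -/

section Codes

/-- The exponent vector with the given entries. -/
noncomputable def ofList (l : List ℕ) : Fin 5 →₀ ℕ :=
  Finsupp.equivFunOnFinite.symm fun j => l.getD j 0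

theorem ofList_apply (l : List ℕ) (j : Fin 5) : ofList l j = l.getD j 0 := rfl

/-- The five digits in base `100`. Exponent vectors with entries below `100` are encoded in this
way, for instance `(3, 5, 3, 10, 14)` by `305031014`. -/
def digits (c : ℕ) : List ℕ :=
  [c / 100000000 % 100, c / 1000000 % 100, c / 10000 % 100, c / 100 % 100, c % 100]

/-- The number with the given digits in base `100`. -/
def encode (l : List ℕ) : ℕ := l.foldl (fun c d => c * 100 + d) 0

/-- The exponent vector encoded by a number. -/
noncomputable def decode (c : ℕ) : Fin 5 →₀ ℕ := ofList (digits c)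

theorem decode_apply (c : ℕ) (j : Fin 5) : decode c j = (digits c).getD j 0 := rfl

theorem digits_length (c : ℕ) : (digits c).length = 5 := rfl

theorem digits_lt (c : ℕ) : ∀ x ∈ digits c, x < 100 := by
  intro x hx
  simp only [digits, List.mem_cons, List.not_mem_nil, or_false] at hx
  rcases hx with rfl | rfl | rfl | rfl | rfl <;> exact Nat.mod_lt _ (by norm_num)

theorem digits_encode {l : List ℕ} (h : l.length = 5) (hl : ∀ x ∈ l, x < 100) :
    digits (encode l) = l := by
  match l, h with
  | [a, b, c, d, e], _ =>
    simp only [List.mem_cons, List.not_mem_nil, or_false, forall_eq_or_imp, forall_eq] at hl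
    simp only [encode, digits, List.foldl, List.cons.injEq, and_true]
    omega

theorem decode_encode {l : List ℕ} (h : l.length = 5) (hl : ∀ x ∈ l, x < 100) :
    decode (encode l) = ofList l := by
  rw [decode, digits_encode h hl]

theorem mono_ofList {l : List ℕ} (h : l.length = 5) :
    (mono (ofList l) : P 5) = powProd (List.finRange 5) l := by
  match l, h with
  | [a, b, c, d, e], _ =>
    rw [mono_eq_prod, Fin.prod_univ_five]
    simp [powProd, ofList_apply, List.finRange_succ, mul_assoc]

theorem sq_mono_ofList {l : List ℕ} (h : l.length = 5) (n : ℕ) :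
    sq 5 n (mono (ofList l)) = ((sqList l n).map fun y => mono (ofList y)).sum := by
  rw [mono_ofList h, sq_powProd l _ n (by simp [h])]
  congr 1
  exact List.map_congr_left fun y hy =>
    (mono_ofList ((sqList_length l n y hy).trans h)).symm

theorem mono_add_smul {k : ℕ} (x v : Fin k →₀ ℕ) (m : ℕ) :
    (mono (x + m • v) : P k) = mono x * mono v ^ m := by
  simp [mono, monomial_mul, monomial_pow]

end Codes

/-! ### Cancellation in characteristic two -/

section Cancel

/-- Insert an entry into a list, or remove it if it is present. -/
def toggle (c : ℕ) : List ℕ → List ℕ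
  | [] => [c]
  | d :: l => bif Nat.beq c d then l else d :: toggle c l

/-- Remove equal entries in pairs. -/
def cancel (l : List ℕ) : List ℕ := l.foldr toggle []

theorem sum_toggle {k : ℕ} (f : ℕ → P k) (c : ℕ) :
    ∀ l, ((toggle c l).map f).sum = f c + (l.map f).sum
  | [] => by simp [toggle]
  | d :: l => by
    unfold toggle
    cases h : Nat.beq c d with
    | true =>
      have := Nat.eq_of_beq_eq_true h
      subst this
      rw [cond_true, List.map_cons, List.sum_cons, ← add_assoc, add_self_eq_zero, zero_add]
    | false =>
      rw [cond_false, List.map_cons, List.sum_cons, sum_toggle f c l, List.map_cons,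
        List.sum_cons, add_left_comm]

theorem sum_cancel {k : ℕ} (f : ℕ → P k) (l : List ℕ) :
    ((cancel l).map f).sum = (l.map f).sum := by
  induction l with
  | nil => rfl
  | cons c l ih =>
    change ((toggle c (cancel l)).map f).sum = _
    rw [sum_toggle, ih, List.map_cons, List.sum_cons]

end Cancel

/-! ### Comparison of weight vectors by their first entries -/

section LowerWeight

/-- Whether the list of the first weights of an exponent vector is smaller than `w`. -/
def lower : List ℕ → List ℕ → Bool
  | [], _ => false
  | a :: w, l => let b := (l.map (· % 2)).sum
    Nat.blt b a || (Nat.beq b a && lower w (l.map (· / 2)))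

theorem lower_iff : ∀ w l : List ℕ, lower w l = true ↔ ∃ i < w.length,
    (∀ j < i, (l.map (· / 2 ^ j % 2)).sum = w.getD j 0) ∧
      (l.map (· / 2 ^ i % 2)).sum < w.getD i 0
  | [], l => by simp [lower]
  | a :: w, l => by
    have hd : ∀ i, ((l.map (· / 2)).map (· / 2 ^ i % 2)).sum
        = (l.map (· / 2 ^ (i + 1) % 2)).sum := fun i => by
      simp [Function.comp_def, pow_succ', Nat.div_div_eq_div_mul]
    simp only [lower, Bool.or_eq_true, Bool.and_eq_true, lower_iff w, hd, Nat.beq_eq,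
      Nat.blt_eq]
    constructor
    · rintro (h | ⟨h, i, hi, h1, h2⟩)
      · exact ⟨0, by simp, by simp, by simpa using h⟩
      · refine ⟨i + 1, by simpa using hi, fun j hj => ?_, by simpa using h2⟩
        cases j with
        | zero => simpa using h
        | succ j => simpa using h1 j (by omega)
    · rintro ⟨i, hi, h1, h2⟩
      cases i with
      | zero => exact Or.inl (by simpa using h2)
      | succ i =>
        refine Or.inr ⟨by simpa using h1 0 (by omega), i, by simpa using hi, fun j hj => ?_,
          by simpa using h2⟩
        simpa using h1 (j + 1) (by omega)

/-- Adding multiples of 2^s does not change the binary digits below position s. -/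
theorem weight_ofList {l : List ℕ} (h : l.length = 5) (s : ℕ) (v : Fin 5 →₀ ℕ) {i : ℕ}
    (hi : i < s) : weight (ofList l + 2 ^ s • v) i = (l.map (· / 2 ^ i % 2)).sum := by
  have key : ∀ a b : ℕ, (a + 2 ^ s * b) / 2 ^ i % 2 = a / 2 ^ i % 2 := by
    intro a b
    obtain ⟨t, rfl⟩ : ∃ t, s = i + (t + 1) := ⟨s - i - 1, by omega⟩
    rw [pow_add, mul_assoc, Nat.add_mul_div_left _ _ (by positivity), pow_succ', mul_assoc,
      Nat.add_mul_mod_self_left]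
  match l, h with
  | [a, b, c, d, e], _ =>
    rw [weight_apply, Fin.sum_univ_five]
    simp only [Finsupp.add_apply, Finsupp.smul_apply, smul_eq_mul, key]
    simp [ofList_apply, add_assoc]

/-- A strict drop among the first weights already decides the lexicographic comparison, so such a
term can be discarded whatever the higher digits v are. -/
theorem weight_lt_of_lower {ω : ℕ →₀ ℕ} {w l : List ℕ} (hw : ∀ i < w.length, ω i = w.getD i 0)
    (h : l.length = 5) (hl : lower w l = true) (v : Fin 5 →₀ ℕ) :
    toLex (weight (ofList l + 2 ^ w.length • v)) < toLex ω := by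
  obtain ⟨i, hi, h1, h2⟩ := (lower_iff w l).1 hl
  refine Finsupp.Lex.lt_iff.2 ⟨i, fun j hj => ?_, ?_⟩
  · change weight _ j = ω j
    rw [weight_ofList h _ v (hj.trans hi), h1 j hj, hw j (hj.trans hi)]
  · change weight _ i < ω i
    rw [weight_ofList h _ v hi, hw i hi]
    exact h2

end LowerWeight

/-! ### Congruences stable under multiplication by 2^s-th powers -/

section Relations

/-- The sum of the encoded monomials, multiplied by any `2 ^ s`-th power of a monomial, is zero
modulo hit polynomials and monomials of weight smaller than `ω`. -/
def Relation (ω : ℕ →₀ ℕ) (s : ℕ) (l : List ℕ) : Prop :=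
  ∀ v : Fin 5 →₀ ℕ, (l.map fun c => (mono (decode c + 2 ^ s • v) : P 5)).sum ∈ trivials 5 ω

/-- The function `r` replaces monomials by equivalent sums of monomials. -/
def Reduces (ω : ℕ →₀ ℕ) (s : ℕ) (r : ℕ → List ℕ) : Prop :=
  ∀ x, Relation ω s (x :: r x)

variable {ω : ℕ →₀ ℕ} {s : ℕ} {l l' : List ℕ}

theorem Relation.append (h : Relation ω s l) (h' : Relation ω s l') : Relation ω s (l ++ l') := by
  intro v
  rw [List.map_append, List.sum_append]
  exact Submodule.add_mem _ (h v) (h' v)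

theorem Relation.of_append_left (h : Relation ω s (l ++ l')) (h' : Relation ω s l') :
    Relation ω s l := by
  intro v
  have := Submodule.sub_mem _ (h v) (h' v)
  rwa [List.map_append, List.sum_append, add_sub_cancel_right] at this

theorem Relation.of_append_right (h : Relation ω s (l ++ l')) (h' : Relation ω s l) :
    Relation ω s l' := by
  intro v
  have := Submodule.sub_mem _ (h v) (h' v)
  rwa [List.map_append, List.sum_append, add_sub_cancel_left] at this

theorem Relation.nil : Relation ω s [] := fun v => by simp

theorem relation_of_cancel (h : (cancel l).isEmpty = true) : Relation ω s l := by
  intro v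
  rw [← sum_cancel, List.isEmpty_iff.1 h]
  simp

theorem Reduces.sum_add_sum {r : ℕ → List ℕ} (hr : Reduces ω s r) (v : Fin 5 →₀ ℕ) (l : List ℕ) :
    (l.map fun c => (mono (decode c + 2 ^ s • v) : P 5)).sum +
      ((l.flatMap r).map fun c => (mono (decode c + 2 ^ s • v) : P 5)).sum ∈ trivials 5 ω := by
  induction l with
  | nil => simp
  | cons x l ih =>
    have := Submodule.add_mem _ (hr x v) ih
    rw [List.map_cons, List.sum_cons] at this
    rw [List.flatMap_cons, List.map_append, List.map_cons, List.sum_cons, List.sum_append,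
      add_add_add_comm]
    exact this

theorem Reduces.flatMap {r : ℕ → List ℕ} (hr : Reduces ω s r) (h : Relation ω s l) :
    Relation ω s (l.flatMap r) := by
  intro v
  have := Submodule.sub_mem _ (hr.sum_add_sum v l) (h v)
  rwa [add_sub_cancel_left] at this

theorem Reduces.singleton : Reduces ω s fun x => [x] := fun x v => by
  simp only [List.map_cons, List.map_nil, List.sum_cons, List.sum_nil, add_zero]
  rw [add_self_eq_zero]
  exact Submodule.zero_mem _

theorem Reduces.comp {r r' : ℕ → List ℕ} (hr : Reduces ω s r) (hr' : Reduces ω s r') :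
    Reduces ω s fun x => (r x).flatMap r' := by
  intro x v
  -- Rewriting the relation x + r x throughout by r' gives r' x + r' (r x); in the sum with x + r' x
  -- the terms r' x cancel.
  have h1 := hr'.flatMap (hr x) v
  have h2 := hr' x v
  rw [List.flatMap_cons, List.map_append, List.sum_append] at h1
  rw [List.map_cons, List.sum_cons] at h2 ⊢
  have := Submodule.add_mem _ h1 h2
  rwa [add_comm _ (_ + _), add_assoc, ← add_assoc _ _ (List.sum _), add_self_eq_zero,
    zero_add] at this

end Relations

/-! ### Congruences obtained from Steenrod squares -/

section Templates

/-- The monomials of `∑ Sqⁿ(g)`, over the pairs `(n, g)` in the list, except those whose first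
weights are smaller than `w`. -/
def squares (w : List ℕ) (q : List (ℕ × ℕ)) : List ℕ :=
  q.flatMap fun q => ((sqList (digits q.2) q.1).filter fun l => !lower w l).map encode

/-- Check that `∑ Sqⁿ(g)` is the sum of the monomials in `l`, up to monomials whose first weights
are smaller than `w`. -/
def isSquares (w : List ℕ) (q : List (ℕ × ℕ)) (l : List ℕ) : Bool :=
  (q.all fun q => Nat.ble 1 q.1 && Nat.blt q.1 (2 ^ w.length) &&
    (digits q.2).all fun d => Nat.blt d 50) && (cancel (squares w q ++ l)).isEmpty

variable {ω : ℕ →₀ ℕ} {w : List ℕ}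

/-- Since n < 2^s, with s the length of `w`, the product Sqⁿ(g) v^(2^s) equals Sqⁿ(g v^(2^s)) and is
hit for every v. -/
theorem relation_squares (hw : ∀ i < w.length, ω i = w.getD i 0) :
    ∀ q : List (ℕ × ℕ), (q.all fun q => Nat.ble 1 q.1 && Nat.blt q.1 (2 ^ w.length) &&
      (digits q.2).all fun d => Nat.blt d 50) = true → Relation ω w.length (squares w q)
  | [], _ => Relation.nil
  | q :: qs, h => by
    rw [List.all_cons, Bool.and_eq_true] at h
    refine Relation.append ?_ (relation_squares hw qs h.2)
    obtain ⟨h, -⟩ := h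
    simp only [Bool.and_eq_true, Nat.ble_eq, Nat.blt_eq, List.all_eq_true] at h
    obtain ⟨⟨h1, h2⟩, h3⟩ := h
    intro v
    have hs : sq 5 q.1 (mono (decode q.2) * mono v ^ 2 ^ w.length) ∈ trivials 5 ω :=
      sq_mem_trivials h1 _ ω
    rw [sq_mul_pow _ _ h2, decode, sq_mono_ofList (digits_length _), ← List.sum_map_mul_right]
      at hs
    -- Filtering out the terms of lower weight changes the sum only by an element of `trivials`.
    have key : ∀ L : List (List ℕ), (∀ l ∈ L, l.length = 5 ∧ ∀ x ∈ l, x < 100) →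
        (L.map fun l => (mono (ofList l) : P 5) * mono v ^ 2 ^ w.length).sum -
        (((L.filter fun l => !lower w l).map encode).map
          fun c => (mono (decode c + 2 ^ w.length • v) : P 5)).sum ∈ trivials 5 ω := by
      intro L
      induction L with
      | nil => simp
      | cons l L ih =>
        intro hl
        obtain ⟨⟨hl1, hl2⟩, hl⟩ := List.forall_mem_cons.1 hl
        rw [List.map_cons, List.sum_cons]
        cases hlow : lower w l with
        | true =>
          rw [List.filter_cons_of_neg (by simp [hlow]), add_sub_assoc]
          have hm := mono_mem_trivials (weight_lt_of_lower hw hl1 hlow v)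
          rw [mono_add_smul] at hm
          exact Submodule.add_mem _ hm (ih hl)
        | false =>
          rw [List.filter_cons_of_pos (by simp [hlow]), List.map_cons, List.map_cons,
            List.sum_cons, decode_encode hl1 hl2, mono_add_smul, add_sub_add_left_eq_sub]
          exact ih hl
    have := Submodule.sub_mem _ hs (key (sqList (digits q.2) q.1) fun l hl =>
      ⟨(sqList_length _ _ l hl).trans (digits_length _), sqList_lt 50 _ _ h3 l hl⟩)
    rwa [sub_sub_cancel] at this

theorem relation_of_isSquares (hw : ∀ i < w.length, ω i = w.getD i 0) {q : List (ℕ × ℕ)}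
    {l : List ℕ} (h : isSquares w q l = true) : Relation ω w.length l := by
  rw [isSquares, Bool.and_eq_true] at h
  exact (relation_of_cancel h.2).of_append_right (relation_squares hw q h.1)

end Templates

/-! ### Permutations of the variables -/

section Permutations

/-- The permutation `j ↦ p_j` of the indices `0, …, 4`, given by the decimal digits of a number. -/
def permDigits (p : ℕ) : List ℕ :=
  [p / 10000 % 10, p / 1000 % 10, p / 100 % 10, p / 10 % 10, p % 10]

/-- Whether the decimal digits of a number are a permutation of `0, …, 4`. -/
def isPerm (p : ℕ) : Bool :=
  ((permDigits p).all fun i => Nat.blt i 5) &&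
    Nat.beq (((permDigits p).map fun i => 2 ^ i).sum) 31

/-- Permute the entries of an encoded exponent vector. -/
def permute (p c : ℕ) : ℕ := encode ((permDigits p).map fun i => (digits c).getD i 0)

/-- The binary expansion of 31 has five ones. Two equal powers would merge and write 31 as a sum of
fewer than five powers of two, which is impossible. -/
theorem injective_of_sum_two_pow (f : Fin 5 → Fin 5) (h : ∑ j, 2 ^ (f j : ℕ) = 31) :
    Function.Injective f := by
  revert f
  decide +kernel

theorem exists_perm_of_isPerm {p : ℕ} (hp : isPerm p = true) :
    ∃ σ : Equiv.Perm (Fin 5), ∀ c, decode (permute p c) = (decode c).equivMapDomain σ.symm := by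
  rw [isPerm, Bool.and_eq_true] at hp
  obtain ⟨h1, h2⟩ := hp
  simp only [permDigits, List.all_cons, List.all_nil, Bool.and_eq_true, Nat.blt_eq] at h1
  obtain ⟨h10, h11, h12, h13, h14, -⟩ := h1
  let f : Fin 5 → Fin 5 := ![⟨_, h10⟩, ⟨_, h11⟩, ⟨_, h12⟩, ⟨_, h13⟩, ⟨_, h14⟩]
  have hf : Function.Injective f := by
    refine injective_of_sum_two_pow f ?_
    have := Nat.eq_of_beq_eq_true h2
    rw [Fin.sum_univ_five]
    simpa [permDigits, f, add_assoc] using this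
  refine ⟨Equiv.ofBijective f (Finite.injective_iff_bijective.1 hf), fun c => ?_⟩
  have hl : ∀ x ∈ (permDigits p).map fun i => (digits c).getD i 0, x < 100 := by
    intro x hx
    obtain ⟨i, -, rfl⟩ := List.mem_map.1 hx
    rw [List.getD_eq_getElem?_getD]
    cases h : (digits c)[i]? with
    | none => simp
    | some y => exact digits_lt c y (List.mem_of_getElem? h)
  rw [permute, decode_encode rfl hl]
  ext j
  rw [Finsupp.equivMapDomain_apply, Equiv.symm_symm, Equiv.ofBijective_apply, decode_apply,
    ofList_apply]
  fin_cases j <;> simp [permDigits, f]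

/-- The matrix of a permutation of the variables. -/
def permMatrix (σ : Equiv.Perm (Fin 5)) : Matrix (Fin 5) (Fin 5) (ZMod 2) :=
  Matrix.of fun j i => if j = σ i then 1 else 0

theorem permMatrix_mul (σ τ : Equiv.Perm (Fin 5)) :
    permMatrix σ * permMatrix τ = permMatrix (σ * τ) := by
  ext i j
  simp only [permMatrix, Matrix.mul_apply, Matrix.of_apply, mul_ite, mul_one, mul_zero,
    Finset.sum_ite_eq', Finset.mem_univ, if_true, Equiv.Perm.mul_apply]
  exact if_congr Iff.rfl rfl rfl

theorem permMatrix_one : permMatrix 1 = 1 := by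
  ext i j
  rw [permMatrix, Matrix.of_apply, Matrix.one_apply, Equiv.Perm.one_apply]

/-- A permutation of the variables as an element of `GL₅`. -/
def permGL (σ : Equiv.Perm (Fin 5)) : GL (Fin 5) (ZMod 2) where
  val := permMatrix σ
  inv := permMatrix σ⁻¹
  val_inv := by rw [permMatrix_mul, mul_inv_cancel, permMatrix_one]
  inv_val := by rw [permMatrix_mul, inv_mul_cancel, permMatrix_one]

theorem subst_permMatrix (σ : Equiv.Perm (Fin 5)) (e : Fin 5 →₀ ℕ) :
    subst (permMatrix σ) (mono e) = mono (e.equivMapDomain σ) := by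
  have h : ∀ i, subst (permMatrix σ) (X i) = X (σ i) := by
    intro i
    rw [subst, aeval_X, Finset.sum_eq_single (σ i)]
    · simp [permMatrix]
    · intro j _ hj
      simp [permMatrix, hj]
    · simp
  rw [mono_eq_prod, mono_eq_prod, map_prod,
    ← Equiv.prod_comp σ fun j => (X j : P 5) ^ e.equivMapDomain σ j]
  refine Finset.prod_congr rfl fun i _ => ?_
  rw [map_pow, h, Finsupp.equivMapDomain_apply, Equiv.symm_apply_apply]

/-- The relation is available for every multiplier, so it is used for the inversely permuted one;
the substitution then restores v and permutes only the coded part. -/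
theorem Relation.permute {ω : ℕ →₀ ℕ} {s p : ℕ} {l : List ℕ} (hp : isPerm p = true)
    (h : Relation ω s l) : Relation ω s (l.map (permute p)) := by
  obtain ⟨σ, hσ⟩ := exists_perm_of_isPerm hp
  intro v
  have h1 := subst_mem_trivials (permMatrix σ.symm) ω (h (v.equivMapDomain σ))
  have hv : ∀ c, (decode c + 2 ^ s • v.equivMapDomain σ).equivMapDomain σ.symm
      = decode (HitProblem.permute p c) + 2 ^ s • v := by
    intro c
    rw [hσ]
    ext j
    simp
  rw [map_list_sum, List.map_map] at h1
  have he : ∀ c ∈ l, (subst (permMatrix σ.symm) ∘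
      fun c => (mono (decode c + 2 ^ s • v.equivMapDomain σ) : P 5)) c
        = ((fun c => (mono (decode c + 2 ^ s • v) : P 5)) ∘ HitProblem.permute p) c := fun c _ => by
    rw [Function.comp_apply, Function.comp_apply, subst_permMatrix, hv]
  rw [List.map_congr_left he] at h1
  rw [List.map_map]
  exact h1

end Permutations

/-! ### Rewriting of the low binary digits -/

section Rules

/-- Look up a number in a list of pairs. -/
def look {α : Type} (x : ℕ) : List (ℕ × α) → Option α
  | [] => none
  | p :: ps => bif Nat.beq x p.1 then some p.2 else look x ps

theorem mem_of_look {α : Type} {x : ℕ} {l : α} : ∀ {R : List (ℕ × α)}, look x R = some l →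
    (x, l) ∈ R
  | p :: R, h => by
    unfold look at h
    cases hb : Nat.beq x p.1 with
    | true =>
      rw [hb, cond_true, Option.some_inj] at h
      rw [Nat.eq_of_beq_eq_true hb, ← h]
      simp
    | false =>
      rw [hb, cond_false] at h
      exact List.mem_cons_of_mem _ (mem_of_look h)

/-- Rewrite the last `s` binary digits of the exponents by the rules in `R`. -/
def step (s : ℕ) (R : List (ℕ × List ℕ)) (x : ℕ) : List ℕ :=
  match look (encode ((digits x).map (· % 2 ^ s))) R with
  | none => [x]
  | some l => bif (digits x).all (fun d => Nat.blt d 64) then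
      l.map fun y => encode (List.zipWith (fun a b => a - a % 2 ^ s + b) (digits x) (digits y))
    else [x]

/-- A rule in s digits applies below any higher digits, because these amount to a factor that is a
2^s-th power. The bounds 64 and 36 add up to 100, so the new entries remain base-100 digits. -/
theorem reduces_step {ω : ℕ →₀ ℕ} {s t : ℕ} (hst : s ≤ t) {R : List (ℕ × List ℕ)}
    (hR : ∀ q ∈ R, Relation ω s (q.1 :: q.2) ∧ ∀ y ∈ q.2, ∀ d ∈ digits y, d < 36) :
    Reduces ω t (step s R) := by
  intro x
  unfold step
  cases h : look (encode ((digits x).map (· % 2 ^ s))) R with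
  | none => exact Reduces.singleton x
  | some l =>
    cases hx : (digits x).all (fun d => Nat.blt d 64) with
    | false => exact Reduces.singleton x
    | true =>
      obtain ⟨h1, h2⟩ := hR _ (mem_of_look h)
      simp only [List.all_eq_true, Nat.blt_eq] at hx
      intro v
      obtain ⟨m, rfl⟩ := Nat.exists_eq_add_of_le hst
      -- The digits of x from position s on and the outer multiplier v^(2^(s+m)) are combined into a
      -- single 2^s-th power.
      have h3 := h1 (ofList ((digits x).map (· / 2 ^ s)) + 2 ^ m • v)
      have hz : ∀ y : List ℕ, y.length = 5 → (∀ d ∈ y, d < 36) →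
          decode (encode (List.zipWith (fun a b => a - a % 2 ^ s + b) (digits x) y))
            + 2 ^ (s + m) • v = ofList y +
              2 ^ s • (ofList ((digits x).map (· / 2 ^ s)) + 2 ^ m • v) := by
        intro y hy hd
        match y, hy with
        | [a, b, c, d, e], _ =>
          simp only [digits, List.mem_cons, List.not_mem_nil, or_false, forall_eq_or_imp,
            forall_eq] at hx hd
          rw [decode_encode rfl]
          · rw [smul_add, smul_smul, ← pow_add, ← add_assoc]
            congr 1
            ext j
            have key : ∀ a b : ℕ, a - a % 2 ^ s + b = b + 2 ^ s * (a / 2 ^ s) := by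
              intro a b
              have := Nat.mod_add_div a (2 ^ s)
              omega
            fin_cases j <;> simp [ofList_apply, digits, key]
          · simp only [digits, List.zipWith_cons_cons, List.zipWith_nil_left, List.mem_cons,
              List.not_mem_nil, or_false, forall_eq_or_imp, forall_eq]
            omega
      have hx' : ofList ((digits x).map (· % 2 ^ s)) +
          2 ^ s • (ofList ((digits x).map (· / 2 ^ s)) + 2 ^ m • v)
            = decode x + 2 ^ (s + m) • v := by
        rw [smul_add, smul_smul, ← pow_add, ← add_assoc]
        congr 1
        ext j
        fin_cases j <;> simp [ofList_apply, decode_apply, digits, Nat.mod_add_div]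
      rw [List.map_cons, List.sum_cons] at h3 ⊢
      dsimp only at h3 ⊢
      rw [decode_encode (by rw [List.length_map, digits_length]), hx'] at h3
      · rw [cond_true, List.map_map]
        convert h3 using 3
        refine List.map_congr_left fun y hy => ?_
        rw [Function.comp_apply, hz _ (digits_length y) (h2 y hy), decode]
      · intro d hd
        obtain ⟨a, ha, rfl⟩ := List.mem_map.1 hd
        exact (Nat.mod_le _ _).trans_lt (digits_lt x a ha)

/-- The sum of permuted relations from the list `T`, reduced by `r`. -/
def expand (T : List (List ℕ)) (r : ℕ → List ℕ) (q : List (ℕ × ℕ)) : List ℕ :=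
  q.flatMap fun q => ((T.getD q.1 []).map (permute q.2)).flatMap r

theorem relation_expand {ω : ℕ →₀ ℕ} {s : ℕ} {T : List (List ℕ)} {r : ℕ → List ℕ}
    (hT : ∀ l ∈ T, Relation ω s l) (hr : Reduces ω s r) : ∀ q : List (ℕ × ℕ),
    (q.all fun q => isPerm q.2) = true → Relation ω s (expand T r q)
  | [], _ => Relation.nil
  | q :: qs, h => by
    rw [List.all_cons, Bool.and_eq_true] at h
    refine Relation.append (hr.flatMap (Relation.permute h.1 ?_)) (relation_expand hT hr qs h.2)
    rw [List.getD_eq_getElem?_getD]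
    cases h : T[q.1]? with
    | none => exact Relation.nil
    | some y => exact hT y (List.mem_of_getElem? h)

/-- Check that `l` is a sum of permuted relations from the list `T`, reduced by `r`. -/
def follows (T : List (List ℕ)) (r : ℕ → List ℕ) (l : List ℕ) (q : List (ℕ × ℕ)) : Bool :=
  (q.all fun q => isPerm q.2) && (cancel (l ++ expand T r q)).isEmpty

theorem relation_of_follows {ω : ℕ →₀ ℕ} {s : ℕ} {T : List (List ℕ)} {r : ℕ → List ℕ}
    (hT : ∀ l ∈ T, Relation ω s l) (hr : Reduces ω s r) {l : List ℕ} {q : List (ℕ × ℕ)}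
    (h : follows T r l q = true) : Relation ω s l := by
  rw [follows, Bool.and_eq_true] at h
  exact (relation_of_cancel h.2).of_append_left (relation_expand hT hr q h.1)

end Rules

/-! ### Words in permutations and one transvection -/

section Words

/-- The image of an encoded monomial under the substitution `x₁ ↦ x₁ + x₂`. -/
def transvect (c : ℕ) : List ℕ :=
  match digits c with
  | a :: b :: l => ((List.range (a + 1)).filter fun i => oddChoose a i).map
      fun i => encode ((a - i) :: (b + i) :: l)
  | _ => []

/-- Whether the sum of the first two exponents is less than `100`. -/
def fits (c : ℕ) : Bool := Nat.blt ((digits c).getD 0 0 + (digits c).getD 1 0) 100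

/-- The matrix of the substitution `x₁ ↦ x₁ + x₂`. -/
def transvection : Matrix (Fin 5) (Fin 5) (ZMod 2) :=
  Matrix.of fun j i => if j = i ∨ (j = 1 ∧ i = 0) then 1 else 0

/-- The substitution `x₁ ↦ x₁ + x₂` as an element of `GL₅`. -/
def transvectionGL : GL (Fin 5) (ZMod 2) where
  val := transvection
  inv := transvection
  val_inv := by decide +kernel
  inv_val := by decide +kernel

theorem subst_transvection (i : Fin 5) :
    subst transvection (X i) = if i = 0 then X 0 + X 1 else X i := by
  rw [subst, aeval_X, Fin.sum_univ_five]
  fin_cases i <;> simp [transvection]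

/-- This is the binomial expansion of (x₁ + x₂)^a modulo two. No exponent of x₂ exceeds the sum of
the first two exponents, and `fits` keeps that sum from overflowing a base-100 digit. -/
theorem subst_transvection_mono {c : ℕ} (h : fits c = true) :
    subst transvection (mono (decode c)) = ((transvect c).map fun y => mono (decode y)).sum := by
  have hlt := digits_lt c
  rw [fits, Nat.blt_eq] at h
  rw [decode, transvect]
  obtain ⟨a, b, d, e, f, hd⟩ : ∃ a b d e f, digits c = [a, b, d, e, f] := ⟨_, _, _, _, _, rfl⟩
  rw [hd] at hlt h ⊢
  simp only [List.mem_cons, List.not_mem_nil, or_false, forall_eq_or_imp, forall_eq,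
    List.getD_cons_zero, List.getD_cons_succ] at hlt h
  have hm : ∀ a b d e f : ℕ, (mono (ofList [a, b, d, e, f]) : P 5)
      = X 0 ^ a * X 1 ^ b * (X 2 ^ d * X 3 ^ e * X 4 ^ f) := by
    intro a b d e f
    rw [mono_eq_prod, Fin.prod_univ_five]
    simp only [ofList_apply, mul_assoc]
    rfl
  have hi : ∀ i ∈ (List.range (a + 1)).filter (fun i => oddChoose a i),
      (mono (decode (encode [a - i, b + i, d, e, f])) : P 5)
        = X 0 ^ (a - i) * X 1 ^ i * (X 1 ^ b * (X 2 ^ d * X 3 ^ e * X 4 ^ f)) := by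
    intro i hi
    have := List.mem_range.1 (List.mem_filter.1 hi).1
    rw [decode_encode rfl, hm, pow_add]
    · ring
    · simp only [List.mem_cons, List.not_mem_nil, or_false, forall_eq_or_imp, forall_eq]
      omega
  dsimp only
  rw [List.map_map, Function.comp_def, List.map_congr_left hi, List.sum_map_mul_right, hm]
  simp only [map_mul, map_pow, subst_transvection]
  rw [if_pos trivial, if_neg (by decide), if_neg (by decide), if_neg (by decide),
    if_neg (by decide), mul_assoc, add_comm (X 0) (X 1), add_pow]
  congr 1
  have hf : ∀ L : List ℕ, ((L.filter fun i => oddChoose a i).map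
      fun i => (X 0 ^ (a - i) * X 1 ^ i : P 5)).sum
        = (L.map fun i => X 1 ^ i * X 0 ^ (a - i) * (a.choose i : P 5)).sum := by
    intro L
    induction L with
    | nil => rfl
    | cons i L ih =>
      have hc : (a.choose i : P 5) = if oddChoose a i then 1 else 0 := by
        rw [← map_natCast (C : ZMod 2 →+* P 5), choose_cast]
        split_ifs <;> simp
      rw [List.map_cons, List.sum_cons, hc, ← ih, List.filter_cons]
      split_ifs
      · rw [List.map_cons, List.sum_cons]
        ring
      · ring
  rw [hf, sum_map_range_eq]

/-- Apply a word to a sum of encoded monomials, up to monomials whose first weights are smaller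
than `w`. The letter `0` is the substitution `x₁ ↦ x₁ + x₂`, and the other letters are
permutations of the variables. -/
def act (w : List ℕ) : List ℕ → List ℕ → Option (List ℕ)
  | [], l => some l
  | p :: ps, l =>
    if Nat.beq p 0 then
      bif l.all fits then
        act w ps ((l.flatMap transvect).filter fun c => !lower w (digits c))
      else none
    else bif isPerm p then act w ps (l.map (permute p)) else none

theorem sum_add_sum_filter_mem_trivials {ω : ℕ →₀ ℕ} {w : List ℕ}
    (hw : ∀ i < w.length, ω i = w.getD i 0) (m : List ℕ) :
    (m.map fun c => (mono (decode c) : P 5)).sum +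
      ((m.filter fun c => !lower w (digits c)).map fun c => (mono (decode c) : P 5)).sum
        ∈ trivials 5 ω := by
  induction m with
  | nil => simp
  | cons c m ih =>
    rw [List.map_cons, List.sum_cons, List.filter_cons]
    cases hl : lower w (digits c) with
    | true =>
      have := weight_lt_of_lower hw (digits_length c) hl 0
      rw [smul_zero, add_zero] at this
      rw [if_neg (by simp), add_assoc]
      exact Submodule.add_mem _ (mono_mem_trivials this) ih
    | false =>
      rw [if_pos (by simp), List.map_cons, List.sum_cons, add_add_add_comm,
        add_self_eq_zero, zero_add]
      exact ih

/-- The group element depends on the word alone, so the same translate of a functional can be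
evaluated on many monomials. The first letter acts first, whence the product `g' * g` with the rest
of the word on the left. -/
theorem exists_of_act {ω : ℕ →₀ ℕ} {w : List ℕ} (hw : ∀ i < w.length, ω i = w.getD i 0) :
    ∀ ps : List ℕ, ∃ g : GL (Fin 5) (ZMod 2), ∀ l l' : List ℕ, act w ps l = some l' →
      subst g.1 ((l.map fun c => (mono (decode c) : P 5)).sum) +
        (l'.map fun c => (mono (decode c) : P 5)).sum ∈ trivials 5 ω
  | [] => by
    refine ⟨1, fun l l' h => ?_⟩
    unfold act at h
    obtain rfl := Option.some_inj.1 h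
    rw [Units.val_one, subst_one, AlgHom.id_apply, add_self_eq_zero]
    exact Submodule.zero_mem _
  | p :: ps => by
    obtain ⟨g', hg'⟩ := exists_of_act hw ps
    have next : ∀ (g : GL (Fin 5) (ZMod 2)) (l m l' : List ℕ), act w ps m = some l' →
        subst g.1 ((l.map fun c => (mono (decode c) : P 5)).sum) +
          (m.map fun c => (mono (decode c) : P 5)).sum ∈ trivials 5 ω →
        subst (g' * g).1 ((l.map fun c => (mono (decode c) : P 5)).sum) +
            (l'.map fun c => (mono (decode c) : P 5)).sum ∈ trivials 5 ω := by
      intro g l m l' hm hg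
      have h1 := Submodule.add_mem _ (subst_mem_trivials g'.1 ω hg) (hg' m l' hm)
      rw [map_add, add_assoc, ← add_assoc _ _ (List.sum _), add_self_eq_zero, zero_add] at h1
      rwa [Units.val_mul, subst_mul, AlgHom.comp_apply]
    by_cases h0 : Nat.beq p 0 = true
    · refine ⟨g' * transvectionGL, fun l l' h => ?_⟩
      rw [act, if_pos h0] at h
      cases hf : l.all fits with
      | false => simp [hf] at h
      | true =>
        rw [hf, cond_true] at h
        refine next _ l _ l' h ?_
        have h2 : subst transvection ((l.map fun c => (mono (decode c) : P 5)).sum)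
            = ((l.flatMap transvect).map fun c => (mono (decode c) : P 5)).sum := by
          rw [sum_map_flatMap, map_list_sum, List.map_map]
          refine congrArg List.sum (List.map_congr_left fun c hc => ?_)
          exact subst_transvection_mono (List.all_eq_true.1 hf c hc)
        change subst transvection _ + _ ∈ _
        rw [h2]
        exact sum_add_sum_filter_mem_trivials hw _
    · cases hp : isPerm p with
      | false =>
        -- A letter that is neither `0` nor a permutation makes `act` fail, so any group element
        -- will do.
        refine ⟨1, fun l l' h => ?_⟩
        rw [act, if_neg h0, hp, cond_false] at h
        simp at h
      | true =>
        obtain ⟨σ, hσ⟩ := exists_perm_of_isPerm hp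
        refine ⟨g' * permGL σ.symm, fun l l' h => ?_⟩
        rw [act, if_neg h0, hp, cond_true] at h
        refine next _ l _ l' h ?_
        have h2 : subst (permMatrix σ.symm) ((l.map fun c => (mono (decode c) : P 5)).sum)
            = ((l.map (permute p)).map fun c => (mono (decode c) : P 5)).sum := by
          rw [map_list_sum, List.map_map, List.map_map]
          refine congrArg List.sum (List.map_congr_left fun c _ => ?_)
          rw [Function.comp_apply, Function.comp_apply, subst_permMatrix, hσ]
        change subst (permMatrix σ.symm) _ + _ ∈ _
        rw [h2, add_self_eq_zero]
        exact Submodule.zero_mem _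

end Words

/-! ### Functionals that vanish on hit polynomials -/

section Functional

/-- The linear functional that sums the coefficients of the encoded monomials. -/
noncomputable def functional (F : List ℕ) : P 5 →ₗ[ZMod 2] ZMod 2 :=
  (F.map fun c => MvPolynomial.lcoeff (ZMod 2) (decode c)).sum

theorem functional_apply (F : List ℕ) (f : P 5) :
    functional F f = (F.map fun c => coeff (decode c) f).sum := by
  induction F with
  | nil => simp [functional]
  | cons c F ih =>
    rw [functional, List.map_cons, List.sum_cons, LinearMap.add_apply, List.map_cons,
      List.sum_cons, ← ih]
    rfl

/-- Whether the second monomial occurs in the total Steenrod square of the first. -/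
def occurs : List ℕ → List ℕ → Bool
  | e :: es, c :: cs => Nat.ble e c && oddChoose e (c - e) && occurs es cs
  | _, _ => true

/-- The exponent vectors of the monomials in whose total Steenrod square the given one occurs. -/
def sources : List ℕ → List (List ℕ)
  | [] => [[]]
  | c :: cs => let r := sources cs
    ((List.range (c + 1)).filter fun e => oddChoose e (c - e)).flatMap fun e => r.map (e :: ·)

theorem mem_sources : ∀ es cs : List ℕ, es.length = cs.length → occurs es cs = true →
    es ∈ sources cs
  | [], [], _, _ => by simp [sources]
  | e :: es, c :: cs, hl, h => by
    simp only [occurs, Bool.and_eq_true, Nat.ble_eq] at h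
    rw [sources]
    refine List.mem_flatMap.2 ⟨e, List.mem_filter.2 ⟨List.mem_range.2 (by omega), h.1.2⟩, ?_⟩
    exact List.mem_map.2 ⟨es, mem_sources es cs (by simpa using hl) h.2, rfl⟩

/-- Check that the functional of `F` vanishes on the hit polynomials, where `F` consists of
monomials of degree `d`. -/
def vanishes (d : ℕ) (F : List ℕ) : Bool :=
  F.all fun c => Nat.beq (digits c).sum d && (sources (digits c)).all fun e =>
    Nat.beq e.sum d || Nat.beq ((F.countP fun c => occurs e (digits c)) % 2) 0

/-- By linearity only monomials e matter. As all monomials of F have degree d, the value on Sqⁿ(e)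
is zero unless n = d - deg e, and then it is the number of members of F occurring in Sq(e), modulo
two. Only the finitely many e found by `sources` can give a nonzero count. -/
theorem functional_sq {d : ℕ} {F : List ℕ} (hF : vanishes d F = true) {n : ℕ} (hn : 1 ≤ n)
    (f : P 5) : functional F (sq 5 n f) = 0 := by
  simp only [vanishes, List.all_eq_true, Bool.and_eq_true, Bool.or_eq_true] at hF
  induction f using MvPolynomial.induction_on' with
  | add p q hp hq => rw [map_add, map_add, hp, hq, add_zero]
  | monomial e a =>
    have ha : (monomial e a : P 5) = a • mono e := by
      rw [smul_monomial, smul_eq_mul, mul_one]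
    rw [ha, map_smul, map_smul, functional_apply]
    refine (congrArg (a • ·) ?_).trans (smul_zero a)
    let es := [e 0, e 1, e 2, e 3, e 4]
    have hsum : es.sum = ∑ j, e j := by
      simp [es, Fin.sum_univ_five, add_assoc]
    have hdeg : ∀ c ∈ F, ∑ j, decode c j = d := by
      intro c hc
      rw [← Nat.eq_of_beq_eq_true (hF c hc).1, Fin.sum_univ_five]
      simp [decode_apply, digits, add_assoc]
    have hocc : ∀ c, occurs es (digits c) = true ↔
        ∀ j, e j ≤ decode c j ∧ oddChoose (e j) (decode c j - e j) = true := by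
      intro c
      simp [occurs, es, digits, decode_apply, Fin.forall_fin_succ, and_assoc]
    have hcoeff : ∀ c ∈ F, coeff (decode c) (sq 5 n (mono e))
        = if occurs es (digits c) = true then (if es.sum + n = d then 1 else 0) else 0 := by
      intro c hc
      have hd := hdeg c hc
      rw [coeff_sq_mono, Nat.cast_prod, Finset.prod_congr rfl fun j _ => choose_cast _ _,
        Finset.prod_ite_zero, hsum]
      simp only [hocc, forall_and, Finset.mem_univ, true_implies, Finset.prod_const_one]
      by_cases hle : ∀ j, e j ≤ decode c j
      · have hs : ∑ j, (decode c j - e j) + ∑ j, e j = d := by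
          rw [← hd, ← Finset.sum_add_distrib]
          exact Finset.sum_congr rfl fun j _ => Nat.sub_add_cancel (hle j)
        have hiff : ∑ j, (decode c j - e j) = n ↔ ∑ j, e j + n = d := by omega
        have hle' : e ≤ decode c := hle
        simp only [hle, hle', hiff, true_and, implies_true]
        split_ifs <;> rfl
      · have hle' : ¬ e ≤ decode c := hle
        simp [hle, hle']
    have hcount : ∀ L : List ℕ, (L.map fun c =>
        if occurs es (digits c) = true then (if es.sum + n = d then (1 : ZMod 2) else 0)
          else 0).sum
        = if es.sum + n = d then ((L.countP fun c => occurs es (digits c) : ℕ) : ZMod 2)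
          else 0 := by
      intro L
      induction L with
      | nil => simp
      | cons c L ih =>
        rw [List.map_cons, List.sum_cons, ih, List.countP_cons]
        split_ifs <;> simp [add_comm]
    rw [List.map_congr_left hcoeff, hcount]
    split_ifs with hn'
    · rcases Nat.eq_zero_or_pos (F.countP fun c => occurs es (digits c)) with h0 | h0
      · rw [h0, Nat.cast_zero]
      -- Some c in F occurs in Sq(e), so e is one of the sources that were tested; the exempted case
      -- deg e = d is excluded by n ≥ 1.
      · obtain ⟨c, hc, hc'⟩ := List.countP_pos_iff.1 h0
        rcases (hF c hc).2 es (mem_sources es _ rfl hc') with h | h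
        · have := Nat.eq_of_beq_eq_true h
          omega
        · exact (ZMod.natCast_eq_zero_iff _ _).2 (Nat.dvd_of_mod_eq_zero (Nat.eq_of_beq_eq_true h))
    · rfl

theorem weight_ofList' {l : List ℕ} (h : l.length = 5) (i : ℕ) :
    weight (ofList l) i = (l.map (· / 2 ^ i % 2)).sum := by
  have := weight_ofList h (i + 1) 0 (Nat.lt_succ_self i)
  rwa [smul_zero, add_zero] at this

theorem lower_of_weight_lt {ω : ℕ →₀ ℕ} {w : List ℕ} (hw : ∀ i, ω i = w.getD i 0) {l : List ℕ}
    (hl : l.length = 5) (h : toLex (weight (ofList l)) < toLex ω) : lower w l = true := by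
  obtain ⟨i, h1, h2⟩ := Finsupp.Lex.lt_iff.1 h
  change weight (ofList l) i < ω i at h2
  refine (lower_iff w l).2 ⟨i, ?_, fun j hj => ?_, ?_⟩
  -- Past the end of `w` the entries of ω are zero, and nothing is smaller than zero.
  · by_contra hi
    rw [hw, List.getD_eq_default _ _ (not_lt.1 hi)] at h2
    omega
  · rw [← weight_ofList' hl, ← hw]
    exact h1 j hj
  · rwa [← weight_ofList' hl, ← hw]

theorem functional_trivials {ω : ℕ →₀ ℕ} {w : List ℕ} (hw : ∀ i, ω i = w.getD i 0) {d : ℕ}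
    {F : List ℕ} (hF : vanishes d F = true) (hF' : (F.all fun c => !lower w (digits c)) = true)
    {f : P 5} (hf : f ∈ trivials 5 ω) : functional F f = 0 := by
  suffices h : trivials 5 ω ≤ LinearMap.ker (functional F) from LinearMap.mem_ker.1 (h hf)
  refine sup_le (iSup₂_le fun n hn => ?_) (Submodule.span_le.2 ?_)
  · rintro _ ⟨g, rfl⟩
    exact LinearMap.mem_ker.2 (functional_sq hF hn g)
  · rintro _ ⟨y, hy, rfl⟩
    refine LinearMap.mem_ker.2 ?_
    rw [functional_apply]
    refine List.sum_eq_zero fun b hb => ?_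
    obtain ⟨c, hc, rfl⟩ := List.mem_map.1 hb
    rw [coeff_monomial, if_neg]
    rintro rfl
    have h1 := lower_of_weight_lt hw (digits_length c) hy
    have h2 := List.all_eq_true.1 hF' c hc
    rw [h1] at h2
    exact absurd h2 (by decide)

/-- Only five base-100 digits are read, and 100^5 = 10000000000. -/
theorem decode_eq_decode_iff (c c' : ℕ) :
    decode c = decode c' ↔ c % 10000000000 = c' % 10000000000 := by
  constructor
  · intro h
    have h' := fun j => DFunLike.congr_fun h j
    simp only [decode_apply, digits, Fin.forall_fin_succ, List.getD_cons_zero, Fin.val_zero,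
      Fin.val_succ, List.getD_cons_succ] at h'
    omega
  · intro h
    have : digits c = digits c' := by
      simp only [digits, List.cons.injEq, and_true]
      omega
    rw [decode, this, decode]

/-- The number of pairs of equal entries of two lists of encoded monomials, modulo two. -/
def pairing (F l : List ℕ) : ℕ :=
  (l.map fun c => F.countP fun c' => Nat.beq (c % 10000000000) (c' % 10000000000)).sum % 2

theorem functional_sum (F l : List ℕ) :
    functional F (l.map fun c => mono (decode c)).sum = pairing F l := by
  rw [pairing, ZMod.natCast_mod]
  induction l with
  | nil => simp
  | cons c l ih =>
    rw [List.map_cons, List.sum_cons, map_add, ih, List.map_cons, List.sum_cons, Nat.cast_add,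
      functional_apply]
    congr 1
    clear ih
    induction F with
    | nil => simp
    | cons c' F ih =>
      have h : Nat.beq (c % 10000000000) (c' % 10000000000) = true ↔ decode c = decode c' := by
        rw [Nat.beq_eq, decode_eq_decode_iff]
      rw [List.map_cons, List.sum_cons, ih, List.countP_cons, coeff_monomial, Nat.cast_add,
        add_comm]
      simp only [h]
      congr 1
      split_ifs <;> simp

end Functional

/-! ### The grading and the passage to QP_k(ω) -/

section Graded

variable {k : ℕ} {ω : ℕ →₀ ℕ}

theorem PLt_le_PLe (k : ℕ) (ω : ℕ →₀ ℕ) : PLt k ω ≤ PLe k ω := by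
  refine Submodule.span_mono ?_
  rintro f ⟨y, h1, h2, h3⟩
  exact ⟨y, h1, h2.le, h3⟩

theorem mono_isHomogeneous (y : Fin k →₀ ℕ) : (mono y : P k).IsHomogeneous y.degree :=
  isHomogeneous_monomial (σ := Fin k) (1 : ZMod 2) rfl

theorem isHomogeneous_of_mem_PLe {f : P k} (hf : f ∈ PLe k ω) : f.IsHomogeneous (wdeg ω) := by
  suffices h : PLe k ω ≤ homogeneousSubmodule (Fin k) (ZMod 2) (wdeg ω) from
    (mem_homogeneousSubmodule _ _).1 (h hf)
  refine Submodule.span_le.2 ?_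
  rintro _ ⟨y, hy, -, rfl⟩
  exact hy ▸ mono_isHomogeneous y

theorem homogeneousComponent_mem_PLt {f : P k} (hf : f ∈ lowWeight k ω) :
    homogeneousComponent (wdeg ω) f ∈ PLt k ω := by
  suffices h : lowWeight k ω ≤ (PLt k ω).comap (homogeneousComponent (wdeg ω)) from h hf
  refine Submodule.span_le.2 ?_
  rintro _ ⟨y, hy, rfl⟩
  change homogeneousComponent (wdeg ω) (mono y) ∈ PLt k ω
  rw [homogeneousComponent_of_mem (mono_isHomogeneous y)]
  split_ifs with h
  · exact Submodule.subset_span ⟨y, h.symm, hy, rfl⟩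
  · exact Submodule.zero_mem _

/-- The component of degree deg ω of a hit polynomial is hit, and that of a low-weight polynomial
lies in P_k⁻(ω). -/
theorem exists_add_of_mem_trivials {f : P k} (hf : f ∈ trivials k ω)
    (hd : f.IsHomogeneous (wdeg ω)) : ∃ h ∈ hit k, ∃ p ∈ PLt k ω, h + p = f := by
  obtain ⟨h, hh, p, hp, rfl⟩ := Submodule.mem_sup.1 hf
  refine ⟨_, homogeneousComponent_mem_hit (wdeg ω) hh, _, homogeneousComponent_mem_PLt hp, ?_⟩
  rw [← map_add, homogeneousComponent_of_mem hd, if_pos rfl]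

/-- Justifies computing modulo the ungraded `trivials`. Elements of P_k(ω) are homogeneous, so they
split as a hit polynomial plus an element of P_k⁻(ω); the hit part is then a difference of elements
of P_k(ω). -/
theorem mem_relations_iff {f : P k} (hf : f ∈ PLe k ω) :
    (⟨f, hf⟩ : PLe k ω) ∈ relations k ω ↔ f ∈ trivials k ω := by
  change f ∈ (hit k ⊓ PLe k ω) ⊔ PLt k ω ↔ _
  constructor
  · intro h
    have hle : (hit k ⊓ PLe k ω) ⊔ PLt k ω ≤ trivials k ω := by
      refine sup_le (fun g hg => Submodule.mem_sup_left hg.1) (Submodule.span_le.2 ?_)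
      rintro _ ⟨y, -, hy, rfl⟩
      exact mono_mem_trivials hy
    exact hle h
  · intro h
    obtain ⟨g, hg, p, hp, rfl⟩ := exists_add_of_mem_trivials h (isHomogeneous_of_mem_PLe hf)
    have := Submodule.sub_mem _ hf (PLt_le_PLe k ω hp)
    rw [add_sub_cancel_right] at this
    exact Submodule.add_mem_sup ⟨hg, this⟩ hp

theorem cls_eq_cls_iff {f g : P k} (hf : f ∈ PLe k ω) (hg : g ∈ PLe k ω) :
    cls f hf = cls g hg ↔ f - g ∈ trivials k ω := by
  rw [← mem_relations_iff (Submodule.sub_mem _ hf hg), cls, cls, Submodule.mkQ_apply,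
    Submodule.mkQ_apply, Submodule.Quotient.eq]
  rfl

/-- Over 𝔽₂ a polynomial is the sum of the monomials in its support, which serves as the finite set
of smaller monomials. -/
theorem inadmissible_of_mem_hit {x : Fin k →₀ ℕ} {q : P k} (hq : mono x + q ∈ hit k)
    (h : ∀ y ∈ q.support, MonoLT y x) : Inadmissible x := by
  refine ⟨q.support, h, ?_⟩
  convert hq using 2
  conv_rhs => rw [q.as_sum]
  refine Finset.sum_congr rfl fun y hy => ?_
  have key : ∀ a : ZMod 2, a ≠ 0 → a = 1 := by decide
  rw [key _ (mem_support_iff.1 hy)]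

end Graded

/-! ### Enumeration of the monomials of a given weight -/

section Enumeration

/-- The lists of length `n` with entries `0` and `1`. -/
def bitLists : ℕ → List (List ℕ)
  | 0 => [[]]
  | n + 1 => (bitLists n).flatMap fun l => [0 :: l, 1 :: l]

theorem mem_bitLists : ∀ l : List ℕ, (∀ x ∈ l, x < 2) → l ∈ bitLists l.length
  | [], _ => by simp [bitLists]
  | x :: l, h => by
    rw [List.forall_mem_cons] at h
    refine List.mem_flatMap.2 ⟨l, mem_bitLists l h.2, ?_⟩
    have := h.1
    interval_cases x <;> simp

/-- The exponent vectors with the given list of weights. -/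
def vectors : List ℕ → List (List ℕ)
  | [] => [[0, 0, 0, 0, 0]]
  | a :: w => let r := vectors w
    ((bitLists 5).filter fun b => Nat.beq b.sum a).flatMap fun b =>
      r.map fun l => List.zipWith (fun x y => x + 2 * y) b l

theorem mem_vectors : ∀ w l : List ℕ, l.length = 5 →
    (∀ i, (l.map (· / 2 ^ i % 2)).sum = w.getD i 0) → l ∈ vectors w
  | [], l, hl, h => by
    have h0 : ∀ x ∈ l, x = 0 := by
      intro x hx
      refine Nat.eq_of_testBit_eq fun i => ?_
      have h1 := h i
      rw [List.getD_nil, List.sum_eq_zero_iff] at h1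
      have h2 := h1 _ (List.mem_map_of_mem hx)
      rw [Nat.testBit_eq_decide_div_mod_eq, h2]
      simp
    match l, hl with
    | [a, b, c, d, e], _ =>
      simp only [List.mem_cons, List.not_mem_nil, or_false, forall_eq_or_imp, forall_eq] at h0
      simp [vectors, h0]
  | a :: w, l, hl, h => by
    rw [vectors]
    refine List.mem_flatMap.2 ⟨l.map (· % 2), List.mem_filter.2 ⟨?_, ?_⟩, ?_⟩
    · have := mem_bitLists (l.map (· % 2)) fun x hx => by
        obtain ⟨y, -, rfl⟩ := List.mem_map.1 hx
        exact Nat.mod_lt _ (by norm_num)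
      rwa [List.length_map, hl] at this
    · rw [Nat.beq_eq]
      simpa using h 0
    · refine List.mem_map.2 ⟨l.map (· / 2), mem_vectors w _ (by rw [List.length_map, hl]) ?_, ?_⟩
      · intro i
        have := h (i + 1)
        rw [List.map_map]
        simpa [Function.comp_def, pow_succ', Nat.div_div_eq_div_mul] using this
      · match l, hl with
        | [a, b, c, d, e], _ => simp [Nat.mod_add_div]

/-- Whether `w` is the list of the weights of an exponent vector. -/
def hasWeights : List ℕ → List ℕ → Bool
  | [], l => l.all fun x => Nat.beq x 0
  | a :: w, l => Nat.beq (l.map (· % 2)).sum a && hasWeights w (l.map (· / 2))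

theorem sum_of_hasWeights : ∀ w l : List ℕ, hasWeights w l = true →
    ∀ i, (l.map (· / 2 ^ i % 2)).sum = w.getD i 0
  | [], l, h => by
    intro i
    simp only [hasWeights, List.all_eq_true, Nat.beq_eq] at h
    rw [List.getD_nil]
    refine List.sum_eq_zero fun x hx => ?_
    obtain ⟨y, hy, rfl⟩ := List.mem_map.1 hx
    rw [h y hy]
    simp
  | a :: w, l, h => by
    simp only [hasWeights, Bool.and_eq_true, Nat.beq_eq] at h
    intro i
    cases i with
    | zero => simpa using h.1
    | succ i =>
      have := sum_of_hasWeights w _ h.2 i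
      rw [List.map_map] at this
      simpa [Function.comp_def, pow_succ', Nat.div_div_eq_div_mul] using this

/-- The code of an exponent vector. -/
noncomputable def code (x : Fin 5 →₀ ℕ) : ℕ := encode [x 0, x 1, x 2, x 3, x 4]

theorem ofList_entries (x : Fin 5 →₀ ℕ) : ofList [x 0, x 1, x 2, x 3, x 4] = x := by
  ext j
  fin_cases j <;> rfl

theorem decode_code {x : Fin 5 →₀ ℕ} (h : ∀ j, x j < 100) : decode (code x) = x := by
  rw [code, decode_encode rfl, ofList_entries]
  simp [h]

/-- With all entries below 100, comparing codes as numbers is comparing exponent vectors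
lexicographically; the checks use the former. -/
theorem code_lt_code {x y : Fin 5 →₀ ℕ} (hx : ∀ j, x j < 100) (hy : ∀ j, y j < 100)
    (h : toLex x < toLex y) : code x < code y := by
  obtain ⟨i, h1, h2⟩ := Finsupp.Lex.lt_iff.1 h
  change ∀ j < i, x j = y j at h1
  change x i < y i at h2
  have c0 := h1 0
  have c1 := h1 1
  have c2 := h1 2
  have c3 := h1 3
  have hx1 := hx 1
  have hx2 := hx 2
  have hx3 := hx 3
  have hx4 := hx 4
  have hy1 := hy 1
  have hy2 := hy 2
  have hy3 := hy 3
  have hy4 := hy 4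
  simp only [code, encode, List.foldl]
  fin_cases i <;> simp at c0 c1 c2 c3 h2 <;> omega

end Enumeration

/-! ### From congruences to a basis, admissibility and generation -/

section Structure

variable {k : ℕ} {ω : ℕ →₀ ℕ} {s : Set ℕ} {m : ℕ → Fin k →₀ ℕ}

/-- The classes modulo `trivials k ω` of a family of monomials. -/
noncomputable def classes (ω : ℕ →₀ ℕ) (s : Set ℕ) (m : ℕ → Fin k →₀ ℕ) (t : s) :
    P k ⧸ trivials k ω :=
  (trivials k ω).mkQ (mono (m t))

/-- If m_t were inadmissible, it would be congruent to a sum of smaller monomials. Those of lower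
weight are trivial; those of weight ω are spanned by basis monomials not exceeding them, hence
different from m_t. This contradicts independence, and it is why `hspan` carries the bound by x. -/
theorem not_inadmissible (hweight : ∀ t ∈ s, weight (m t) = ω)
    (hspan : ∀ x, weight x = ω → mono x ∈ Submodule.span (ZMod 2)
      {f | ∃ t ∈ s, toLex (m t) ≤ toLex x ∧ f = mono (m t)} ⊔ trivials k ω)
    (hind : LinearIndependent (ZMod 2) (classes ω s m)) {t : ℕ} (ht : t ∈ s) :
    ¬ Inadmissible (m t) := by
  rintro ⟨S, hS, hhit⟩
  let N : Submodule (ZMod 2) (P k) := Submodule.span (ZMod 2)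
      {f | ∃ u ∈ s, u ≠ t ∧ f = mono (m u)} ⊔ trivials k ω
  have h1 : ∀ y ∈ S, mono y ∈ N := by
    intro y hy
    obtain ⟨-, h | ⟨h, h'⟩⟩ := hS y hy
    · rw [hweight t ht] at h
      exact Submodule.mem_sup_right (mono_mem_trivials h)
    · rw [hweight t ht] at h
      refine (sup_le_sup_right (Submodule.span_mono ?_) _ :
        Submodule.span (ZMod 2) {f | ∃ t ∈ s, toLex (m t) ≤ toLex y ∧ f = mono (m t)}
          ⊔ trivials k ω ≤ N) (hspan y h)
      rintro f ⟨u, hu, hle, rfl⟩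
      refine ⟨u, hu, ?_, rfl⟩
      rintro rfl
      exact absurd h' (not_lt.2 hle)
  have h2 : mono (m t) ∈ N := by
    have := Submodule.sub_mem N (Submodule.mem_sup_right (Submodule.mem_sup_left hhit))
      (Submodule.sum_mem N h1)
    rwa [add_sub_cancel_right] at this
  refine hind.notMem_span_image (s := {u : s | (u : ℕ) ≠ t}) (x := ⟨t, ht⟩) (by simp) ?_
  obtain ⟨p, hp, q, hq, hpq⟩ := Submodule.mem_sup.1 h2
  have h3 : classes ω s m ⟨t, ht⟩ = (trivials k ω).mkQ p := by
    rw [classes, ← hpq, map_add]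
    have : (trivials k ω).mkQ q = 0 := (Submodule.Quotient.mk_eq_zero _).2 hq
    rw [this, add_zero]
  rw [h3]
  suffices h : Submodule.span (ZMod 2) {f | ∃ u ∈ s, u ≠ t ∧ f = mono (m u)} ≤
      (Submodule.span (ZMod 2) (classes ω s m '' {u : s | (u : ℕ) ≠ t})).comap
        (trivials k ω).mkQ from h hp
  refine Submodule.span_le.2 ?_
  rintro _ ⟨u, hu, hut, rfl⟩
  exact Submodule.subset_span ⟨⟨u, hu⟩, hut, rfl⟩

theorem mono_mem_PLe (hdeg : ∀ x : Fin k →₀ ℕ, weight x = ω → x.degree = wdeg ω)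
    (hweight : ∀ t ∈ s, weight (m t) = ω) : ∀ t ∈ s, mono (m t) ∈ PLe k ω := fun t ht =>
  Submodule.subset_span ⟨m t, hdeg _ (hweight t ht), (congrArg toLex (hweight t ht)).le, rfl⟩

/-- The inclusion of P_k(ω) induces a map from QP_k(ω) to the quotient by `trivials`, where the
images are independent. -/
theorem linearIndependent_cls (hmem : ∀ t ∈ s, mono (m t) ∈ PLe k ω)
    (hind : LinearIndependent (ZMod 2) (classes ω s m)) :
    LinearIndependent (ZMod 2) fun t : s => cls (mono (m t)) (hmem t t.2) := by
  refine LinearIndependent.of_comp (Submodule.mapQ (relations k ω) (trivials k ω)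
    (PLe k ω).subtype fun f hf => (mem_relations_iff f.2).1 hf) ?_
  exact hind

theorem span_cls_eq_top (hmem : ∀ t ∈ s, mono (m t) ∈ PLe k ω)
    (hspan : ∀ x, weight x = ω → mono x ∈ Submodule.span (ZMod 2)
      {f | ∃ t ∈ s, toLex (m t) ≤ toLex x ∧ f = mono (m t)} ⊔ trivials k ω) :
    ⊤ ≤ Submodule.span (ZMod 2) (Set.range fun t : s => cls (mono (m t)) (hmem t t.2)) := by
  set M := Submodule.span (ZMod 2) (Set.range fun t : s => cls (mono (m t)) (hmem t t.2))
  -- L consists of the polynomials in P_k(ω) whose class lies in M; it suffices to find all spanning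
  -- monomials in it.
  let L : Submodule (ZMod 2) (P k) := (M.comap (relations k ω).mkQ).map (PLe k ω).subtype
  have hL : PLe k ω ≤ L := by
    refine Submodule.span_le.2 ?_
    rintro _ ⟨y, hy, hyω, rfl⟩
    have hyP : mono y ∈ PLe k ω := Submodule.subset_span ⟨y, hy, hyω, rfl⟩
    refine ⟨⟨mono y, hyP⟩, ?_, rfl⟩
    change cls (mono y) hyP ∈ M
    have hsum : ∀ p ∈ Submodule.span (ZMod 2) {f | ∃ t ∈ s, f = mono (m t)}, ∃ h : p ∈ PLe k ω,
        cls p h ∈ M := by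
      intro p hp
      induction hp using Submodule.span_induction with
      | mem p hp =>
        obtain ⟨t, ht, rfl⟩ := hp
        exact ⟨hmem t ht, Submodule.subset_span ⟨⟨t, ht⟩, rfl⟩⟩
      | zero => exact ⟨Submodule.zero_mem _, Submodule.zero_mem M⟩
      | add p q _ _ hp hq =>
        obtain ⟨hp, hp'⟩ := hp
        obtain ⟨hq, hq'⟩ := hq
        exact ⟨Submodule.add_mem _ hp hq, Submodule.add_mem M hp' hq'⟩
      | smul c p _ hp =>
        obtain ⟨hp, hp'⟩ := hp
        exact ⟨Submodule.smul_mem _ c hp, Submodule.smul_mem M c hp'⟩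
    have h1 : mono y ∈ Submodule.span (ZMod 2) {f | ∃ t ∈ s, f = mono (m t)} ⊔ trivials k ω := by
      rcases hyω.lt_or_eq with h | h
      · exact Submodule.mem_sup_right (mono_mem_trivials h)
      · suffices h' : Submodule.span (ZMod 2)
            {f | ∃ t ∈ s, toLex (m t) ≤ toLex y ∧ f = mono (m t)} ≤
              Submodule.span (ZMod 2) {f | ∃ t ∈ s, f = mono (m t)} from
          (sup_le_sup_right h' _ : _ ≤ _) (hspan y (toLex.injective h))
        refine Submodule.span_mono ?_
        rintro f ⟨t, ht, -, rfl⟩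
        exact ⟨t, ht, rfl⟩
    obtain ⟨p, hp, q, hq, hpq⟩ := Submodule.mem_sup.1 h1
    obtain ⟨hpP, hpM⟩ := hsum p hp
    have h2 : cls (mono y) hyP = cls p hpP := by
      rw [cls_eq_cls_iff, ← hpq, add_sub_cancel_left]
      exact hq
    rwa [h2]
  intro v _
  obtain ⟨⟨f, hf⟩, rfl⟩ := (relations k ω).mkQ_surjective v
  obtain ⟨⟨g, hg⟩, h, hgf⟩ := hL hf
  change g = f at hgf
  subst hgf
  exact h

theorem generates_cls (hmem : ∀ t ∈ s, mono (m t) ∈ PLe k ω)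
    (htop : ⊤ ≤ Submodule.span (ZMod 2) (Set.range fun t : s => cls (mono (m t)) (hmem t t.2)))
    {t : ℕ} (ht : t ∈ s)
    (hgen : ∀ W : Submodule (ZMod 2) (P k), trivials k ω ≤ W →
      (∀ (g : GL (Fin k) (ZMod 2)), ∀ f ∈ W, subst g.1 f ∈ W) → mono (m t) ∈ W →
        ∀ u ∈ s, mono (m u) ∈ W) : Generates (cls (mono (m t)) (hmem t ht)) := by
  intro W hW
  refine top_le_iff.1 (htop.trans (Submodule.span_le.2 ?_))
  rintro _ ⟨u, rfl⟩
  -- The lift of W to P_k, enlarged by `trivials`, is stable under substitutions, so `hgen` applies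
  -- to it.
  let L : Submodule (ZMod 2) (P k) :=
    (W.toSubmodule.comap (relations k ω).mkQ).map (PLe k ω).subtype ⊔ trivials k ω
  have hL : mono (m u) ∈ L := by
    refine hgen L le_sup_right (fun g f hf => ?_) (Submodule.mem_sup_left ?_) u u.2
    · obtain ⟨_, ⟨p, hp, rfl⟩, q, hq, rfl⟩ := Submodule.mem_sup.1 hf
      rw [map_add]
      refine Submodule.add_mem_sup ⟨PLeRep k ω g p, ?_, rfl⟩ (subst_mem_trivials g.1 ω hq)
      exact W.apply_mem_toSubmodule g hp
    · exact ⟨⟨mono (m t), hmem t ht⟩, hW, rfl⟩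
  obtain ⟨_, ⟨⟨p, hpP⟩, hp, rfl⟩, q, hq, hpq⟩ := Submodule.mem_sup.1 hL
  change p + q = _ at hpq
  have h2 : cls (mono (m u)) (hmem u u.2) = cls p hpP := by
    rw [cls_eq_cls_iff, ← hpq, add_sub_cancel_left]
    exact hq
  change cls (mono (m u)) (hmem u u.2) ∈ W.toSubmodule
  rw [h2]
  exact hp

/-- The description of `QP_k(ω)` by a family of monomials, from conditions modulo hit polynomials
and monomials of smaller weight. -/
theorem exists_basis_and_generates (hdeg : ∀ x : Fin k →₀ ℕ, weight x = ω → x.degree = wdeg ω)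
    (hweight : ∀ t ∈ s, weight (m t) = ω)
    (hspan : ∀ x, weight x = ω → mono x ∈ Submodule.span (ZMod 2)
      {f | ∃ t ∈ s, toLex (m t) ≤ toLex x ∧ f = mono (m t)} ⊔ trivials k ω)
    (hinad : ∀ x, weight x = ω → x ∉ m '' s → Inadmissible x)
    (hind : LinearIndependent (ZMod 2) (classes ω s m)) {t : ℕ} (ht : t ∈ s)
    (hgen : ∀ W : Submodule (ZMod 2) (P k), trivials k ω ≤ W →
      (∀ (g : GL (Fin k) (ZMod 2)), ∀ f ∈ W, subst g.1 f ∈ W) → mono (m t) ∈ W →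
        ∀ u ∈ s, mono (m u) ∈ W) :
    ∃ hmem : ∀ t ∈ s, mono (m t) ∈ PLe k ω,
      admissibleMonomials k ω = m '' s ∧
      (∃ b : Module.Basis s (ZMod 2) (QP k ω), ∀ t : s, b t = cls (mono (m t)) (hmem t t.2)) ∧
      Module.finrank (ZMod 2) (QP k ω) = Nat.card s ∧
      Generates (cls (mono (m t)) (hmem t ht)) := by
  have hmem := mono_mem_PLe hdeg hweight
  have htop := span_cls_eq_top hmem hspan
  have hli := linearIndependent_cls hmem hind
  refine ⟨hmem, ?_, ⟨Module.Basis.mk hli htop, fun t => Module.Basis.mk_apply hli htop t⟩,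
    Module.finrank_eq_nat_card_basis (Module.Basis.mk hli htop), generates_cls hmem htop ht hgen⟩
  ext x
  constructor
  · rintro ⟨hx, hxω⟩
    by_contra h
    exact hx (hinad x hxω h)
  · rintro ⟨t, ht, rfl⟩
    exact ⟨not_inadmissible hweight hspan hind ht, hweight t ht⟩

end Structure

/-! ### Decidable certificates and what they prove -/

section Checks

variable {ω : ℕ →₀ ℕ} {w : List ℕ}

/-- Check that the `i`-th polynomial in `Q` has the monomials of the `i`-th list in `T`, up to
monomials whose first weights are smaller than `w`. -/
def areSquares (w : List ℕ) : List (List (ℕ × ℕ)) → List (List ℕ) → Bool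
  | q :: Q, l :: T => isSquares w q l && areSquares w Q T
  | [], [] => true
  | _, _ => false

theorem relation_of_areSquares (hw : ∀ i < w.length, ω i = w.getD i 0) :
    ∀ (Q : List (List (ℕ × ℕ))) (T : List (List ℕ)), areSquares w Q T = true →
      ∀ l ∈ T, Relation ω w.length l
  | q :: Q, l :: T, h => by
    rw [areSquares, Bool.and_eq_true] at h
    exact List.forall_mem_cons.2
      ⟨relation_of_isSquares hw h.1, relation_of_areSquares hw Q T h.2⟩
  | [], [], _ => by simp

/-- Check that each rewriting rule in `R` is a permuted relation from the list `T`, reduced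
by `r`. -/
def areRules (T : List (List ℕ)) (r : ℕ → List ℕ) : List (ℕ × List ℕ) → List (ℕ × ℕ) → Bool
  | x :: R, q :: Q => follows T r (x.1 :: x.2) [q] &&
      (x.2.all fun y => (digits y).all fun d => Nat.blt d 36) && areRules T r R Q
  | [], [] => true
  | _, _ => false

theorem relation_of_areRules {s : ℕ} {T : List (List ℕ)} {r : ℕ → List ℕ}
    (hT : ∀ l ∈ T, Relation ω s l) (hr : Reduces ω s r) :
    ∀ (R : List (ℕ × List ℕ)) (Q : List (ℕ × ℕ)), areRules T r R Q = true →
      ∀ q ∈ R, Relation ω s (q.1 :: q.2) ∧ ∀ y ∈ q.2, ∀ d ∈ digits y, d < 36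
  | x :: R, q :: Q, h => by
    rw [areRules, Bool.and_eq_true, Bool.and_eq_true] at h
    refine List.forall_mem_cons.2 ⟨⟨relation_of_follows hT hr h.1.1, ?_⟩,
      relation_of_areRules hT hr R Q h.2⟩
    simpa only [List.all_eq_true, Nat.blt_eq] using h.1.2
  | [], [], _ => by simp

/-- Whether all entries of `m` encode exponent vectors of weight `w` and are smaller than `c`. -/
def smaller (w : List ℕ) (c : ℕ) (m : List ℕ) : Bool :=
  m.all fun y => Nat.blt y c && hasWeights w (digits y)

/-- Whether the monomial encoded by `c` is equivalent to a sum of smaller monomials of weight `w`,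
by the rules for the reduction `r` or by the entry of `c` in the table `C`. -/
def reducible (w : List ℕ) (r : ℕ → List ℕ) (T : List (List ℕ)) (C : List (ℕ × List (ℕ × ℕ)))
    (c : ℕ) : Bool :=
  smaller w c (r c) || match look c C with
    | none => false
    | some q => (q.all fun q => isPerm q.2) && smaller w c (cancel (c :: expand T r q))

theorem exists_of_reducible {s c : ℕ} {r : ℕ → List ℕ} {T : List (List ℕ)}
    {C : List (ℕ × List (ℕ × ℕ))} (hT : ∀ l ∈ T, Relation ω s l) (hr : Reduces ω s r)
    (h : reducible w r T C c = true) :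
    ∃ m, Relation ω s (c :: m) ∧ ∀ y ∈ m, y < c ∧ hasWeights w (digits y) = true := by
  have key : ∀ m, smaller w c m = true → ∀ y ∈ m, y < c ∧ hasWeights w (digits y) = true := by
    intro m hm
    simpa only [smaller, List.all_eq_true, Bool.and_eq_true, Nat.blt_eq] using hm
  rw [reducible, Bool.or_eq_true] at h
  rcases h with h | h
  · exact ⟨r c, hr c, key _ h⟩
  · cases hl : look c C with
    | none => simp [hl] at h
    | some q =>
      rw [hl] at h
      dsimp only at h
      rw [Bool.and_eq_true] at h
      refine ⟨_, ?_, key _ h.2⟩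
      have h1 := relation_expand hT hr q h.1
      intro v
      -- The candidate list was formed by adding c to the relation; adding c once more recovers the
      -- relation itself.
      rw [List.map_cons, List.sum_cons, sum_cancel, List.map_cons, List.sum_cons, ← add_assoc,
        add_self_eq_zero, zero_add]
      exact h1 v

/-- Check that the monomials of weight `w` have degree `d` and entries below `100`, and that they
are reducible unless they are in the list `B`. -/
def classifies (w : List ℕ) (d : ℕ) (r : ℕ → List ℕ) (T : List (List ℕ))
    (C : List (ℕ × List (ℕ × ℕ))) (B : List ℕ) : Bool :=
  (vectors w).all fun l => Nat.beq l.sum d && (l.all fun x => Nat.blt x 100) &&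
    (reducible w r T C (encode l) || B.any (Nat.beq (encode l)))

/-- Check that the monomials of the list can be separated by the functional `F`, applied after
words. -/
def separates (w F : List ℕ) : List (ℕ × ℕ × List ℕ) → Bool
  | [] => true
  | q :: O => (match act w q.2.2 [q.2.1] with
      | none => false
      | some l => Nat.beq (pairing F l) 1) &&
    (O.all fun x => match act w q.2.2 [x.2.1] with
      | none => false
      | some l => Nat.beq (pairing F l) 0) && separates w F O

/-- Triangular elimination: the translate of F by the word of the first monomial takes the value one
there and zero on all later ones, so the first coefficient vanishes and the rest of the list
remains. -/
theorem eq_zero_of_separates {F : List ℕ} (hw : ∀ i, ω i = w.getD i 0)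
    (hF : ∀ f ∈ trivials 5 ω, functional F f = 0) (f : ℕ → ZMod 2) :
    ∀ O : List (ℕ × ℕ × List ℕ), separates w F O = true →
      (O.map fun q => f q.1 • (mono (decode q.2.1) : P 5)).sum ∈ trivials 5 ω →
        ∀ q ∈ O, f q.1 = 0
  | [], _, _ => by simp
  | q :: O, h, hO => by
    rw [separates, Bool.and_eq_true, Bool.and_eq_true] at h
    obtain ⟨⟨h1, h2⟩, h3⟩ := h
    obtain ⟨g, hg⟩ := exists_of_act (fun i _ => hw i) q.2.2
    have hval : ∀ c l, act w q.2.2 [c] = some l →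
        functional F (subst g.1 (mono (decode c))) = pairing F l := by
      intro c l hl
      have := hF _ (hg _ _ hl)
      rw [map_add, functional_sum, List.map_cons, List.map_nil, List.sum_cons, List.sum_nil,
        add_zero] at this
      rwa [← CharTwo.sub_eq_add, sub_eq_zero] at this
    have hq : functional F (subst g.1 (mono (decode q.2.1))) = 1 := by
      cases hl : act w q.2.2 [q.2.1] with
      | none => simp [hl] at h1
      | some l =>
        rw [hl] at h1
        rw [hval _ _ hl, Nat.eq_of_beq_eq_true h1, Nat.cast_one]
    have hx : ∀ x ∈ O, functional F (subst g.1 (mono (decode x.2.1))) = 0 := by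
      intro x hx
      have := List.all_eq_true.1 h2 x hx
      cases hl : act w q.2.2 [x.2.1] with
      | none => simp [hl] at this
      | some l =>
        rw [hl] at this
        rw [hval _ _ hl, Nat.eq_of_beq_eq_true this, Nat.cast_zero]
    have hsum : functional F (subst g.1
        ((O.map fun q => f q.1 • (mono (decode q.2.1) : P 5)).sum)) = 0 := by
      rw [map_list_sum, map_list_sum, List.map_map, List.map_map]
      refine List.sum_eq_zero fun b hb => ?_
      obtain ⟨x, hx', rfl⟩ := List.mem_map.1 hb
      simp only [Function.comp_apply, map_smul, hx x hx', smul_zero]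
    have hfq : f q.1 = 0 := by
      have := hF _ (subst_mem_trivials g.1 ω hO)
      rwa [List.map_cons, List.sum_cons, map_add, map_add, hsum, map_smul, map_smul, hq,
        add_zero, smul_eq_mul, mul_one] at this
    rw [List.map_cons, List.sum_cons, hfq, zero_smul, zero_add] at hO
    exact List.forall_mem_cons.2 ⟨hfq, eq_zero_of_separates hw hF f O h3 hO⟩

/-- Check that the monomials obtained successively are in the submodule generated by those
in `K`. An entry consists of the new monomial, a known monomial to which a word is applied, the
word, further known monomials, and permuted relations from the list `T`. -/
def generates (w : List ℕ) (r : ℕ → List ℕ) (T : List (List ℕ)) : List ℕ →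
    List (ℕ × ℕ × List ℕ × List ℕ × List (ℕ × ℕ)) → Bool
  | _, [] => true
  | K, x :: S => K.any (Nat.beq x.2.1) && (x.2.2.2.1.all fun c => K.any (Nat.beq c)) &&
    (match act w x.2.2.1 [x.2.1] with
      | none => false
      | some l => follows T r ((x.1 :: x.2.2.2.1) ++ l.flatMap r) x.2.2.2.2) &&
    generates w r T (x.1 :: K) S

theorem mem_of_any_beq {c : ℕ} {K : List ℕ} (h : K.any (Nat.beq c) = true) : c ∈ K := by
  obtain ⟨x, hx, h⟩ := List.any_eq_true.1 h
  rwa [Nat.eq_of_beq_eq_true h]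

theorem mem_of_generates {r : ℕ → List ℕ} {T : List (List ℕ)} {s : ℕ}
    (hw : ∀ i, ω i = w.getD i 0) (hT : ∀ l ∈ T, Relation ω s l) (hr : Reduces ω s r)
    {W : Submodule (ZMod 2) (P 5)} (hW : trivials 5 ω ≤ W)
    (hW' : ∀ (g : GL (Fin 5) (ZMod 2)), ∀ f ∈ W, subst g.1 f ∈ W) :
    ∀ (S : List (ℕ × ℕ × List ℕ × List ℕ × List (ℕ × ℕ))) (K : List ℕ),
      generates w r T K S = true → (∀ c ∈ K, mono (decode c) ∈ W) →
        ∀ x ∈ S, mono (decode x.1) ∈ W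
  | [], _, _, _ => by simp
  | x :: S, K, h, hK => by
    rw [generates, Bool.and_eq_true, Bool.and_eq_true, Bool.and_eq_true] at h
    obtain ⟨⟨⟨h1, h2⟩, h3⟩, h4⟩ := h
    suffices hx : mono (decode x.1) ∈ W from List.forall_mem_cons.2
      ⟨hx, mem_of_generates hw hT hr hW hW' S _ h4 (List.forall_mem_cons.2 ⟨hx, hK⟩)⟩
    obtain ⟨g, hg⟩ := exists_of_act (fun i _ => hw i) x.2.2.1
    cases hl : act w x.2.2.1 [x.2.1] with
    | none => simp [hl] at h3
    | some l =>
      rw [hl] at h3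
      -- Membership in W is passed along congruences: from the image of the known monomial to its
      -- expansion `l` (`e3`), to the reduction of `l` (`e6`), to the new monomial plus known ones
      -- (`e7`), and finally to the new monomial.
      have e1 := hW (hg _ _ hl)
      have e2 := hW' g _ (hK _ (mem_of_any_beq h1))
      rw [List.map_cons, List.map_nil, List.sum_cons, List.sum_nil, add_zero] at e1
      have e3 := (Submodule.add_mem_iff_right W e2).1 e1
      have e4 := hW (hr.sum_add_sum 0 l)
      have e5 := hW (relation_of_follows hT hr h3 0)
      simp only [smul_zero, add_zero] at e4 e5
      have e6 := (Submodule.add_mem_iff_right W e3).1 e4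
      rw [List.map_append, List.sum_append] at e5
      have e7 := (Submodule.add_mem_iff_left W e6).1 e5
      rw [List.map_cons, List.sum_cons] at e7
      refine (Submodule.add_mem_iff_left W (list_sum_mem fun b hb => ?_)).1 e7
      obtain ⟨c, hc, rfl⟩ := List.mem_map.1 hb
      exact hK c (mem_of_any_beq (List.all_eq_true.1 h2 c hc))

end Checks

/-! ### Inadmissibility, spanning and independence from the certificates -/

section Assembly

variable {ω : ℕ →₀ ℕ} {w : List ℕ}

theorem mem_support_of_mem_PLt {k : ℕ} {p : P k} (hp : p ∈ PLt k ω) :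
    ∀ y ∈ p.support, y.degree = wdeg ω ∧ toLex (weight y) < toLex ω := by
  classical
  induction hp using Submodule.span_induction with
  | mem p hp =>
    obtain ⟨x, hx, hx', rfl⟩ := hp
    intro y hy
    have := Finset.mem_singleton.1 (support_monomial_subset hy)
    subst this
    exact ⟨hx, hx'⟩
  | zero => simp
  | add p q _ _ hp hq =>
    intro y hy
    rcases Finset.mem_union.1 (support_add hy) with h | h
    · exact hp y h
    · exact hq y h
  | smul c p _ hp => exact fun y hy => hp y (support_smul hy)

theorem code_decode {c : ℕ} (h : c < 10000000000) : code (decode c) = c := by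
  simp only [code, decode_apply, digits, encode, List.foldl, Fin.isValue, Fin.val_zero,
    Fin.val_one, Fin.val_two, List.getD_cons_zero, List.getD_cons_succ]
  change ((((0 * 100 + c / 100000000 % 100) * 100 + c / 1000000 % 100) * 100 +
    c / 10000 % 100) * 100 + c / 100 % 100) * 100 + c % 100 = c
  omega

theorem code_lt {x : Fin 5 →₀ ℕ} (h : ∀ j, x j < 100) : code x < 10000000000 := by
  have h0 := h 0
  have h1 := h 1
  have h2 := h 2
  have h3 := h 3
  have h4 := h 4
  simp only [code, encode, List.foldl]
  omega

theorem entries_mem_vectors (hw : ∀ i, ω i = w.getD i 0) {x : Fin 5 →₀ ℕ} (hx : weight x = ω) :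
    [x 0, x 1, x 2, x 3, x 4] ∈ vectors w :=
  mem_vectors w _ rfl fun i => by rw [← weight_ofList' rfl, ofList_entries, hx, hw]

theorem weight_decode (hw : ∀ i, ω i = w.getD i 0) {c : ℕ}
    (h : hasWeights w (digits c) = true) : weight (decode c) = ω :=
  Finsupp.ext fun i => by
    rw [decode, weight_ofList' (digits_length c), sum_of_hasWeights w _ h, hw]

variable {d s : ℕ} {r : ℕ → List ℕ} {T : List (List ℕ)} {C : List (ℕ × List (ℕ × ℕ))}
  {B : List ℕ}

theorem degree_of_classifies (hw : ∀ i, ω i = w.getD i 0)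
    (hC : classifies w d r T C B = true) {x : Fin 5 →₀ ℕ} (hx : weight x = ω) :
    x.degree = d ∧ ∀ j, x j < 100 := by
  have h := List.all_eq_true.1 hC _ (entries_mem_vectors hw hx)
  rw [Bool.and_eq_true, Bool.and_eq_true, Nat.beq_eq] at h
  constructor
  · rw [← h.1.1, Finsupp.degree_eq_sum, Fin.sum_univ_five]
    simp [add_assoc]
  · have := h.1.2
    simp only [List.all_cons, List.all_nil, Bool.and_eq_true, Nat.blt_eq] at this
    simp only [Fin.forall_fin_succ]
    exact ⟨this.1, this.2.1, this.2.2.1, this.2.2.2.1, this.2.2.2.2.1, fun j => j.elim0⟩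

theorem exists_of_classifies (hw : ∀ i, ω i = w.getD i 0) (hT : ∀ l ∈ T, Relation ω s l)
    (hr : Reduces ω s r) (hC : classifies w d r T C B = true) {x : Fin 5 →₀ ℕ}
    (hx : weight x = ω) (hB : code x ∉ B) :
    ∃ m : List ℕ, mono x + (m.map fun c => (mono (decode c) : P 5)).sum ∈ trivials 5 ω ∧
      ∀ c ∈ m, weight (decode c) = ω ∧ toLex (decode c) < toLex x := by
  have hlt := (degree_of_classifies hw hC hx).2
  have h := List.all_eq_true.1 hC _ (entries_mem_vectors hw hx)
  rw [Bool.and_eq_true, Bool.or_eq_true] at h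
  have h' := h.2.resolve_right fun h => hB (mem_of_any_beq h)
  obtain ⟨m, hm, hm'⟩ := exists_of_reducible hT hr h'
  change Relation ω s (code x :: m) at hm
  change ∀ y ∈ m, y < code x ∧ _ at hm'
  refine ⟨m, ?_, fun c hc => ?_⟩
  · have := hm 0
    simp only [smul_zero, add_zero] at this
    rwa [List.map_cons, List.sum_cons, decode_code hlt] at this
  · obtain ⟨h1, h2⟩ := hm' c hc
    have hwc := weight_decode hw h2
    refine ⟨hwc, ?_⟩
    -- If x ≤ `decode c`, then the code of x would be at most c, against `h1`.
    by_contra h3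
    rcases (not_lt.1 h3).lt_or_eq with h4 | h4
    · have := code_lt_code hlt (degree_of_classifies hw hC hwc).2 h4
      rw [code_decode (h1.trans (code_lt hlt))] at this
      omega
    · have := congrArg code (toLex.injective h4)
      rw [code_decode (h1.trans (code_lt hlt))] at this
      omega

/-- The congruence holds only up to low weight. In degree deg ω that remainder is some p in P₅⁻(ω),
whose monomials precede x by weight and may therefore be counted among the smaller monomials. -/
theorem inadmissible_of_classifies (hw : ∀ i, ω i = w.getD i 0) (hd : wdeg ω = d)
    (hT : ∀ l ∈ T, Relation ω s l) (hr : Reduces ω s r) (hC : classifies w d r T C B = true)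
    {x : Fin 5 →₀ ℕ} (hx : weight x = ω) (hB : code x ∉ B) : Inadmissible x := by
  classical
  obtain ⟨m, hm, hm'⟩ := exists_of_classifies hw hT hr hC hx hB
  have hdeg : ∀ y : Fin 5 →₀ ℕ, weight y = ω → y.degree = wdeg ω := fun y hy =>
    (degree_of_classifies hw hC hy).1.trans hd.symm
  have hsupp : ∀ y ∈ (m.map fun c => (mono (decode c) : P 5)).sum.support,
      weight y = ω ∧ toLex y < toLex x := by
    clear hm
    induction m with
    | nil => simp
    | cons c m ih =>
      intro y hy
      rw [List.map_cons, List.sum_cons] at hy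
      rcases Finset.mem_union.1 (support_add hy) with h | h
      · have := Finset.mem_singleton.1 (support_monomial_subset h)
        subst this
        exact hm' c (by simp)
      · exact ih (fun c hc => hm' c (by simp [hc])) y h
  have hhom : (mono x + (m.map fun c => (mono (decode c) : P 5)).sum).IsHomogeneous (wdeg ω) := by
    refine (hdeg x hx ▸ mono_isHomogeneous x).add ?_
    rw [← mem_homogeneousSubmodule]
    refine list_sum_mem fun b hb => ?_
    obtain ⟨c, hc, rfl⟩ := List.mem_map.1 hb
    rw [mem_homogeneousSubmodule]
    exact hdeg _ (hm' c hc).1 ▸ mono_isHomogeneous (decode c)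
  obtain ⟨h, hh, p, hp, hhp⟩ := exists_add_of_mem_trivials hm hhom
  refine inadmissible_of_mem_hit
    (q := (m.map fun c => (mono (decode c) : P 5)).sum + p) ?_ fun y hy => ?_
  · rwa [← add_assoc, ← hhp, add_assoc, add_self_eq_zero, add_zero]
  · rcases Finset.mem_union.1 (support_add hy) with hy | hy
    · obtain ⟨h1, h2⟩ := hsupp y hy
      exact ⟨(hdeg y h1).trans (hdeg x hx).symm, Or.inr ⟨h1.trans hx.symm, h2⟩⟩
    · obtain ⟨h1, h2⟩ := mem_support_of_mem_PLt hp y hy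
      exact ⟨h1.trans (hdeg x hx).symm, Or.inl (hx.symm ▸ h2)⟩

/-- Strong induction on the code: a monomial outside the list is replaced by smaller ones, so the
bound on the monomials used is inherited. -/
theorem mem_span_of_classifies (hw : ∀ i, ω i = w.getD i 0) (hT : ∀ l ∈ T, Relation ω s l)
    (hr : Reduces ω s r) (hC : classifies w d r T C B = true) {I : Set ℕ}
    {m : ℕ → Fin 5 →₀ ℕ} (hB : ∀ c ∈ B, ∃ t ∈ I, m t = decode c) :
    ∀ (n : ℕ) (x : Fin 5 →₀ ℕ), code x = n → weight x = ω → mono x ∈ Submodule.span (ZMod 2)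
      {f | ∃ t ∈ I, toLex (m t) ≤ toLex x ∧ f = mono (m t)} ⊔ trivials 5 ω := by
  intro n
  induction n using Nat.strong_induction_on with
  | _ n ih =>
    rintro x rfl hx
    have hlt := (degree_of_classifies hw hC hx).2
    by_cases hxB : code x ∈ B
    · obtain ⟨t, ht, hmt⟩ := hB _ hxB
      rw [decode_code hlt] at hmt
      subst hmt
      exact Submodule.mem_sup_left (Submodule.subset_span ⟨t, ht, le_rfl, rfl⟩)
    · obtain ⟨l, hl, hl'⟩ := exists_of_classifies hw hT hr hC hx hxB
      refine (Submodule.add_mem_iff_left _ (list_sum_mem fun b hb => ?_)).1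
        (Submodule.mem_sup_right hl)
      obtain ⟨c, hc, rfl⟩ := List.mem_map.1 hb
      obtain ⟨h1, h2⟩ := hl' c hc
      have h3 := ih _ (code_lt_code (degree_of_classifies hw hC h1).2 hlt h2) _ rfl h1
      suffices h' : Submodule.span (ZMod 2)
          {f | ∃ t ∈ I, toLex (m t) ≤ toLex (decode c) ∧ f = mono (m t)} ≤
            Submodule.span (ZMod 2) {f | ∃ t ∈ I, toLex (m t) ≤ toLex x ∧ f = mono (m t)} from
        (sup_le_sup_right h' _ : _ ≤ _) h3
      refine Submodule.span_mono ?_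
      rintro f ⟨t, ht, hle, rfl⟩
      exact ⟨t, ht, hle.trans h2.le, rfl⟩

theorem linearIndependent_of_separates {F : List ℕ} (hw : ∀ i, ω i = w.getD i 0)
    (hF : ∀ f ∈ trivials 5 ω, functional F f = 0) {O : List (ℕ × ℕ × List ℕ)}
    (hO : separates w F O = true) {I : Set ℕ} {m : ℕ → Fin 5 →₀ ℕ}
    (hnodup : (O.map (·.1)).Nodup) (hI : ∀ t, t ∈ O.map (·.1) ↔ t ∈ I)
    (hm : ∀ q ∈ O, m q.1 = decode q.2.1) : LinearIndependent (ZMod 2) (classes ω I m) := by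
  classical
  have : Fintype I := Fintype.ofFinset (O.map (·.1)).toFinset fun t => by
    rw [List.mem_toFinset, hI]
  rw [Fintype.linearIndependent_iff]
  intro g hg t
  -- The coefficients are extended by zero to all indices, as the list sum is indexed by natural
  -- numbers.
  let f : ℕ → ZMod 2 := fun t => if h : t ∈ I then g ⟨t, h⟩ else 0
  have hf : ∀ t : I, f t = g t := fun t => dif_pos t.2
  have hsum : (O.map fun q => f q.1 • (mono (decode q.2.1) : P 5)).sum
      = ∑ t : I, g t • (mono (m t) : P 5) := by
    have h1 : (O.map fun q => f q.1 • (mono (decode q.2.1) : P 5))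
        = (O.map (·.1)).map fun t => f t • (mono (m t) : P 5) := by
      rw [List.map_map]
      exact List.map_congr_left fun q hq => by rw [Function.comp_apply, hm q hq]
    rw [h1, ← List.sum_toFinset _ hnodup,
      Finset.sum_subtype (p := (· ∈ I)) (F := this) _ fun t => by rw [List.mem_toFinset, hI]]
    exact Finset.sum_congr rfl fun t _ => by rw [hf]
  have hmem : (O.map fun q => f q.1 • (mono (decode q.2.1) : P 5)).sum ∈ trivials 5 ω := by
    rw [hsum, ← Submodule.Quotient.mk_eq_zero, ← Submodule.mkQ_apply, map_sum]
    exact hg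
  obtain ⟨q, hq, hqt⟩ := List.mem_map.1 ((hI t).2 t.2)
  rw [← hf, ← hqt]
  exact eq_zero_of_separates hw hF f O hO hmem q hq

/-- The description of `QP₅(ω)`, from checks on lists of encoded monomials. -/
theorem exists_basis_and_generates_of_checks (hw : ∀ i, ω i = w.getD i 0) (hd : wdeg ω = d)
    (hT : ∀ l ∈ T, Relation ω s l) (hr : Reduces ω s r) {F : List ℕ}
    {O : List (ℕ × ℕ × List ℕ)} {S : List (ℕ × ℕ × List ℕ × List ℕ × List (ℕ × ℕ))}
    {lo hi t c : ℕ} (hC : classifies w d r T C (O.map (·.2.1)) = true)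
    (hF : vanishes d F = true) (hF' : (F.all fun c => !lower w (digits c)) = true)
    (hO : separates w F O = true) (hperm : (O.map (·.1)).Perm (List.range' lo (hi + 1 - lo)))
    (hcode : ∀ q ∈ O, a q.1 = decode q.2.1)
    (hweights : (O.all fun q => hasWeights w (digits q.2.1)) = true)
    (hS : generates w r T [c] S = true)
    (hS' : (O.all fun q => (c :: S.map (·.1)).any (Nat.beq q.2.1)) = true)
    (hc : a t = decode c) (ht : t ∈ Set.Icc lo hi) :
    ∃ hmem : ∀ t ∈ Set.Icc lo hi, mono (a t) ∈ PLe 5 ω,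
      admissibleMonomials 5 ω = a '' Set.Icc lo hi ∧
      (∃ b : Module.Basis (Set.Icc lo hi) (ZMod 2) (QP 5 ω),
        ∀ t : Set.Icc lo hi, b t = cls (mono (a t)) (hmem t t.2)) ∧
      Module.finrank (ZMod 2) (QP 5 ω) = Nat.card (Set.Icc lo hi) ∧
      Generates (cls (mono (a t)) (hmem t ht)) := by
  have hI : ∀ t, t ∈ O.map (·.1) ↔ t ∈ Set.Icc lo hi := fun t => by
    rw [hperm.mem_iff, List.mem_range'_1, Set.mem_Icc]
    omega
  have hfind : ∀ t ∈ Set.Icc lo hi, ∃ q ∈ O, a t = decode q.2.1 := fun t ht => by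
    obtain ⟨q, hq, rfl⟩ := List.mem_map.1 ((hI t).2 ht)
    exact ⟨q, hq, hcode q hq⟩
  have hB : ∀ c ∈ O.map (·.2.1), ∃ t ∈ Set.Icc lo hi, a t = decode c := fun c hc => by
    obtain ⟨q, hq, rfl⟩ := List.mem_map.1 hc
    exact ⟨q.1, (hI _).1 (List.mem_map_of_mem hq), hcode q hq⟩
  refine exists_basis_and_generates
    (fun x hx => (degree_of_classifies hw hC hx).1.trans hd.symm) (fun u hu => ?_)
    (fun x hx => mem_span_of_classifies hw hT hr hC hB _ x rfl hx) (fun x hx hxI => ?_)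
    (linearIndependent_of_separates hw (fun f hf => functional_trivials hw hF hF' hf) hO
      (hperm.nodup_iff.2 List.nodup_range') hI hcode) ht fun W hW hW' htW u hu => ?_
  · obtain ⟨q, hq, hqu⟩ := hfind u hu
    rw [hqu]
    exact weight_decode hw (List.all_eq_true.1 hweights q hq)
  · refine inadmissible_of_classifies hw hd hT hr hC hx fun hxB => hxI ?_
    obtain ⟨u, hu, h⟩ := hB _ hxB
    rw [decode_code (degree_of_classifies hw hC hx).2] at h
    exact ⟨u, hu, h⟩
  · obtain ⟨q, hq, hqu⟩ := hfind u hu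
    rw [hqu]
    have hcW : ∀ y ∈ [c], mono (decode y) ∈ W := by
      simpa [← hc] using htW
    rcases List.mem_cons.1 (mem_of_any_beq (List.all_eq_true.1 hS' q hq)) with h | h
    · exact h ▸ hcW c (by simp)
    · obtain ⟨x, hx, h⟩ := List.mem_map.1 h
      exact h ▸ mem_of_generates hw hT hr hW hW' S _ hS hcW x hx

end Assembly

/-! ### Certificates for the weights (3,4,2,2) and (3,4,4,1) -/

section Tables

/-- Pairs `(n, g)` such that the polynomials `∑ Sqⁿ(g)` give relations in weight `(3,4)`. -/
def w34Squares : List (List (ℕ × ℕ)) :=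
  [[(1, 1030303)], [(1, 101020303)]]

/-- The terms of weight `(3,4)` of the polynomials given by `w34Squares`. -/
def w34Relations : List (List ℕ) :=
  [[2030303], [102020303, 201020303]]

/-- Rewriting rules in weight `(3,4)`. -/
def w34Rules : List (ℕ × List ℕ) :=
  [(2030303, []), (3020303, []), (3030203, []), (3030302, []), (200030303, []), (201020303,
   [102020303]), (201030203, [102030203]), (201030302, [102030302]), (202010303, [102020303]),
   (202030103, [102030203]), (202030301, [102030302]), (203000303, []), (203010203, [103020203]),
   (203010302, [103020302]), (203020103, [103020203]), (203020301, [103020302]), (203030003, []),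
   (203030102, [103030202]), (203030201, [103030202]), (203030300, []), (300020303, []),
   (300030203, []), (300030302, []), (302000303, []), (302010203, [301020203]), (302010302,
   [301020302]), (302020103, [301020203]), (302020301, [301020302]), (302030003, []), (302030102,
   [301030202]), (302030201, [301030202]), (302030300, []), (303000203, []), (303000302, []),
   (303020003, []), (303020102, [303010202]), (303020201, [303010202]), (303020300, []),
   (303030002, []), (303030200, [])]

/-- For each rule in `w34Rules`, the index of a relation in `w34Relations` and a
permutation of the variables. -/
def w34RuleSources : List (ℕ × ℕ) :=
  [(0, 1234), (0, 2134), (0, 2314), (0, 2341), (0, 10234), (1, 1234), (1, 1324), (1, 1342), (1,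
   2134), (1, 2314), (1, 2341), (0, 12034), (1, 3124), (1, 3142), (1, 3214), (1, 3241), (0,
   12304), (1, 3412), (1, 3421), (0, 12340), (0, 20134), (0, 20314), (0, 20341), (0, 21034), (1,
   30124), (1, 30142), (1, 30214), (1, 30241), (0, 21304), (1, 30412), (1, 30421), (0, 21340), (0,
   23014), (0, 23041), (0, 23104), (1, 34012), (1, 34021), (0, 23140), (0, 23401), (0, 23410)]

/-- Pairs `(n, g)` such that the polynomials `∑ Sqⁿ(g)` give relations in weight `(3,4,2)`. -/
def w342Squares : List (List (ℕ × ℕ)) :=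
  [[(3, 102030307), (2, 202030307), (1, 401030307)], [(3, 103030306), (2, 203030306), (1,
   403030305)]]

/-- The terms of weight `(3,4,2)` of the polynomials given by `w342Squares`. -/
def w342Relations : List (List ℕ) :=
  [[102030607, 102060307], [103030606, 103060306, 106030306]]

/-- Rewriting rules in weight `(3,4,2)`. -/
def w342Rules : List (ℕ × List ℕ) :=
  [(102060307, [102030607]), (102060703, [102030706]), (102070603, [102070306]), (106020307,
   [103020607]), (106020703, [103020706]), (106030207, [103060207]), (106030306, [103030606,
   103060306]), (106030603, [103030606, 103060603]), (106030702, [103060702]), (106060303,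
   [103060306, 103060603]), (106070203, [103070206]), (106070302, [103070602]), (107020603,
   [107020306]), (107060203, [107030206]), (107060302, [107030602]), (502020307, [301020607]),
   (502020703, [301020706]), (502030207, [301060207]), (502030306, [301030606, 301060306]),
   (502030603, [301030606, 301060603]), (502030702, [301060702]), (502060303, [301060306,
   301060603]), (502070203, [301070206]), (502070302, [301070602]), (503020207, [305020207]),
   (503020306, [303010606, 305020306]), (503020603, [303010606, 305020603]), (503020702,
   [305020702]), (503030206, [303050206, 305030206]), (503030602, [303050602, 305030602]),
   (503060203, [303050206, 305060203]), (503060302, [303050602, 305060302]), (503070202,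
   [305070202]), (506020303, [305020306, 305020603]), (506030203, [305030206, 305060203]),
   (506030302, [305030602, 305060302]), (507020203, [307010206]), (507020302, [307010602]),
   (507030202, [307050202]), (701020603, [701020306]), (701060203, [701030206]), (701060302,
   [701030602]), (705020203, [703010206]), (705020302, [703010602]), (705030202, [703050202])]

/-- For each rule in `w342Rules`, the index of a relation in `w342Relations` and a
permutation of the variables. -/
def w342RuleSources : List (ℕ × ℕ) :=
  [(0, 1234), (0, 1243), (0, 1423), (0, 2134), (0, 2143), (0, 2314), (1, 1234), (1, 1243), (0,
   2341), (1, 1423), (0, 2413), (0, 2431), (0, 4123), (0, 4213), (0, 4231), (0, 20134), (0,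
   20143), (0, 20314), (1, 10234), (1, 10243), (0, 20341), (1, 10423), (0, 20413), (0, 20431), (0,
   23014), (1, 12034), (1, 12043), (0, 23041), (1, 12304), (1, 12340), (1, 12403), (1, 12430), (0,
   23401), (1, 14023), (1, 14203), (1, 14230), (0, 24013), (0, 24031), (0, 24301), (0, 40123), (0,
   40213), (0, 40231), (0, 42013), (0, 42031), (0, 42301)]

/-- Pairs `(n, g)` such that the polynomials `∑ Sqⁿ(g)` give relations in weight `(3,4,2,2)`. -/
def w3422Squares : List (List (ℕ × ℕ)) :=
  [[(4, 102060715)], [(4, 102070714)], [(4, 103060714)], [(4, 106060711)], [(4, 106070710)], [(4,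
   305060710)], [(8, 305060607)], [(2, 101011515), (4, 101011513), (4, 101011315), (2, 101011119),
   (8, 101011113)], [(2, 101051115), (6, 101050715), (4, 101050915), (8, 101050713), (4,
   101051113)], [(2, 103050915), (4, 103030915), (4, 103030519), (8, 105030513), (2, 103050519),
   (4, 109030513)], [(2, 105070911), (4, 103070911), (4, 103110907), (2, 105110907), (4,
   103130509), (8, 103090509), (4, 103090513)], [(2, 305050911), (4, 303030913), (4, 303030517),
   (2, 303050517), (8, 505030509), (4, 503030911), (4, 903030907), (2, 903050907), (4,
   509030509)]]

/-- The terms of weight `(3,4,2,2)` of the polynomials given by `w3422Squares`. -/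
def w3422Relations : List (List ℕ) :=
  [[102061115, 102100715], [102071114, 102110714], [103061114, 103100714], [106061111, 106100711,
   110060711], [106071110, 106110710, 110070710], [305061110, 305100710, 309060710], [305061011,
   305100611, 305101007, 309060611, 309061007, 309100607], [102021515, 201021515, 202011515],
   [102100715, 201100715, 202090715], [106031015, 205031015, 206030915], [103071014, 103141007,
   203070914, 203071013, 203131007, 203140907], [303051014, 303060914, 303061013, 305031014,
   305061011, 306030914, 306031013, 306051011, 306060911, 503061011, 506031011, 603051011,
   603060911, 605031011, 606030911, 906031007, 1005031007, 1006030907]]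

/-- Monomials of weight `(3,4,2,2)`, with permuted relations from `w3422Relations`
that express them by smaller monomials. -/
def w3422Reductions : List (ℕ × List (ℕ × ℕ)) :=
  [(102021515, [(7, 1234)]), (102031415, [(0, 1234), (8, 1234)]), (102031514, [(0, 1243), (8,
   1243)]), (102071015, [(8, 1324)]), (102071510, [(8, 1342)]), (102100715, [(0, 1234)]),
   (102101507, [(0, 1243)]), (102110615, [(0, 1324)]), (102110714, [(1, 1234)]), (102111407, [(1,
   1243)]), (102111506, [(0, 1342)]), (102150215, [(7, 1324)]), (102150314, [(0, 1423), (8,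
   1423)]), (102150710, [(8, 1432)]), (102151007, [(0, 1423)]), (102151106, [(0, 1432)]),
   (102151502, [(7, 1342)]), (103021415, [(0, 2134), (8, 2134)]), (103021514, [(0, 2143), (8,
   2143)]), (103031414, [(2, 2134), (3, 1234), (2, 1243), (10, 1324)]), (103061015, [(9, 1234)]),
   (103061411, [(2, 1243), (3, 1243), (2, 2143)]), (103061510, [(9, 1243)]), (103100615, [(9,
   1324)]), (103100714, [(2, 1234)]), (103101407, [(2, 1243)]), (103101506, [(9, 1342)]),
   (103110614, [(2, 1324)]), (103111406, [(2, 1342)]), (103140215, [(0, 2314), (8, 2314)]),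
   (103140314, [(2, 2413), (3, 1423), (10, 1234)]), (103140611, [(2, 1423), (10, 1234)]),
   (103140710, [(10, 1243)]), (103141007, [(2, 1423)]), (103141106, [(2, 1432)]), (103141403, [(2,
   2341), (3, 1342)]), (103141502, [(0, 2341), (8, 2341)]), (103150214, [(0, 2413), (8, 2413)]),
   (103150610, [(9, 1423)]), (103151006, [(9, 1432)]), (103151402, [(0, 2431), (8, 2431)]),
   (107021015, [(8, 3124)]), (107021510, [(8, 3142)]), (107071010, [(4, 2314), (10, 2413)]),
   (107100215, [(8, 3214)]), (107100314, [(2, 3214), (2, 4213), (3, 4123), (10, 2134)]),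
   (107100710, [(4, 2134), (10, 2143)]), (107101007, [(4, 2143), (10, 2134)]), (107101106, [(2,
   3241), (2, 4231), (3, 4132), (4, 2134)]), (107101502, [(8, 3241)]), (107111006, [(2, 3421), (2,
   4321), (3, 4312), (4, 2314)]), (107150210, [(8, 3412)]), (107151002, [(8, 3421)]), (110020715,
   [(0, 2134)]), (110021507, [(0, 2143)]), (110030615, [(9, 3124)]), (110030714, [(2, 2134)]),
   (110031407, [(2, 2143)]), (110031506, [(9, 3142)]), (110070215, [(0, 2314)]), (110070314, [(2,
   2314)]), (110070710, [(4, 1234)]), (110071007, [(4, 1243)]), (110071106, [(2, 2341)]),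
   (110071502, [(0, 2341)]), (110100707, [(4, 1423)]), (110110607, [(2, 2413)]), (110110706, [(2,
   2431)]), (110150207, [(0, 2413)]), (110150306, [(9, 3412)]), (110150702, [(0, 2431)]),
   (111020615, [(0, 3124)]), (111020714, [(1, 2134)]), (111021407, [(1, 2143)]), (111021506, [(0,
   3142)]), (111030614, [(2, 3124)]), (111031406, [(2, 3142)]), (111060215, [(0, 3214)]),
   (111060314, [(2, 3214)]), (111060611, [(3, 3124)]), (111060710, [(4, 2134)]), (111061007, [(2,
   4123)]), (111061106, [(2, 4132)]), (111061403, [(2, 3241)]), (111061502, [(0, 3241)]),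
   (111070214, [(1, 2314)]), (111070610, [(4, 2314)]), (111071006, [(4, 2341)]), (111071402, [(1,
   2341)]), (111100607, [(2, 4213)]), (111100706, [(2, 4231)]), (111110606, [(3, 3412)]),
   (111140207, [(1, 2413)]), (111140306, [(2, 3412)]), (111140603, [(2, 3421)]), (111140702, [(1,
   2431)]), (111150206, [(0, 3412)]), (111150602, [(0, 3421)]), (115020215, [(7, 3124)]),
   (115020314, [(0, 4123), (8, 4123)]), (115020710, [(8, 4132)]), (115021007, [(0, 4123)]),
   (115021106, [(0, 4132)]), (115021502, [(7, 3142)]), (115030214, [(0, 4213), (8, 4213)]),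
   (115030610, [(9, 4123)]), (115031006, [(9, 4132)]), (115031402, [(0, 4231), (8, 4231)]),
   (115070210, [(8, 4312)]), (115071002, [(8, 4321)]), (115100207, [(0, 4213)]), (115100306, [(9,
   4312)]), (115100702, [(0, 4231)]), (115110206, [(0, 4312)]), (115110602, [(0, 4321)]),
   (115150202, [(7, 3412)]), (301021415, [(0, 20134), (8, 20134)]), (301021514, [(0, 20143), (8,
   20143)]), (301031414, [(2, 20134), (3, 10234), (10, 10324), (2, 10243)]), (301061015, [(9,
   10234)]), (301061411, [(2, 10243), (3, 10243), (2, 20143)]), (301061510, [(9, 10243)]),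
   (301100615, [(9, 10324)]), (301100714, [(2, 10234)]), (301101407, [(2, 10243)]), (301101506,
   [(9, 10342)]), (301110614, [(2, 10324)]), (301111406, [(2, 10342)]), (301140215, [(0, 20314),
   (8, 20314)]), (301140314, [(2, 20413), (3, 10423), (10, 10234)]), (301140611, [(2, 10423), (10,
   10234)]), (301140710, [(10, 10243)]), (301141007, [(2, 10423)]), (301141106, [(2, 10432)]),
   (301141403, [(2, 20341), (3, 10342)]), (301141502, [(0, 20341), (8, 20341)]), (301150214, [(0,
   20413), (8, 20413)]), (301150610, [(9, 10423)]), (301151006, [(9, 10432)]), (301151402, [(0,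
   20431), (8, 20431)]), (303011414, [(2, 21034), (3, 12034), (10, 13024), (2, 12043)]),
   (303090614, [(5, 10423), (11, 1324), (5, 1243), (11, 10234)]), (303091406, [(5, 10432), (5,
   1234), (11, 10243), (11, 1342)]), (303130214, [(2, 21304), (3, 12304), (10, 13204), (2,
   12403)]), (303131006, [(5, 10342), (11, 1432), (5, 1324), (11, 10423)]), (303131402, [(2,
   21340), (3, 12340), (10, 13240), (2, 12430)]), (305021015, [(9, 12034)]), (305021411, [(2,
   12043), (3, 12043), (2, 21043)]), (305021510, [(9, 12043)]), (305061011, [(5, 1243), (5,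
   12043), (5, 10243)]), (305061110, [(5, 1234), (5, 10234), (5, 12034)]), (305071010, [(5, 1324),
   (11, 10423)]), (305100215, [(9, 12304)]), (305100314, [(11, 12304), (6, 1234), (5, 4123)]),
   (305100611, [(11, 12304), (11, 12034)]), (305100710, [(11, 12043)]), (305101007, [(11,
   12034)]), (305101106, [(6, 1243), (5, 4132)]), (305101403, [(11, 12340)]), (305101502, [(9,
   12340)]), (305111006, [(6, 1423), (5, 4312)]), (305140211, [(2, 12403), (3, 12403), (2,
   21403)]), (305140310, [(11, 12403)]), (305141003, [(11, 12430)]), (305141102, [(2, 12430), (3,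
   12430), (2, 21430)]), (305150210, [(9, 12403)]), (305151002, [(9, 12430)]), (307091006, [(5,
   3142), (6, 4123), (5, 3412), (5, 3124)]), (309020615, [(9, 13024)]), (309020714, [(2, 12034)]),
   (309021407, [(2, 12043)]), (309021506, [(9, 13042)]), (309030614, [(5, 14023), (11, 3124), (5,
   1243)]), (309031406, [(5, 14032), (11, 3142), (5, 1234)]), (309060215, [(9, 13204)]),
   (309060314, [(5, 14203), (11, 3124), (5, 1423)]), (309060611, [(11, 13024), (5, 1423)]),
   (309060710, [(5, 1234)]), (309061007, [(5, 1243)]), (309061106, [(5, 4132), (5, 1432)]),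
   (309061403, [(11, 13240)]), (309061502, [(9, 13240)]), (309070214, [(2, 12304)]), (309070610,
   [(5, 1324)]), (309071006, [(5, 1342)]), (309071402, [(2, 12340)]), (309100607, [(5, 1423)]),
   (309100706, [(5, 1432)]), (309110606, [(5, 4312)]), (309140207, [(2, 12403)]), (309140306,
   [(11, 13402)]), (309140603, [(11, 13420)]), (309140702, [(2, 12430)]), (309150206, [(9,
   13402)]), (309150602, [(9, 13420)]), (311010614, [(2, 13024)]), (311011406, [(2, 13042)]),
   (311050214, [(2, 13204)]), (311050610, [(5, 3124)]), (311051006, [(5, 3142)]), (311051402, [(2,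
   13240)]), (311090606, [(5, 3412)]), (311130206, [(2, 13402)]), (311130602, [(2, 13420)]),
   (313020215, [(0, 23014), (8, 23014)]), (313020314, [(2, 24013), (3, 13024), (10, 32014)]),
   (313020611, [(2, 14023), (10, 12034)]), (313020710, [(10, 12043)]), (313021007, [(2, 14023)]),
   (313021106, [(2, 14032)]), (313021403, [(2, 23041), (3, 13042)]), (313021502, [(0, 23041), (8,
   23041)]), (313030214, [(2, 24103), (3, 13204), (10, 32104)]), (313030610, [(11, 14023)]),
   (313031006, [(11, 14032)]), (313031402, [(2, 24130), (3, 13240), (10, 32140)]), (313060211,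
   [(2, 14203), (10, 12304)]), (313060310, [(11, 14203)]), (313061003, [(11, 14230)]), (313061102,
   [(2, 14230), (10, 12340)]), (313070210, [(10, 12403)]), (313071002, [(10, 12430)]), (313100207,
   [(2, 14203)]), (313100306, [(11, 14302)]), (313100603, [(11, 14320)]), (313100702, [(2,
   14230)]), (313110206, [(2, 14302)]), (313110602, [(2, 14320)]), (313140203, [(2, 23401), (3,
   13402)]), (313140302, [(2, 23410), (3, 13420)]), (313150202, [(0, 23401), (8, 23401)]),
   (315010214, [(0, 24013), (8, 24013)]), (315010610, [(9, 14023)]), (315011006, [(9, 14032)]),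
   (315011402, [(0, 24031), (8, 24031)]), (315050210, [(9, 14203)]), (315051002, [(9, 14230)]),
   (315090206, [(9, 14302)]), (315090602, [(9, 14320)]), (315130202, [(0, 24301), (8, 24301)]),
   (701021015, [(8, 30124)]), (701021510, [(8, 30142)]), (701071010, [(4, 20314), (10, 20413)]),
   (701100215, [(8, 30214)]), (701100314, [(2, 30214), (2, 40213), (3, 30124), (10, 20314)]),
   (701100710, [(4, 20134), (10, 20143)]), (701101007, [(4, 20143), (10, 20134)]), (701101106,
   [(2, 30241), (2, 40231), (3, 40132), (4, 20134)]), (701101502, [(8, 30241)]), (701111006, [(2,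
   30421), (2, 40321), (3, 40312), (4, 20314)]), (701150210, [(8, 30412)]), (701151002, [(8,
   30421)]), (703091006, [(5, 30142), (6, 40123), (5, 30412), (5, 30124)]), (707011010, [(4,
   23014), (10, 24013)]), (707090210, [(4, 23104), (10, 24103)]), (707091002, [(4, 23140), (10,
   24130)]), (709020215, [(8, 32014)]), (709020314, [(2, 32014), (2, 42013), (3, 41023), (10,
   21034)]), (709020710, [(4, 21034), (10, 21043)]), (709021007, [(4, 21043), (10, 21034)]),
   (709021106, [(2, 32041), (2, 42031), (3, 31042), (4, 24031)]), (709021502, [(8, 32041)]),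
   (709030214, [(2, 32104), (2, 42103), (3, 41203), (10, 21304)]), (709030610, [(5, 31024), (11,
   41023)]), (709031006, [(5, 31042), (11, 41032)]), (709031402, [(2, 32140), (2, 42130), (3,
   41230), (10, 21340)]), (709070210, [(4, 21304), (10, 21403)]), (709071002, [(4, 21340), (10,
   21430)]), (709100207, [(4, 21403), (10, 21304)]), (709100306, [(5, 31402), (11, 41302)]),
   (709100702, [(4, 21430), (10, 21340)]), (709110206, [(2, 32401), (2, 42301), (3, 41302), (4,
   21304)]), (709110602, [(2, 32410), (2, 42310), (3, 41320), (4, 21340)]), (709150202, [(8,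
   32401)]), (711011006, [(2, 34021), (2, 43021), (3, 34012), (4, 23041)]), (711090206, [(2,
   34201), (2, 43201), (3, 43102), (4, 23104)]), (711090602, [(2, 34210), (2, 43210), (3, 34120),
   (4, 23410)]), (715010210, [(8, 34012)]), (715011002, [(8, 34021)]), (715090202, [(8, 34201)]),
   (902020715, [(0, 20134)]), (902021507, [(0, 20143)]), (902030615, [(9, 30124)]), (902030714,
   [(2, 20134)]), (902031407, [(2, 20143)]), (902031506, [(9, 30142)]), (902070215, [(0, 20314)]),
   (902070314, [(2, 20314)]), (902070710, [(4, 10234)]), (902071007, [(4, 10243)]), (902071106,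
   [(2, 20341)]), (902071502, [(0, 20341)]), (902100707, [(4, 10423)]), (902110607, [(2, 20413)]),
   (902110706, [(2, 20431)]), (902150207, [(0, 20413)]), (902150306, [(9, 30412)]), (902150702,
   [(0, 20431)]), (903020615, [(9, 31024)]), (903020714, [(2, 21034)]), (903021407, [(2, 21043)]),
   (903021506, [(9, 31042)]), (903030614, [(5, 41023), (11, 30124), (5, 10243)]), (903031406, [(5,
   41032), (5, 10234), (11, 30142)]), (903060215, [(9, 31204)]), (903060314, [(5, 41203), (5,
   10423), (11, 30124)]), (903060611, [(11, 30124), (5, 14023)]), (903060710, [(5, 10234)]),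
   (903061007, [(5, 10243)]), (903061106, [(5, 40132), (5, 10432)]), (903061403, [(11, 31240)]),
   (903061502, [(9, 31240)]), (903070214, [(2, 21304)]), (903070610, [(5, 10324)]), (903071006,
   [(5, 10342)]), (903071402, [(2, 21340)]), (903100607, [(5, 10423)]), (903100706, [(5, 10432)]),
   (903110606, [(5, 40312)]), (903140207, [(2, 21403)]), (903140306, [(11, 31402)]), (903140603,
   [(11, 31420)]), (903140702, [(2, 21430)]), (903150206, [(9, 31402)]), (903150602, [(9,
   31420)]), (907020215, [(0, 23014)]), (907020314, [(2, 23014)]), (907020710, [(4, 12034)]),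
   (907021007, [(4, 12043)]), (907021106, [(2, 23041)]), (907021502, [(0, 23041)]), (907030214,
   [(2, 23104)]), (907030610, [(5, 13024)]), (907031006, [(5, 13042)]), (907031402, [(2, 23140)]),
   (907070210, [(4, 12304)]), (907071002, [(4, 12340)]), (907100207, [(4, 12403)]), (907100306,
   [(5, 13402)]), (907100702, [(4, 12430)]), (907110206, [(2, 23401)]), (907110602, [(2, 23410)]),
   (907150202, [(0, 23401)]), (910020707, [(4, 14023)]), (910030607, [(5, 14023)]), (910030706,
   [(5, 14032)]), (910070207, [(4, 14203)]), (910070306, [(5, 14302)]), (910070702, [(4, 14230)]),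
   (911020607, [(2, 24013)]), (911020706, [(2, 24031)]), (911030606, [(5, 43012)]), (911060207,
   [(2, 24103)]), (911060306, [(5, 43102)]), (911060603, [(5, 43120)]), (911060702, [(2, 24130)]),
   (911070206, [(2, 24301)]), (911070602, [(2, 24310)]), (915020207, [(0, 24013)]), (915020306,
   [(9, 34012)]), (915020702, [(0, 24031)]), (915030206, [(9, 34102)]), (915030602, [(9, 34120)]),
   (915070202, [(0, 24301)]), (1101020615, [(0, 30124)]), (1101020714, [(1, 20134)]), (1101021407,
   [(1, 20143)]), (1101021506, [(0, 30142)]), (1101030614, [(2, 30124)]), (1101031406, [(2,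
   30142)]), (1101060215, [(0, 30214)]), (1101060314, [(2, 30214)]), (1101060611, [(3, 30124)]),
   (1101060710, [(4, 20134)]), (1101061007, [(2, 40123)]), (1101061106, [(2, 40132)]),
   (1101061403, [(2, 30241)]), (1101061502, [(0, 30241)]), (1101070214, [(1, 20314)]),
   (1101070610, [(4, 20314)]), (1101071006, [(4, 20341)]), (1101071402, [(1, 20341)]),
   (1101100607, [(2, 40213)]), (1101100706, [(2, 40231)]), (1101110606, [(3, 30412)]),
   (1101140207, [(1, 20413)]), (1101140306, [(2, 30412)]), (1101140603, [(2, 30421)]),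
   (1101140702, [(1, 20431)]), (1101150206, [(0, 30412)]), (1101150602, [(0, 30421)]),
   (1103010614, [(2, 31024)]), (1103011406, [(2, 31042)]), (1103050214, [(2, 31204)]),
   (1103050610, [(5, 30124)]), (1103051006, [(5, 30142)]), (1103051402, [(2, 31240)]),
   (1103090606, [(5, 30412)]), (1103130206, [(2, 31402)]), (1103130602, [(2, 31420)]),
   (1105020215, [(0, 32014)]), (1105020314, [(2, 32014)]), (1105020611, [(3, 31024)]),
   (1105020710, [(4, 21034)]), (1105021007, [(2, 41023)]), (1105021106, [(2, 41032)]),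
   (1105021403, [(2, 32041)]), (1105021502, [(0, 32041)]), (1105030214, [(2, 32104)]),
   (1105030610, [(5, 31024)]), (1105031006, [(5, 31042)]), (1105031402, [(2, 32140)]),
   (1105060211, [(3, 31204)]), (1105060310, [(5, 31204)]), (1105061003, [(5, 31240)]),
   (1105061102, [(3, 31240)]), (1105070210, [(4, 21304)]), (1105071002, [(4, 21340)]),
   (1105100207, [(2, 41203)]), (1105100306, [(5, 31402)]), (1105100603, [(5, 31420)]),
   (1105100702, [(2, 41230)]), (1105110206, [(2, 41302)]), (1105110602, [(2, 41320)]),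
   (1105140203, [(2, 32401)]), (1105140302, [(2, 32410)]), (1105150202, [(0, 32401)]),
   (1107010214, [(1, 23014)]), (1107010610, [(4, 23014)]), (1107011006, [(4, 23041)]),
   (1107011402, [(1, 23041)]), (1107050210, [(4, 23104)]), (1107051002, [(4, 23140)]),
   (1107090206, [(4, 23401)]), (1107090602, [(4, 23410)]), (1107130202, [(1, 23401)]),
   (1109020607, [(2, 42013)]), (1109020706, [(2, 42031)]), (1109030606, [(5, 34012)]),
   (1109060207, [(2, 42103)]), (1109060306, [(5, 34102)]), (1109060603, [(5, 34120)]),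
   (1109060702, [(2, 42130)]), (1109070206, [(2, 42301)]), (1109070602, [(2, 42310)]),
   (1111010606, [(3, 34012)]), (1111050206, [(3, 34102)]), (1111050602, [(3, 34120)]),
   (1113020207, [(1, 24013)]), (1113020306, [(2, 34012)]), (1113020603, [(2, 34021)]),
   (1113020702, [(1, 24031)]), (1113030206, [(2, 34102)]), (1113030602, [(2, 34120)]),
   (1113060203, [(2, 34201)]), (1113060302, [(2, 34210)]), (1113070202, [(1, 24301)]),
   (1115010206, [(0, 34012)]), (1115010602, [(0, 34021)]), (1115050202, [(0, 34201)]),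
   (1501020215, [(7, 30124)]), (1501020314, [(0, 40123), (8, 40123)]), (1501020710, [(8, 40132)]),
   (1501021007, [(0, 40123)]), (1501021106, [(0, 40132)]), (1501021502, [(7, 30142)]),
   (1501030214, [(0, 40213), (8, 40213)]), (1501030610, [(9, 40123)]), (1501031006, [(9, 40132)]),
   (1501031402, [(0, 40231), (8, 40231)]), (1501070210, [(8, 40312)]), (1501071002, [(8, 40321)]),
   (1501100207, [(0, 40213)]), (1501100306, [(9, 40312)]), (1501100702, [(0, 40231)]),
   (1501110206, [(0, 40312)]), (1501110602, [(0, 40321)]), (1501150202, [(7, 30412)]),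
   (1503010214, [(0, 42013), (8, 42013)]), (1503010610, [(9, 41023)]), (1503011006, [(9, 41032)]),
   (1503011402, [(0, 42031), (8, 42031)]), (1503050210, [(9, 41203)]), (1503051002, [(9, 41230)]),
   (1503090206, [(9, 41302)]), (1503090602, [(9, 41320)]), (1503130202, [(0, 42301), (8, 42301)]),
   (1507010210, [(8, 43012)]), (1507011002, [(8, 43021)]), (1507090202, [(8, 43201)]),
   (1509020207, [(0, 42013)]), (1509020306, [(9, 43012)]), (1509020702, [(0, 42031)]),
   (1509030206, [(9, 43102)]), (1509030602, [(9, 43120)]), (1509070202, [(0, 42301)]),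
   (1511010206, [(0, 43012)]), (1511010602, [(0, 43021)]), (1511050202, [(0, 43201)]),
   (1515010202, [(7, 34012)])]

/-- Monomials of weight `(3,4,2,2)` whose coefficients have sum zero in hit polynomials. -/
def w3422Functional : List ℕ :=
  [711130202, 711140102, 711140201, 713110202, 714110102, 714110201, 1107130202, 1107140102,
   1107140201, 1113070202, 1114070102, 1114070201, 1307110202, 1311070202, 1407110102, 1407110201,
   1411070102, 1411070201, 713130101, 1307130101, 1313070101, 1111110101, 707190101, 719070101,
   1907070101, 1107150101, 1115070101, 1511070101]

/-- The indices and the codes of the monomials `a_t` of weight `(3,4,2,2)`, and words after which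
`w3422Functional` separates them. -/
def w3422Separation : List (ℕ × ℕ × List ℕ) :=
  [(170, 711130202, []), (169, 711011402, [1324]), (168, 711010214, [1423]), (167, 701111402,
   [2314]), (166, 701110214, [2413]), (165, 701021114, [3412]), (164, 107111402, [12304]), (163,
   107110214, [12403]), (162, 107021114, [13402]), (161, 102071114, [23401]), (190, 305111402, [0,
   12304]), (189, 305110214, [0, 12403]), (188, 305021114, [0, 13402]), (192, 307091402, [2134, 0,
   12304]), (191, 307090214, [2143, 0, 12304]), (172, 301061114, [2341, 0, 12304]), (196,
   307131002, [3124, 0, 12304]), (179, 307011014, [3142, 0, 12304]), (177, 301071014, [3241, 0,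
   12304]), (195, 307130210, [4123, 0, 12304]), (180, 307011410, [4132, 0, 12304]), (178,
   301071410, [4231, 0, 12304]), (194, 703091402, [12034, 0, 12304]), (193, 703090214, [12043, 0,
   12304]), (171, 103061114, [12340, 0, 12304]), (198, 703131002, [13024, 0, 12304]), (183,
   703011014, [13042, 0, 12304]), (173, 103071014, [13240, 0, 12304]), (197, 703130210, [14023, 0,
   12304]), (184, 703011410, [14032, 0, 12304]), (174, 103071410, [14230, 0, 12304]), (200,
   711051002, [23014, 0, 12304]), (181, 701031014, [23041, 0, 12304]), (175, 107031014, [23140, 0,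
   12304]), (199, 711050210, [24013, 0, 12304]), (182, 701031410, [24031, 0, 12304]), (176,
   107031410, [24130, 0, 12304]), (187, 711010610, [34012, 0, 12304]), (186, 701110610, [34021, 0,
   12304]), (185, 107110610, [34120, 0, 12304]), (203, 305031014, [0, 23140, 0, 12304]), (204,
   305031410, [0, 24130, 0, 12304]), (206, 305110610, [0, 34120, 0, 12304]), (201, 303051014,
   [2134, 0, 23140, 0, 12304]), (202, 303051410, [2143, 0, 23140, 0, 12304]), (209, 307090610,
   [2341, 0, 23140, 0, 12304]), (207, 307051010, [3241, 0, 23140, 0, 12304]), (205, 303130610,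
   [4132, 0, 23140, 0, 12304]), (210, 703090610, [12340, 0, 23140, 0, 12304]), (208, 703051010,
   [13240, 0, 23140, 0, 12304])]

/-- The monomials `a_t` of weight `(3,4,2,2)` as combinations of images of earlier ones, with the
relations from `w3422Relations` that are used. -/
def w3422Generation : List (ℕ × ℕ × List ℕ × List ℕ × List (ℕ × ℕ)) :=
  [(305031410, 305031014, [1243], [], []), (303051014, 305031014, [1324], [305031014], [(11,
   12304), (6, 1234), (5, 4123), (5, 1243), (5, 12043), (5, 10243)]), (303051410, 305031014,
   [1342], [305031410], [(11, 12340), (6, 1243), (5, 4132), (5, 1234), (5, 10234), (5, 12034)]),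
   (305110610, 305031014, [1432], [], [(11, 12430), (6, 1423), (5, 4312)]), (303130610, 305031014,
   [2413], [], []), (307090610, 305031014, [4123], [], [(11, 14203), (5, 3124)]), (307051010,
   305031014, [4132], [307090610], [(11, 14230), (6, 4123), (5, 3412), (5, 3124)]), (703090610,
   305031014, [40123], [], [(5, 31204), (5, 30124), (5, 31024), (11, 41023)]), (703051010,
   305031014, [40132], [703090610], [(5, 31240), (5, 31042), (11, 41032), (6, 40123), (5, 30412),
   (5, 30124)]), (107031014, 305031014, [1234, 0], [305031014], []), (107031410, 305031014, [1243,
   0], [305031410], []), (107110610, 305031014, [1423, 0], [303130610, 305110610], [(11, 12403),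
   (5, 1324), (11, 10423)]), (103071014, 107031014, [2134], [], []), (103071410, 107031014,
   [2143], [], []), (103061114, 107031014, [2314], [], [(2, 1234)]), (701031014, 107031014,
   [10234], [], []), (701031410, 107031014, [10243], [], []), (701110610, 107031014, [10423], [],
   []), (703011014, 107031014, [12034], [], []), (703011410, 107031014, [12043], [], []),
   (703090214, 107031014, [12304], [], []), (703091402, 107031014, [12340], [], []), (703130210,
   107031014, [12403], [], []), (703131002, 107031014, [12430], [], []), (711010610, 107031014,
   [14023], [], []), (711050210, 107031014, [14203], [], []), (711051002, 107031014, [14230], [],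
   []), (301071014, 107031014, [20134], [], []), (301071410, 107031014, [20143], [], []),
   (301061114, 107031014, [20314], [], [(2, 10234)]), (307011014, 107031014, [21034], [], []),
   (307011410, 107031014, [21043], [], []), (307090214, 107031014, [21304], [], []), (307091402,
   107031014, [21340], [], []), (307130210, 107031014, [21403], [], []), (307131002, 107031014,
   [21430], [], []), (305021114, 107031014, [23014], [], [(2, 12034)]), (305110214, 107031014,
   [23104], [], [(2, 12304)]), (305111402, 107031014, [23140], [], [(2, 12340)]), (107021114,
   107031014, [23014, 0], [305021114], [(2, 12034), (1, 2134)]), (107110214, 107031014, [23104,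
   0], [305110214], [(2, 12304), (1, 2314)]), (107111402, 107031014, [23140, 0], [305111402], [(2,
   12340), (1, 2341)]), (102071114, 107021114, [2134], [], []), (701021114, 107021114, [10234],
   [], []), (701110214, 107021114, [10324], [], []), (701111402, 107021114, [10342], [], []),
   (711010214, 107021114, [13024], [], []), (711011402, 107021114, [13042], [], []), (711130202,
   107021114, [13402], [], [])]

/-- Pairs `(n, g)` such that the polynomials `∑ Sqⁿ(g)` give relations in weight `(3,4,4)`. -/
def w344Squares : List (List (ℕ × ℕ)) :=
  [[(2, 203060707)], [(2, 303060607)]]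

/-- The terms of weight `(3,4,4)` of the polynomials given by `w344Squares`. -/
def w344Relations : List (List ℕ) :=
  [[205060707, 403060707], [305060607, 503060607]]

/-- Rewriting rules in weight `(3,4,4)`. -/
def w344Rules : List (ℕ × List ℕ) :=
  [(106060707, []), (106070607, []), (106070706, []), (107060607, []), (107060706, []),
   (107070606, []), (502060707, []), (502070607, []), (502070706, []), (503060607, [305060607]),
   (503060706, [305060706]), (503070606, [305070606]), (506020707, []), (506030607, [305060607]),
   (506030706, [305060706]), (506060307, [305060607]), (506060703, [305060706]), (506070207, []),
   (506070306, [305070606]), (506070603, [305070606]), (506070702, []), (507020607, []),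
   (507020706, []), (507030606, [307050606]), (507060207, []), (507060306, [307050606]),
   (507060603, [307050606]), (507060702, []), (507070206, []), (507070602, []), (701060607, []),
   (701060706, []), (701070606, []), (705020607, []), (705020706, []), (705030606, [703050606]),
   (705060207, []), (705060306, [703050606]), (705060603, [703050606]), (705060702, []),
   (705070206, []), (705070602, []), (707010606, []), (707050206, []), (707050602, [])]

/-- For each rule in `w344Rules`, the index of a relation in `w344Relations` and a
permutation of the variables. -/
def w344RuleSources : List (ℕ × ℕ) :=
  [(0, 1234), (0, 1324), (0, 1342), (0, 3124), (0, 3142), (0, 3412), (0, 10234), (0, 10324), (0,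
   10342), (1, 1234), (1, 1243), (1, 1423), (0, 12034), (1, 2134), (1, 2143), (1, 2314), (1,
   2341), (0, 12304), (1, 2413), (1, 2431), (0, 12340), (0, 13024), (0, 13042), (1, 4123), (0,
   13204), (1, 4213), (1, 4231), (0, 13240), (0, 13402), (0, 13420), (0, 30124), (0, 30142), (0,
   30412), (0, 31024), (0, 31042), (1, 40123), (0, 31204), (1, 40213), (1, 40231), (0, 31240), (0,
   31402), (0, 31420), (0, 34012), (0, 34102), (0, 34120)]

/-- Pairs `(n, g)` such that the polynomials `∑ Sqⁿ(g)` give relations in weight `(3,4,4,1)`. -/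
def w3441Squares : List (List (ℕ × ℕ)) :=
  [[(4, 506060707)]]

/-- The terms of weight `(3,4,4,1)` of the polynomials given by `w3441Squares`. -/
def w3441Relations : List (List ℕ) :=
  [[506060711, 506061107, 506100707, 510060707, 906060707]]

/-- Monomials of weight `(3,4,4,1)`, with permuted relations from `w3441Relations`
that express them by smaller monomials. -/
def w3441Reductions : List (ℕ × List (ℕ × ℕ)) :=
  [(305061407, [(0, 1234)]), (305140607, [(0, 1324)]), (305140706, [(0, 1342)]), (313060607, [(0,
   3124)]), (313060706, [(0, 3142)]), (313070606, [(0, 3412)]), (1105060607, [(0, 30124)]),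
   (1105060706, [(0, 30142)]), (1105070606, [(0, 30412)]), (1107050606, [(0, 34012)])]

/-- Monomials of weight `(3,4,4,1)` whose coefficients have sum zero in hit polynomials. -/
def w3441Functional : List ℕ :=
  [1503050606, 1503060506, 1503060605, 1505030606, 1505060306, 1505060603, 1506030506, 1506030605,
   1506050306, 1506050603, 1506060305, 1506060503, 1505050505, 1503030905, 1503090305, 1503090503,
   1505030903, 1509030305, 1509050303, 1505030705, 1505070305, 1505070503, 1507050305, 2303030303,
   1503031103, 1511030303]

/-- The indices and the codes of the monomials `a_t` of weight `(3,4,4,1)`, and words after which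
`w3441Functional` separates them. -/
def w3441Separation : List (ℕ × ℕ × List ℕ) :=
  [(215, 1503050606, []), (214, 315050606, [10234]), (213, 305150606, [20134]), (212, 305061506,
   [30124]), (211, 305060615, [40123]), (225, 711050606, [0, 10234]), (224, 703130606, [2134, 0,
   10234]), (223, 703051406, [3124, 0, 10234]), (222, 703050614, [4123, 0, 10234]), (221,
   307130606, [12034, 0, 10234]), (220, 307051406, [13024, 0, 10234]), (219, 307050614, [14023, 0,
   10234]), (218, 305071406, [23014, 0, 10234]), (217, 305070614, [24013, 0, 10234]), (216,
   305060714, [34012, 0, 10234])]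

/-- The monomials `a_t` of weight `(3,4,4,1)` as combinations of images of earlier ones, with the
relations from `w3441Relations` that are used. -/
def w3441Generation : List (ℕ × ℕ × List ℕ × List ℕ × List (ℕ × ℕ)) :=
  [(703130606, 711050606, [2134], [], []), (703051406, 711050606, [2314], [], []), (703050614,
   711050606, [2341], [], []), (307130606, 711050606, [20134], [], []), (307051406, 711050606,
   [20314], [], []), (307050614, 711050606, [20341], [], []), (305071406, 711050606, [23014], [],
   []), (305070614, 711050606, [23041], [], []), (305060714, 711050606, [23401], [], []),
   (315050606, 711050606, [1234, 0], [711050606], []), (305150606, 315050606, [2134], [], []),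
   (305061506, 315050606, [2314], [], []), (305060615, 315050606, [2341], [], []), (1503050606,
   315050606, [10234], [], [])]

end Tables

/-! ### Verification of the certificates -/

section Verification

/-- Both relations come from Sq¹. Up to order, exponents congruent to (0,2,3,3,3) modulo 4 give
trivial monomials, and in residues (1,2,2,3,3) the 1 can be exchanged with a 2, hence moved in front
of both. -/
theorem reduces_w34 {ω : ℕ →₀ ℕ} (hw : ∀ i < 2, ω i = [3, 4].getD i 0) {t : ℕ} (ht : 2 ≤ t) :
    Reduces ω t (step 2 w34Rules) :=
  reduces_step ht (relation_of_areRules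
    (relation_of_areSquares (w := [3, 4]) hw w34Squares w34Relations (by decide +kernel))
    Reduces.singleton w34Rules w34RuleSources (by decide +kernel))

theorem reduces_w342 {ω : ℕ →₀ ℕ} (hw : ∀ i < 3, ω i = [3, 4, 2].getD i 0) {t : ℕ} (ht : 3 ≤ t) :
    Reduces ω t (step 3 w342Rules) :=
  reduces_step ht (relation_of_areRules
    (relation_of_areSquares (w := [3, 4, 2]) hw w342Squares w342Relations (by decide +kernel))
    (reduces_w34 (fun i hi => (hw i (by omega)).trans (by interval_cases i <;> rfl)) (by norm_num))
    w342Rules w342RuleSources (by decide +kernel))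

/-- Both relations come from Sq². After the two-digit rules, the first says that residues
(1,6,6,7,7) modulo 8 give trivial monomials; the second exchanges the 3 and the 5 in (3,5,6,6,7). -/
theorem reduces_w344 {ω : ℕ →₀ ℕ} (hw : ∀ i < 3, ω i = [3, 4, 4].getD i 0) {t : ℕ} (ht : 3 ≤ t) :
    Reduces ω t (step 3 w344Rules) :=
  reduces_step ht (relation_of_areRules
    (relation_of_areSquares (w := [3, 4, 4]) hw w344Squares w344Relations (by decide +kernel))
    (reduces_w34 (fun i hi => (hw i (by omega)).trans (by interval_cases i <;> rfl)) (by norm_num))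
    w344Rules w344RuleSources (by decide +kernel))

/-- Reduction of monomials of weight `(3,4,2,2)` by the rules in weight `(3,4)` and `(3,4,2)`. -/
def w3422Reduce (x : ℕ) : List ℕ := (step 2 w34Rules x).flatMap (step 3 w342Rules)

/-- Reduction of monomials of weight `(3,4,4,1)` by the rules in weight `(3,4)` and `(3,4,4)`. -/
def w3441Reduce (x : ℕ) : List ℕ := (step 2 w34Rules x).flatMap (step 3 w344Rules)

theorem omega4_apply (i : ℕ) : omega4 i = [3, 4, 2, 2].getD i 0 := rfl

theorem omega5_apply (i : ℕ) : omega5 i = [3, 4, 4, 1].getD i 0 := rfl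

theorem wdeg_eq_sum_range {ω : ℕ →₀ ℕ} {w : List ℕ} (hw : ∀ i, ω i = w.getD i 0) :
    wdeg ω = ∑ i ∈ Finset.range w.length, 2 ^ i * w.getD i 0 := by
  rw [wdeg, Finsupp.sum_of_support_subset (s := Finset.range w.length)]
  · exact Finset.sum_congr rfl fun i _ => by rw [hw]
  · intro i hi
    rw [Finset.mem_range]
    by_contra h
    rw [Finsupp.mem_support_iff, hw, List.getD_eq_default _ _ (not_lt.1 h)] at hi
    exact hi rfl
  · simp

theorem a_eq_decode {t c : ℕ}
    (h : ∀ j : Fin 5, ((aTable.lookup t).getD 0) j = (digits c).getD j 0) : a t = decode c :=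
  Finsupp.ext h

theorem relation_w3422 : ∀ l ∈ w3422Relations, Relation omega4 4 l :=
  relation_of_areSquares (w := [3, 4, 2, 2]) (fun i _ => omega4_apply i) w3422Squares _
    (by decide +kernel)

theorem reduces_w3422 : Reduces omega4 4 w3422Reduce :=
  (reduces_w34 (fun i hi => by interval_cases i <;> rfl) (by norm_num)).comp
    (reduces_w342 (fun i hi => by interval_cases i <;> rfl) (by norm_num))

theorem relation_w3441 : ∀ l ∈ w3441Relations, Relation omega5 4 l :=
  relation_of_areSquares (w := [3, 4, 4, 1]) (fun i _ => omega5_apply i) w3441Squares _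
    (by decide +kernel)

theorem reduces_w3441 : Reduces omega5 4 w3441Reduce :=
  (reduces_w34 (fun i hi => by interval_cases i <;> rfl) (by norm_num)).comp
    (reduces_w344 (fun i hi => by interval_cases i <;> rfl) (by norm_num))

/-- There are 10·5·10·10 = 5000 monomials of this weight; all but the fifty listed are shown to
reduce. -/
theorem w3422_classifies :
    classifies [3, 4, 2, 2] 35 w3422Reduce w3422Relations w3422Reductions
      (w3422Separation.map (·.2.1)) = true := by
  decide +kernel

/-- The list also has monomials of weight above ω, such as (11,11,11,1,1): the sum must vanish on
all hit polynomials of degree 35, whatever their weights. -/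
theorem w3422_vanishes :
    vanishes 35 w3422Functional = true := by
  decide +kernel

theorem w3422_separates :
    separates [3, 4, 2, 2] w3422Functional w3422Separation = true := by
  decide +kernel

theorem w3422_generates :
    generates [3, 4, 2, 2] w3422Reduce w3422Relations [305031014] w3422Generation = true := by
  decide +kernel

theorem w3422_code :
    ∀ q ∈ w3422Separation, ∀ j : Fin 5,
      ((aTable.lookup q.1).getD 0) j = (digits q.2.1).getD j 0 := by
  decide +kernel

/-- There are 10·5·5·5 = 1250 monomials of this weight; all but the fifteen listed are shown to
reduce. -/
theorem w3441_classifies :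
    classifies [3, 4, 4, 1] 35 w3441Reduce w3441Relations w3441Reductions
      (w3441Separation.map (·.2.1)) = true := by
  decide +kernel

theorem w3441_vanishes :
    vanishes 35 w3441Functional = true := by
  decide +kernel

theorem w3441_separates :
    separates [3, 4, 4, 1] w3441Functional w3441Separation = true := by
  decide +kernel

/-- The transvection is needed once, to pass from a₂₂₅ to a₂₁₄; every other monomial is reached by a
permutation of the variables and the reduction rules. -/
theorem w3441_generates :
    generates [3, 4, 4, 1] w3441Reduce w3441Relations [711050606] w3441Generation = true := by
  decide +kernel

theorem w3441_code :
    ∀ q ∈ w3441Separation, ∀ j : Fin 5,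
      ((aTable.lookup q.1).getD 0) j = (digits q.2.1).getD j 0 := by
  decide +kernel

end Verification

end HitProblem

theorem mainTheorem7 :
    (∃ hmem : ∀ t ∈ Set.Icc (161 : ℕ) 210,
        HitProblem.mono (HitProblem.a t) ∈ HitProblem.PLe 5 HitProblem.omega4,
      HitProblem.admissibleMonomials 5 HitProblem.omega4
        = HitProblem.a '' Set.Icc (161 : ℕ) 210 ∧
      (∃ b : Module.Basis (Set.Icc (161 : ℕ) 210) (ZMod 2) (HitProblem.QP 5 HitProblem.omega4),
        ∀ t : Set.Icc (161 : ℕ) 210,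
          b t = HitProblem.cls (HitProblem.mono (HitProblem.a t)) (hmem t t.2)) ∧
      Module.finrank (ZMod 2) (HitProblem.QP 5 HitProblem.omega4) = 50 ∧
      HitProblem.Generates
        (HitProblem.cls (HitProblem.mono (HitProblem.a 203)) (hmem 203 (by simp)))) ∧
    (∃ hmem : ∀ t ∈ Set.Icc (211 : ℕ) 225,
        HitProblem.mono (HitProblem.a t) ∈ HitProblem.PLe 5 HitProblem.omega5,
      HitProblem.admissibleMonomials 5 HitProblem.omega5
        = HitProblem.a '' Set.Icc (211 : ℕ) 225 ∧
      (∃ b : Module.Basis (Set.Icc (211 : ℕ) 225) (ZMod 2) (HitProblem.QP 5 HitProblem.omega5),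
        ∀ t : Set.Icc (211 : ℕ) 225,
          b t = HitProblem.cls (HitProblem.mono (HitProblem.a t)) (hmem t t.2)) ∧
      Module.finrank (ZMod 2) (HitProblem.QP 5 HitProblem.omega5) = 15 ∧
      HitProblem.Generates
        (HitProblem.cls (HitProblem.mono (HitProblem.a 225)) (hmem 225 (by simp)))) := by
  constructor
  · obtain ⟨hmem, h1, h2, h3, h4⟩ := HitProblem.exists_basis_and_generates_of_checks
      HitProblem.omega4_apply (HitProblem.wdeg_eq_sum_range HitProblem.omega4_apply)
      HitProblem.relation_w3422 HitProblem.reduces_w3422 (lo := 161) (hi := 210) (t := 203)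
      HitProblem.w3422_classifies HitProblem.w3422_vanishes (by decide +kernel)
      HitProblem.w3422_separates (by decide +kernel)
      (fun q hq => HitProblem.a_eq_decode (HitProblem.w3422_code q hq)) (by decide +kernel)
      HitProblem.w3422_generates (by decide +kernel)
      -- The seed `305031014` of the generation table is the code of a₂₀₃.
      (HitProblem.a_eq_decode (by decide +kernel)) (by simp)
    exact ⟨hmem, h1, h2, h3.trans (by simp), h4⟩
  · obtain ⟨hmem, h1, h2, h3, h4⟩ := HitProblem.exists_basis_and_generates_of_checks
      HitProblem.omega5_apply (HitProblem.wdeg_eq_sum_range HitProblem.omega5_apply)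
      HitProblem.relation_w3441 HitProblem.reduces_w3441 (lo := 211) (hi := 225) (t := 225)
      HitProblem.w3441_classifies HitProblem.w3441_vanishes (by decide +kernel)
      HitProblem.w3441_separates (by decide +kernel)
      (fun q hq => HitProblem.a_eq_decode (HitProblem.w3441_code q hq)) (by decide +kernel)
      HitProblem.w3441_generates (by decide +kernel)
      (HitProblem.a_eq_decode (by decide +kernel)) (by simp)
    exact ⟨hmem, h1, h2, h3.trans (by simp), h4⟩
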